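/- **Setting.** Let $R$ be a monoid with unit group $W=G(R)$ and set of idempotents $E(R)$. $R$ is *factorisable* if $R=E(R)W=WE(R)$ and idempotents commute; then $E(R)$ is ordered by $e\le f\iff ef=e$. For $e\in E(R)$ put $W(e)=\{w\in W\mid we=ew\}$ and $W_\star(e)=\{w\in W\mid we=ew=e\}$. A *generalised Renner–Coxeter system* is a triple $(R,\Lambda,S)$ such that: 1. $R$ is a factorisable monoid; 2. $\Lambda\subseteq E(R)$ is closed under products and contains exactly one element of each orbit of $W$ acting on $E(R)$ by conjugation; 3. $(W,S)$ is a Coxeter system, with Coxeter matrix $(m_{s,t})$; 4. whenever $e_1\le e_2$ in $E(R)$, there are $w\in W$ and $f_1\le f_2$ in $\Lambda$ with $wf_iw^{-1}=e_i$ for $i=1,2$; 5. for every $e\in\Lambda$, $W(e)$ and $W_\star(e)$ are standard parabolic subgroups of $W$ (each is the subgroup $W_I$ generated by some $I\subseteq S$); 6. for $e\le f$ in $\Lambda$ one has $\lambda^\star(e)\subseteq\lambda^\star(f)$, where $\lambda^\star(e)=\{s\in S\mid se=es\ne e\}$. Put $\lambda_\star(e)=\{s\in S\mid se=es=e\}$,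 $\lambda(e)=S\cap W(e)$ (so that $W(e)=W_{\lambda(e)}$) and $\Lambda_\circ=\Lambda\setminus\{1\}$. On $W$, $\ell$ is the Coxeter length. For $r\in R$, $\ell(r)$ is the minimal number of letters from $S$ in a word on $S\cup\Lambda_\circ$ that represents $r$ (letters from $\Lambda_\circ$ have length $0$). Let $\mathrm{Red}(e,f)$ be the set of $w\in W$ that have minimal length in the double coset $W_{\lambda(e)}\,w\,W_{\lambda(f)}$. For $w\in\mathrm{Red}(e,f)$, $e\wedge_wf$ denotes the element $h\in\Lambda$ such that $w\in W(h)$ and $ewf=wh$. Let $q$ be an indeterminate and $V$ the free $\mathbb Z[q]$-module with basis $(T_r)_{r\in R}$. The *generic Hecke algebra* $\mathcal H(R)$ is $V$ with the unique structure of associative unital $\mathbb Z[q]$-algebra with unit $T_1$ such that for all $r\in R$, $s\in S$, $e\in\Lambda_\circ$: $$T_sT_r=\begin{cases}T_{sr}&\text{if }\ell(sr)=\ell(r)+1,\\ qT_r&\text{if }\ell(sr)=\ell(r),\\ (q-1)T_r+qT_{sr}&\text{if }\ell(sr)=\ell(r)-1,\end{cases}\qquad T_eT_r=q^{\ell(r)-\ell(er)}T_{er}.$$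 **Statement.** Let $(R,\Lambda,S)$ be a generalised Renner–Coxeter system, and fix for every $w\in W$ an arbitrary reduced word of $w$ on $S$. Then there is exactly one algebra structure on $V$ as above, so $\mathcal H(R)$ is well defined. For all $e,f\in\Lambda_\circ$ and $w\in\mathrm{Red}(e,f)$ the element $e\wedge_wf$ exists, is unique and lies in $\Lambda_\circ$. Finally, $\mathcal H(R)$ admits the following presentation as a $\mathbb Z[q]$-algebra: the generators are the $T_x$ with $x\in S\cup\Lambda_\circ$ (corresponding to the basis elements $T_x$ of $\mathcal H(R)$), and the defining relations are * (HEC1) $T_s^2=(q-1)T_s+q\cdot 1$ for $s\in S$; * (HEC2) $T_sT_tT_s\cdots=T_tT_sT_t\cdots$ ($m_{s,t}$ factors on each side) for $s\ne t$ in $S$ with $m_{s,t}<\infty$; * (HEC3) $T_sT_e=T_eT_s$ for $e\in\Lambda_\circ$, $s\in\lambda^\star(e)$; * (HEC4) $T_sT_e=T_eT_s=qT_e$ for $e\in\Lambda_\circ$, $s\in\lambda_\star(e)$; * (HEC5) $T_eT_wT_f=q^{\ell(w)}T_{e\wedge_wf}$ for $e,f\in\Lambda_\circ$, $w\in\mathrm{Red}(e,f)$,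 where $T_w=T_{s_1}\cdots T_{s_k}$ for the fixed reduced word $s_1\cdots s_k$ of $w$. -/

import Mathlib

open Polynomial

noncomputable section

/-- A monoid is factorisable if every element is the product of an idempotent and a unit, in either
order, and its idempotents commute (so that they form a lower semi-lattice, with
`e ≤ f` iff `e * f = e`). -/
structure IsFactorisableMonoid (R : Type*) [Monoid R] : Prop where
  exists_idempotent_mul_unit : ∀ r : R, ∃ (e : R) (u : Rˣ), IsIdempotentElem e ∧ r = e * u
  exists_unit_mul_idempotent : ∀ r : R, ∃ (u : Rˣ) (e : R), IsIdempotentElem e ∧ r = u * e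
  idempotents_commute : ∀ e f : R, IsIdempotentElem e → IsIdempotentElem f → e * f = f * e

/-- The subgroup `W(e)` of the units `w` with `w e = e w`. -/
def unitCentralizer {R : Type*} [Monoid R] (e : R) : Subgroup Rˣ where
  carrier := {w | (w : R) * e = e * w}
  one_mem' := by simp
  mul_mem' := by
    intro a b ha hb
    simp only [Set.mem_ofPred_eq, Units.val_mul] at *
    rw [mul_assoc, hb, ← mul_assoc, ha, mul_assoc]
  inv_mem' := by
    intro a ha
    simp only [Set.mem_ofPred_eq] at *
    rw [Units.inv_mul_eq_iff_eq_mul, ← mul_assoc, ha, mul_assoc, Units.mul_inv, mul_one]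

/-- The subgroup `W_⋆(e)` of the units `w` with `w e = e w = e`. -/
def unitStabilizer {R : Type*} [Monoid R] (e : R) : Subgroup Rˣ where
  carrier := {w | (w : R) * e = e ∧ e * w = e}
  one_mem' := by simp
  mul_mem' := by
    rintro a b ⟨ha, ha'⟩ ⟨hb, hb'⟩
    simp only [Set.mem_ofPred_eq, Units.val_mul]
    exact ⟨by rw [mul_assoc, hb, ha], by rw [← mul_assoc, ha', hb']⟩
  inv_mem' := by
    rintro a ⟨ha, ha'⟩
    simp only [Set.mem_ofPred_eq]
    exact ⟨by rw [Units.inv_mul_eq_iff_eq_mul, ha], by rw [Units.mul_inv_eq_iff_eq_mul, ha']⟩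

/-- The standard parabolic subgroup `W_I` generated by the simple reflections indexed by `I`. -/
def standardParabolic {B W : Type*} [Group W] {M : CoxeterMatrix B} (cs : CoxeterSystem M W)
    (I : Set B) : Subgroup W :=
  Subgroup.closure (cs.simple '' I)

/-- `w` has minimal length in the double coset `W_I w W_J`. -/
def IsDoubleReduced {B W : Type*} [Group W] {M : CoxeterMatrix B} (cs : CoxeterSystem M W)
    (I J : Set B) (w : W) : Prop :=
  ∀ a ∈ standardParabolic cs I, ∀ b ∈ standardParabolic cs J, cs.length w ≤ cs.length (a * w * b)

/-- `λ_⋆(e)`: the simple reflections `s` with `s e = e s = e`. Here and below simple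
reflections are given by their indices. -/
def lowerType {B R : Type*} [Monoid R] {M : CoxeterMatrix B} (cs : CoxeterSystem M Rˣ)
    (e : R) : Set B :=
  {i | (cs.simple i : R) * e = e ∧ e * (cs.simple i : R) = e}

/-- `λ^⋆(e)`: the simple reflections `s` with `s e = e s ≠ e`. -/
def upperType {B R : Type*} [Monoid R] {M : CoxeterMatrix B} (cs : CoxeterSystem M Rˣ)
    (e : R) : Set B :=
  {i | (cs.simple i : R) * e = e * (cs.simple i : R) ∧ e * (cs.simple i : R) ≠ e}

/-- The type `λ(e)`: the simple reflections that lie in `W(e)`. -/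
def typeMap {B R : Type*} [Monoid R] {M : CoxeterMatrix B} (cs : CoxeterSystem M Rˣ)
    (e : R) : Set B :=
  {i | cs.simple i ∈ unitCentralizer e}

/-- A generalised Renner-Coxeter system `(R, Λ, S)`. The set `S` is the set of simple reflections
of a Coxeter system on the group of units of `R`, with Coxeter matrix `M` (where the entry `0`
stands for `∞`). -/
structure RennerCoxeterSystem {B : Type*} (M : CoxeterMatrix B) (R : Type*) [Monoid R] where
  /-- the Coxeter system on the group of units -/
  cs : CoxeterSystem M Rˣ
  /-- the cross section lattice -/
  Λ : Set R
  factorisable : IsFactorisableMonoid R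
  isIdempotentElem : ∀ e ∈ Λ, IsIdempotentElem e
  transversal : ∀ e : R, IsIdempotentElem e →
    ∃! f : R, f ∈ Λ ∧ ∃ w : Rˣ, (w : R) * f * ((w⁻¹ : Rˣ) : R) = e
  mul_mem : ∀ e ∈ Λ, ∀ f ∈ Λ, e * f ∈ Λ
  conj_pair : ∀ e₁ e₂ : R, IsIdempotentElem e₁ → IsIdempotentElem e₂ → e₁ * e₂ = e₁ →
    ∃ (w : Rˣ) (f₁ f₂ : R), f₁ ∈ Λ ∧ f₂ ∈ Λ ∧ f₁ * f₂ = f₁ ∧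
      (w : R) * f₁ * ((w⁻¹ : Rˣ) : R) = e₁ ∧ (w : R) * f₂ * ((w⁻¹ : Rˣ) : R) = e₂
  centralizer_parabolic : ∀ e ∈ Λ, ∃ I : Set B, unitCentralizer e = standardParabolic cs I
  stabilizer_parabolic : ∀ e ∈ Λ, ∃ I : Set B, unitStabilizer e = standardParabolic cs I
  upperType_mono : ∀ e ∈ Λ, ∀ f ∈ Λ, e * f = e → upperType cs e ⊆ upperType cs f

namespace RennerCoxeterSystem

variable {B R : Type*} [Monoid R] {M : CoxeterMatrix B} (𝓡 : RennerCoxeterSystem M R)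

/-- `Λ∘ = Λ \ {1}`. -/
def LambdaCirc : Set R := 𝓡.Λ \ {1}

/-- The alphabet `S ∪ Λ∘`. -/
abbrev Letter : Type _ := B ⊕ 𝓡.LambdaCirc

/-- The element of `R` represented by a letter. -/
def letterVal : 𝓡.Letter → R
  | Sum.inl i => (𝓡.cs.simple i : R)
  | Sum.inr e => e

/-- The length of a letter: `1` on `S` and `0` on `Λ∘`. -/
def letterLength : 𝓡.Letter → ℕ
  | Sum.inl _ => 1
  | Sum.inr _ => 0

/-- The length of `r ∈ R`: the minimal length of a word on `S ∪ Λ∘` that represents `r`. -/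
def length (r : R) : ℕ :=
  sInf {n | ∃ ω : List 𝓡.Letter, (ω.map 𝓡.letterVal).prod = r ∧ (ω.map 𝓡.letterLength).sum = n}

/-- Every element of `R` is represented by a word on `S ∪ Λ∘`. -/
theorem exists_word (r : R) : ∃ ω : List 𝓡.Letter, (ω.map 𝓡.letterVal).prod = r := by
  have hu : ∀ u : Rˣ, ∃ ω : List 𝓡.Letter, (ω.map 𝓡.letterVal).prod = u := by
    intro u
    obtain ⟨ω, rfl⟩ := 𝓡.cs.wordProd_surjective u
    refine ⟨ω.map Sum.inl, ?_⟩
    induction ω with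
    | nil => simp
    | cons a l ih =>
      rw [List.map_cons, List.map_cons, List.prod_cons, ih, CoxeterSystem.wordProd_cons,
        Units.val_mul]
      rfl
  obtain ⟨e, u, he, rfl⟩ := 𝓡.factorisable.exists_idempotent_mul_unit r
  obtain ⟨f, ⟨hf, w, rfl⟩, -⟩ := 𝓡.transversal e he
  obtain ⟨a, ha⟩ := hu w
  obtain ⟨b, hb⟩ := hu (w⁻¹ : Rˣ)
  obtain ⟨c, hc⟩ := hu u
  by_cases h1 : f = 1
  · exact ⟨a ++ b ++ c, by simp [ha, hb, hc, h1]⟩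
  · exact ⟨a ++ [Sum.inr ⟨f, hf, h1⟩] ++ b ++ c, by simp [ha, hb, hc, letterVal, mul_assoc]⟩

/-- `ℓ(er) ≤ ℓ(r)` for `e ∈ Λ∘`. -/
theorem length_lambda_mul_le {e : R} (he : e ∈ 𝓡.LambdaCirc) (r : R) :
    𝓡.length (e * r) ≤ 𝓡.length r := by
  obtain ⟨ω, h⟩ := 𝓡.exists_word r
  obtain ⟨ω', h1, h2⟩ := Nat.sInf_mem (s := {n | ∃ ω : List 𝓡.Letter,
    (ω.map 𝓡.letterVal).prod = r ∧ (ω.map 𝓡.letterLength).sum = n}) ⟨_, ω, h, rfl⟩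
  refine Nat.sInf_le ⟨Sum.inr ⟨e, he⟩ :: ω', ?_, ?_⟩
  · simp [h1, letterVal]
  · simpa [letterLength, length] using h2

/-- `Red(e, f)`: the units of minimal length in their double coset `W(e) w W(f)`. -/
def Red (e f : R) : Set Rˣ :=
  {w | IsDoubleReduced 𝓡.cs (typeMap 𝓡.cs e) (typeMap 𝓡.cs f) w}

/-- `h` is the element `e ∧_w f` of `Λ`: the unit `w` lies in `W(h)` and `e w f = w h`. -/
def IsWedge (e : R) (w : Rˣ) (f h : R) : Prop :=
  h ∈ 𝓡.Λ ∧ w ∈ unitCentralizer h ∧ e * w * f = w * h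

/-- The basis element `T_r` of the free `ℤ[q]`-module on `R`. -/
def basisT (r : R) : R →₀ ℤ[X] := Finsupp.single r 1

/-- The bilinear product `μ` is a structure of associative `ℤ[q]`-algebra with unit `T_1` on the
free module with basis `(T_r)`, and left multiplication by the `T_x`, `x ∈ S ∪ Λ∘`, is given by the
defining formulas of the generic Hecke algebra. (In the last formula, `ℓ(er) ≤ ℓ(r)` by
`length_lambda_mul_le`.) -/
structure IsHeckeMul (μ : (R →₀ ℤ[X]) →ₗ[ℤ[X]] (R →₀ ℤ[X]) →ₗ[ℤ[X]] (R →₀ ℤ[X])) : Prop where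
  assoc : ∀ a b c, μ (μ a b) c = μ a (μ b c)
  one_left : ∀ a, μ (basisT 1) a = a
  one_right : ∀ a, μ a (basisT 1) = a
  simple_up : ∀ (i : B) (r : R), 𝓡.length (𝓡.cs.simple i * r) = 𝓡.length r + 1 →
    μ (basisT (𝓡.cs.simple i : R)) (basisT r) = basisT (𝓡.cs.simple i * r)
  simple_eq : ∀ (i : B) (r : R), 𝓡.length (𝓡.cs.simple i * r) = 𝓡.length r →
    μ (basisT (𝓡.cs.simple i : R)) (basisT r) = (X : ℤ[X]) • basisT r
  simple_down : ∀ (i : B) (r : R), 𝓡.length (𝓡.cs.simple i * r) + 1 = 𝓡.length r →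
    μ (basisT (𝓡.cs.simple i : R)) (basisT r) =
      (X - 1 : ℤ[X]) • basisT r + (X : ℤ[X]) • basisT (𝓡.cs.simple i * r)
  lambda_mul : ∀ e ∈ 𝓡.LambdaCirc, ∀ r : R,
    μ (basisT e) (basisT r) =
      (X ^ (𝓡.length r - 𝓡.length (e * r)) : ℤ[X]) • basisT (e * r)

/-- The algebra given by the product `μ`. When `μ` is the unique product with `IsHeckeMul`, this
is the generic Hecke algebra `H(R)`. -/
@[nolint unusedArguments]
def HeckeAlgebra {𝓡 : RennerCoxeterSystem M R}
    {μ : (R →₀ ℤ[X]) →ₗ[ℤ[X]] (R →₀ ℤ[X]) →ₗ[ℤ[X]] (R →₀ ℤ[X])}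
    (_ : 𝓡.IsHeckeMul μ) : Type _ := R →₀ ℤ[X]

namespace HeckeAlgebra

variable {𝓡}
variable {μ : (R →₀ ℤ[X]) →ₗ[ℤ[X]] (R →₀ ℤ[X]) →ₗ[ℤ[X]] (R →₀ ℤ[X])} (hμ : 𝓡.IsHeckeMul μ)

instance : AddCommGroup (HeckeAlgebra hμ) := inferInstanceAs (AddCommGroup (R →₀ ℤ[X]))

instance : Module ℤ[X] (HeckeAlgebra hμ) := inferInstanceAs (Module ℤ[X] (R →₀ ℤ[X]))

instance : Ring (HeckeAlgebra hμ) :=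
  { (inferInstance : AddCommGroup (HeckeAlgebra hμ)) with
    mul := fun a b => μ a b
    one := basisT 1
    mul_assoc := hμ.assoc
    one_mul := hμ.one_left
    mul_one := hμ.one_right
    left_distrib := fun a b c => (μ a).map_add b c
    right_distrib := fun a b c => μ.map_add₂ a b c
    zero_mul := fun a => μ.map_zero₂ a
    mul_zero := fun a => (μ a).map_zero }

instance : Algebra ℤ[X] (HeckeAlgebra hμ) :=
  Algebra.ofModule (fun c a b => μ.map_smul₂ c a b) (fun c a b => (μ a).map_smul c b)

/-- The basis element `T_r`, as an element of the algebra. -/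
def T (r : R) : HeckeAlgebra hμ := (basisT r : R →₀ ℤ[X])

end HeckeAlgebra

/-- The alternating product `a b a ⋯` with `m` factors. -/
def altProd {A : Type*} [Monoid A] : A → A → ℕ → A
  | _, _, 0 => 1
  | a, b, m + 1 => a * altProd b a m

/-- The generator `T_s` of the free algebra on `S ∪ Λ∘`. -/
def genS (i : B) : FreeAlgebra ℤ[X] 𝓡.Letter := FreeAlgebra.ι ℤ[X] (Sum.inl i)

/-- The generator `T_e` of the free algebra on `S ∪ Λ∘`. -/
def genΛ (e : 𝓡.LambdaCirc) : FreeAlgebra ℤ[X] 𝓡.Letter := FreeAlgebra.ι ℤ[X] (Sum.inr e)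

/-- The product `T_{s₁} ⋯ T_{s_k}` for a word `s₁ ⋯ s_k` on `S`. -/
def genWord (ω : List B) : FreeAlgebra ℤ[X] 𝓡.Letter := (ω.map 𝓡.genS).prod

/-- The defining relations; `word w` is the chosen reduced word of `w`, used to write `T_w`. -/
inductive HeckeRel (word : Rˣ → List B) :
    FreeAlgebra ℤ[X] 𝓡.Letter → FreeAlgebra ℤ[X] 𝓡.Letter → Prop
  | quadratic (i : B) :
      HeckeRel word (𝓡.genS i * 𝓡.genS i) ((X - 1 : ℤ[X]) • 𝓡.genS i + (X : ℤ[X]) • 1)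
  | braid (i j : B) (hij : i ≠ j) (hM : M i j ≠ 0) :
      HeckeRel word (altProd (𝓡.genS i) (𝓡.genS j) (M i j))
        (altProd (𝓡.genS j) (𝓡.genS i) (M i j))
  | upper (i : B) (e : 𝓡.LambdaCirc) (hi : i ∈ upperType 𝓡.cs (e : R)) :
      HeckeRel word (𝓡.genS i * 𝓡.genΛ e) (𝓡.genΛ e * 𝓡.genS i)
  | lower_left (i : B) (e : 𝓡.LambdaCirc) (hi : i ∈ lowerType 𝓡.cs (e : R)) :
      HeckeRel word (𝓡.genS i * 𝓡.genΛ e) ((X : ℤ[X]) • 𝓡.genΛ e)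
  | lower_right (i : B) (e : 𝓡.LambdaCirc) (hi : i ∈ lowerType 𝓡.cs (e : R)) :
      HeckeRel word (𝓡.genΛ e * 𝓡.genS i) ((X : ℤ[X]) • 𝓡.genΛ e)
  | wedge (e f h : 𝓡.LambdaCirc) (w : Rˣ) (hw : w ∈ 𝓡.Red (e : R) f)
      (hh : 𝓡.IsWedge (e : R) w f h) :
      HeckeRel word (𝓡.genΛ e * 𝓡.genWord (word w) * 𝓡.genΛ f)
        ((X ^ 𝓡.cs.length w : ℤ[X]) • 𝓡.genΛ h)

/-- The `ℤ[q]`-algebra given by the generators `T_x`, `x ∈ S ∪ Λ∘`, and the defining relations. -/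
abbrev PresentedHecke (word : Rˣ → List B) : Type _ := RingQuot (𝓡.HeckeRel word)

/-- The class of the generator `T_x` in the presented algebra. -/
def presentedGen (word : Rˣ → List B) (x : 𝓡.Letter) : 𝓡.PresentedHecke word :=
  RingQuot.mkAlgHom ℤ[X] (𝓡.HeckeRel word) (FreeAlgebra.ι ℤ[X] x)

end RennerCoxeterSystem

end

/-!
A simple reflection acts on `W × ℤ/2` by conjugation, with a change of sign at the reflection
itself. This gives the exchange property, hence the theory of minimal coset representatives for
standard parabolic subgroups. The geometric representation shows that `s t` has order exactly
`m_{s,t}`, and Matsumoto's theorem follows.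

In `R`, the subgroups `W_{λ^⋆(e)}` and `W_⋆(e)` commute and generate `W(e)`. Every element is
`u g v` for a unique `g ∈ Λ` and unique units `u`, `v` of minimal length in `u W_⋆(g)` and
`W(g) v`, and its length is then `ℓ(u) + ℓ(v)`. This brings the effect of left and right
multiplication by simple reflections on `ℓ` down to the exchange property in `W`.

For the algebra, consider the operators on `V` by which the `T_x`, `x ∈ S ∪ Λ∘`, have to act from
the left, and their mirror images under the involution `e u ↦ u⁻¹ e` of `R`, which should act from
the right. The left operators commute with the right ones, and the right ones generate `V` from
`T_1`; so an identity between left operators holds as soon as it holds at `T_1`. In this way the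
left operators satisfy the defining relations, and the presented algebra acts on `V`. By the
relations, the elements `T_u T_g T_v` with `u g v` in normal form span the presented algebra, and
they send `T_1` to the basis `T_{ugv}` of `V`. So evaluation at `T_1` is a linear isomorphism of
the presented algebra with `V`, and the product of `V` is transported along it.
-/

namespace CoxeterGroup

open CoxeterSystem

variable {B W : Type*} [Group W] {M : CoxeterMatrix B} (cs : CoxeterSystem M W)

section Exchange

open Classical in
/-- The action of the simple reflection `s` on `W × ℤ/2`: conjugation on `W`, with a change of sign
exactly at `s`. It extends to an action of `W`, so the parity of the number of occurrences of `t` in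
the right inversion sequence of a word depends only on the product of the word. -/
noncomputable def signedConj (i : B) : Function.End (W × ZMod 2) := fun p =>
  (cs.simple i * p.1 * cs.simple i, p.2 + if p.1 = cs.simple i then 1 else 0)

open Classical in
theorem prod_map_signedConj_apply (ω : List B) (t : W) (ε : ZMod 2) :
    (ω.map (signedConj cs)).prod (t, ε) =
      (cs.wordProd ω * t * (cs.wordProd ω)⁻¹, ε + ((cs.rightInvSeq ω).count t : ℕ)) := by
  induction ω with
  | nil => simp [Function.End.one_def]
  | cons i ω ih =>
    have conj_eq_simple_iff : cs.wordProd ω * t * (cs.wordProd ω)⁻¹ = cs.simple i ↔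
        (cs.wordProd ω)⁻¹ * cs.simple i * cs.wordProd ω = t := by
      rw [mul_inv_eq_iff_eq_mul, mul_assoc, inv_mul_eq_iff_eq_mul, eq_comm]
    rw [List.map_cons, List.prod_cons]
    change signedConj cs i ((ω.map (signedConj cs)).prod (t, ε)) = _
    rw [ih]
    simp only [signedConj, rightInvSeq, List.count_cons, wordProd_cons, mul_inv_rev, inv_simple,
      Prod.mk.injEq, conj_eq_simple_iff, beq_iff_eq]
    refine ⟨by simp only [mul_assoc], ?_⟩
    push_cast
    split_ifs <;> simp [add_assoc]

-- The inversion sequence of `(s t)^m` is the concatenation of two copies of that of `s t s ⋯`.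
theorem even_count_leftInvSeq_alternatingWord [DecidableEq W] (i j : B) (t : W) :
    Even ((cs.leftInvSeq (alternatingWord i j (2 * M i j))).count t) := by
  set l := cs.leftInvSeq (alternatingWord i j (2 * M i j)) with hl
  have hlen : l.length = 2 * M i j := by simp [hl]
  have take_eq_drop : l.take (M i j) = l.drop (M i j) := by
    apply List.ext_getElem
    · simp only [List.length_take, List.length_drop, hlen]
      omega
    · intro k hk _
      simp only [List.length_take, hlen] at hk
      simp only [List.getElem_take, List.getElem_drop, hl]
      rw [cs.getElem_leftInvSeq_alternatingWord i j _ k (by omega),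
        cs.getElem_leftInvSeq_alternatingWord i j _ (M i j + k) (by omega),
        prod_alternatingWord_eq_mul_pow, prod_alternatingWord_eq_mul_pow,
        show (2 * k + 1) / 2 = k by omega,
        show (2 * (M i j + k) + 1) / 2 = M i j + k by omega, pow_add, simple_mul_simple_pow']
      simp
  rw [← List.take_append_drop (M i j) l, List.count_append, take_eq_drop]
  exact ⟨_, rfl⟩

theorem prod_map_reverse_alternatingWord {G : Type*} [Monoid G] (f : B → G) (i j : B) (p : ℕ) :
    ((alternatingWord i j (2 * p)).reverse.map f).prod = (f j * f i) ^ p := by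
  induction p with
  | zero => simp [alternatingWord]
  | succ p ih =>
    rw [show 2 * (p + 1) = 2 * p + 1 + 1 by ring, alternatingWord_succ, alternatingWord_succ,
      pow_succ', ← ih]
    simp [mul_assoc]

theorem isLiftable_signedConj : M.IsLiftable (signedConj cs) := by
  classical
  intro j i
  have wordProd_eq_one : cs.wordProd (alternatingWord i j (2 * M i j)).reverse = 1 := by
    rw [wordProd, prod_map_reverse_alternatingWord, simple_mul_simple_pow']
  rw [M.symmetric, ← prod_map_reverse_alternatingWord]
  funext ⟨t, ε⟩
  rw [prod_map_signedConj_apply, rightInvSeq_reverse, List.count_reverse, wordProd_eq_one,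
    (ZMod.natCast_eq_zero_iff_even).2 (even_count_leftInvSeq_alternatingWord cs i j t)]
  simp [Function.End.one_def]

open Classical in
theorem natCast_count_rightInvSeq_congr {ω ω' : List B} (h : cs.wordProd ω = cs.wordProd ω')
    (t : W) :
    (((cs.rightInvSeq ω).count t : ℕ) : ZMod 2) = ((cs.rightInvSeq ω').count t : ℕ) := by
  have prod_eq_lift (ω : List B) : (ω.map (signedConj cs)).prod =
      cs.lift ⟨_, isLiftable_signedConj cs⟩ (cs.wordProd ω) := by
    rw [wordProd, map_list_prod, List.map_map]
    congr 2
    funext i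
    simp
  have apply_eq := congrFun
    ((prod_eq_lift ω).trans ((congrArg _ h).trans (prod_eq_lift ω').symm)) (t, 0)
  rw [prod_map_signedConj_apply, prod_map_signedConj_apply] at apply_eq
  simpa using congrArg Prod.snd apply_eq

variable {cs}

theorem simple_mem_rightInvSeq_of_isRightDescent {ω : List B} {i : B}
    (h : cs.IsRightDescent (cs.wordProd ω) i) : cs.simple i ∈ cs.rightInvSeq ω := by
  classical
  obtain ⟨ν, hν, hν'⟩ := cs.exists_isReduced (cs.wordProd ω * cs.simple i)
  have wordProd_eq : cs.wordProd ω = cs.wordProd (ν ++ [i]) := by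
    rw [wordProd_append, ← hν']
    simp
  have isReduced_append : cs.IsReduced (ν ++ [i]) := by
    rw [CoxeterSystem.IsReduced, ← wordProd_eq, ← cs.isRightDescent_iff.1 h, hν', hν.eq]
    simp
  have count_eq_one : (cs.rightInvSeq (ν ++ [i])).count (cs.simple i) = 1 := by
    refine List.count_eq_one_of_mem isReduced_append.nodup_rightInvSeq ?_
    rw [← List.concat_eq_append, rightInvSeq_concat]
    simp
  by_contra notMem
  have := natCast_count_rightInvSeq_congr cs wordProd_eq (cs.simple i)
  rw [count_eq_one, List.count_eq_zero_of_not_mem notMem] at this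
  simp at this

theorem exists_wordProd_mul_simple_eq_eraseIdx {ω : List B} {i : B}
    (h : cs.IsRightDescent (cs.wordProd ω) i) :
    ∃ j < ω.length, cs.wordProd ω * cs.simple i = cs.wordProd (ω.eraseIdx j) := by
  obtain ⟨j, hj, hj'⟩ := List.mem_iff_getElem.1 (simple_mem_rightInvSeq_of_isRightDescent h)
  refine ⟨j, by simpa using hj, ?_⟩
  rw [← wordProd_mul_getD_rightInvSeq, List.getD_eq_getElem _ _ hj, hj']

-- The exchange property: the letter that is deleted lies in a word of `x` or in a word of `y`.
theorem isRightDescent_or_exists_of_isRightDescent_mul {x y : W} {i : B}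
    (h : cs.IsRightDescent (x * y) i) :
    cs.IsRightDescent y i ∨ ∃ x', cs.length x' < cs.length x ∧ x * y * cs.simple i = x' * y := by
  obtain ⟨ν, hν, rfl⟩ := cs.exists_isReduced x
  obtain ⟨ω, hω, rfl⟩ := cs.exists_isReduced y
  rw [← wordProd_append] at h ⊢
  obtain ⟨k, hk, hk'⟩ := exists_wordProd_mul_simple_eq_eraseIdx h
  rw [hk']
  rcases lt_or_ge k ν.length with hkν | hkν
  · refine .inr ⟨cs.wordProd (ν.eraseIdx k), ?_, ?_⟩
    · have := cs.length_wordProd_le (ν.eraseIdx k)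
      have := List.length_eraseIdx_add_one hkν
      have := hν.eq
      omega
    · rw [List.eraseIdx_append_of_lt_length hkν, wordProd_append]
  · left
    rw [List.length_append] at hk
    rw [List.eraseIdx_append_of_length_le hkν, wordProd_append, wordProd_append, mul_assoc,
      mul_right_inj] at hk'
    have := cs.length_wordProd_le (ω.eraseIdx (k - ν.length))
    have := List.length_eraseIdx_add_one (l := ω) (i := k - ν.length) (by omega)
    rw [IsRightDescent, hk', hω.eq]
    omega

theorem simple_mul_eq_mul_simple_of_length_eq_add_one {w : W} {i j : B}
    (hi : cs.length (cs.simple i * w) = cs.length w + 1)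
    (hj : cs.length (w * cs.simple j) = cs.length w + 1)
    (hij : cs.length (cs.simple i * w * cs.simple j) = cs.length w) :
    cs.simple i * w = w * cs.simple j := by
  have : cs.IsRightDescent (cs.simple i * w) j := by
    rw [isRightDescent_iff]
    omega
  rcases isRightDescent_or_exists_of_isRightDescent_mul this with h | ⟨x, hx, h⟩
  · exact absurd h (cs.not_isRightDescent_iff.2 hj)
  · rw [length_simple, Nat.lt_one_iff, length_eq_zero_iff] at hx
    rw [hx, one_mul] at h
    nth_rewrite 2 [← h]
    simp

theorem simple_mul_eq_mul_simple {w : W} {i j : B}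
    (h : cs.length (cs.simple i * w) = cs.length (w * cs.simple j))
    (h' : cs.length (cs.simple i * w * cs.simple j) = cs.length w) :
    cs.simple i * w = w * cs.simple j := by
  rcases cs.length_simple_mul w i with up | down
  · exact simple_mul_eq_mul_simple_of_length_eq_add_one up (h ▸ up) h'
  · have := simple_mul_eq_mul_simple_of_length_eq_add_one (cs := cs) (w := cs.simple i * w) (i := i)
      (j := j) (by simpa using down.symm) (by omega) (by simp; omega)
    simp only [simple_mul_simple_cancel_left] at this
    nth_rewrite 2 [this]
    simp

end Exchange

section ReducedWords

variable {cs}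

theorem isReduced_of_cons {i : B} {ω : List B} (h : cs.IsReduced (i :: ω)) : cs.IsReduced ω := by
  simpa using h.drop 1

theorem isReduced_of_append_left {ω ν : List B} (h : cs.IsReduced (ω ++ ν)) : cs.IsReduced ω := by
  simpa using h.take ω.length

theorem isReduced_cons_iff {i : B} {ω : List B} (h : cs.IsReduced ω) :
    cs.IsReduced (i :: ω) ↔
      cs.length (cs.simple i * cs.wordProd ω) = cs.length (cs.wordProd ω) + 1 := by
  rw [CoxeterSystem.IsReduced, wordProd_cons, List.length_cons, h.eq]

theorem isReduced_append_iff {ω ν : List B} (hω : cs.IsReduced ω) (hν : cs.IsReduced ν) :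
    cs.IsReduced (ω ++ ν) ↔ cs.length (cs.wordProd ω * cs.wordProd ν) =
      cs.length (cs.wordProd ω) + cs.length (cs.wordProd ν) := by
  rw [CoxeterSystem.IsReduced, wordProd_append, hω.eq, hν.eq, List.length_append]

theorem exists_isReduced_forall_mem {I : Set B} (ω : List B) (h : ∀ i ∈ ω, i ∈ I) :
    ∃ ν, cs.IsReduced ν ∧ (∀ i ∈ ν, i ∈ I) ∧ cs.wordProd ν = cs.wordProd ω := by
  induction ω using List.reverseRecOn with
  | nil => exact ⟨[], by simp [CoxeterSystem.IsReduced], by simp, rfl⟩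
  | append_singleton ω i ih =>
    obtain ⟨ν, hν, hI, hp⟩ := ih fun j hj => h j (by simp [hj])
    rw [wordProd_append, ← hp, wordProd_singleton]
    by_cases descent : cs.IsRightDescent (cs.wordProd ν) i
    · obtain ⟨k, hk, hk'⟩ := exists_wordProd_mul_simple_eq_eraseIdx descent
      refine ⟨ν.eraseIdx k, ?_, fun j hj => hI j (List.mem_of_mem_eraseIdx hj), hk'.symm⟩
      have := List.length_eraseIdx_add_one hk
      have := cs.isRightDescent_iff.1 descent
      have := hν.eq
      rw [CoxeterSystem.IsReduced, ← hk']
      omega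
    · refine ⟨ν ++ [i], ?_, ?_, by simp [wordProd_append]⟩
      · rw [isReduced_append_iff hν (by simp [CoxeterSystem.IsReduced])]
        simpa using cs.not_isRightDescent_iff.1 descent
      · simpa [or_imp, forall_and] using ⟨hI, h i (by simp)⟩

end ReducedWords

section Parabolic

variable {I J : Set B}

theorem simple_mem_standardParabolic {i : B} (hi : i ∈ I) :
    cs.simple i ∈ standardParabolic cs I :=
  Subgroup.subset_closure ⟨i, hi, rfl⟩

theorem wordProd_mem_standardParabolic {ω : List B} (h : ∀ i ∈ ω, i ∈ I) :
    cs.wordProd ω ∈ standardParabolic cs I := by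
  refine Subgroup.list_prod_mem _ fun x hx => ?_
  obtain ⟨i, hi, rfl⟩ := List.mem_map.1 hx
  exact simple_mem_standardParabolic cs (h i hi)

variable {cs}

theorem exists_isReduced_of_mem_standardParabolic {w : W} (hw : w ∈ standardParabolic cs I) :
    ∃ ω, cs.IsReduced ω ∧ (∀ i ∈ ω, i ∈ I) ∧ cs.wordProd ω = w := by
  suffices ∃ ω, (∀ i ∈ ω, i ∈ I) ∧ cs.wordProd ω = w by
    obtain ⟨ω, h, rfl⟩ := this
    exact exists_isReduced_forall_mem ω h
  induction hw using Subgroup.closure_induction with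
  | mem x hx =>
    obtain ⟨i, hi, rfl⟩ := hx
    exact ⟨[i], by simpa using hi, by simp⟩
  | one => exact ⟨[], by simp, by simp⟩
  | mul x y _ _ hx hy =>
    obtain ⟨ω, h, rfl⟩ := hx
    obtain ⟨ν, h', rfl⟩ := hy
    exact ⟨ω ++ ν, by simpa [or_imp, forall_and] using ⟨h, h'⟩, by rw [wordProd_append]⟩
  | inv x _ hx =>
    obtain ⟨ω, h, rfl⟩ := hx
    exact ⟨ω.reverse, by simpa using h, by simp⟩

variable (cs) in
/-- `x` is `(∅, I)`-reduced: it has no right descent in `I`, or equivalently has minimal length in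
the coset `x W_I` (`IsRightReduced.length_le_length_mul`). -/
def IsRightReduced (I : Set B) (x : W) : Prop :=
  ∀ i ∈ I, cs.length (x * cs.simple i) = cs.length x + 1

variable (cs) in
/-- `x` is `(I, ∅)`-reduced: it has no left descent in `I`. -/
def IsLeftReduced (I : Set B) (x : W) : Prop :=
  ∀ i ∈ I, cs.length (cs.simple i * x) = cs.length x + 1

theorem isRightReduced_inv {x : W} : IsRightReduced cs I x⁻¹ ↔ IsLeftReduced cs I x := by
  refine forall₂_congr fun i _ => ?_
  rw [← cs.length_inv (x⁻¹ * _), cs.length_inv x]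
  simp

theorem isLeftReduced_inv {x : W} : IsLeftReduced cs I x⁻¹ ↔ IsRightReduced cs I x := by
  rw [← isRightReduced_inv, inv_inv]

theorem isRightReduced_one : IsRightReduced cs I 1 := fun i _ => by simp

theorem isLeftReduced_one : IsLeftReduced cs I 1 := fun i _ => by simp

theorem IsRightReduced.mono (h : J ⊆ I) {x : W} (hx : IsRightReduced cs I x) :
    IsRightReduced cs J x :=
  fun i hi => hx i (h hi)

theorem length_mul_of_forall_length_le {x : W}
    (hx : ∀ y ∈ standardParabolic cs I, cs.length x ≤ cs.length (x * y))
    {y : W} (hy : y ∈ standardParabolic cs I) :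
    cs.length (x * y) = cs.length x + cs.length y := by
  obtain ⟨ω, hω, hI, rfl⟩ := exists_isReduced_of_mem_standardParabolic hy
  clear hy
  induction ω using List.reverseRecOn with
  | nil => simp
  | append_singleton ω i ih =>
    have hω' := isReduced_of_append_left hω
    have hi : i ∈ I := hI i (by simp)
    have hI' : ∀ j ∈ ω, j ∈ I := fun j hj => hI j (by simp [hj])
    have length_mul_wordProd := ih hω' hI'
    have ascent : cs.length (cs.wordProd ω * cs.simple i) = cs.length (cs.wordProd ω) + 1 := by
      simpa using (isReduced_append_iff hω' (by simp [CoxeterSystem.IsReduced])).1 hω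
    suffices ¬cs.IsRightDescent (x * cs.wordProd ω) i by
      rw [not_isRightDescent_iff, mul_assoc] at this
      rw [wordProd_append, wordProd_singleton]
      omega
    intro descent
    rcases isRightDescent_or_exists_of_isRightDescent_mul descent with h | ⟨x', hx', h⟩
    · exact cs.not_isRightDescent_iff.2 ascent h
    · have hmem := wordProd_mem_standardParabolic cs hI'
      have hle := hx (cs.wordProd ω * cs.simple i * (cs.wordProd ω)⁻¹)
        (mul_mem (mul_mem hmem (simple_mem_standardParabolic cs hi)) (inv_mem hmem))
      rw [← mul_assoc, ← mul_assoc, h, mul_inv_cancel_right] at hle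
      omega

theorem exists_mul_eq_forall_length_le (I : Set B) (w : W) :
    ∃ x y : W, (∀ z ∈ standardParabolic cs I, cs.length x ≤ cs.length (x * z)) ∧
      y ∈ standardParabolic cs I ∧ x * y = w := by
  let s : Set ℕ := {n | ∃ y ∈ standardParabolic cs I, cs.length (w * y) = n}
  obtain ⟨y, hy, h⟩ := Nat.sInf_mem (s := s) ⟨_, 1, one_mem _, rfl⟩
  refine ⟨w * y, y⁻¹, fun z hz => ?_, inv_mem hy, by simp⟩
  rw [h, mul_assoc]
  exact Nat.sInf_le ⟨_, mul_mem hy hz, rfl⟩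

theorem isRightReduced_of_forall_length_le {x : W}
    (hx : ∀ y ∈ standardParabolic cs I, cs.length x ≤ cs.length (x * y)) :
    IsRightReduced cs I x := fun i hi => by
  rw [length_mul_of_forall_length_le hx (simple_mem_standardParabolic cs hi), length_simple]

theorem exists_isRightDescent_of_mem_standardParabolic {y : W} (hy : y ∈ standardParabolic cs I)
    (h : y ≠ 1) : ∃ i ∈ I, cs.IsRightDescent y i := by
  obtain ⟨ω, hω, hI, rfl⟩ := exists_isReduced_of_mem_standardParabolic hy
  cases ω using List.reverseRecOn with
  | nil => simp at h
  | append_singleton ω i =>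
    refine ⟨i, hI i (by simp), cs.isRightDescent_iff.2 ?_⟩
    rw [hω.eq, wordProd_append]
    simp [(isReduced_of_append_left hω).eq]

theorem IsRightReduced.length_le_length_mul {x : W} (hx : IsRightReduced cs I x) :
    ∀ y ∈ standardParabolic cs I, cs.length x ≤ cs.length (x * y) := by
  obtain ⟨x', y, hx', hy, rfl⟩ := exists_mul_eq_forall_length_le (cs := cs) I x
  suffices y = 1 by simpa [this] using hx'
  by_contra hy_ne
  obtain ⟨i, hi, descent⟩ := exists_isRightDescent_of_mem_standardParabolic hy hy_ne
  have ascent := hx i hi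
  rw [mul_assoc, length_mul_of_forall_length_le hx' hy, length_mul_of_forall_length_le hx'
    (mul_mem hy (simple_mem_standardParabolic cs hi)), ← cs.isRightDescent_iff.1 descent] at ascent
  omega

theorem IsRightReduced.length_mul {x y : W} (hx : IsRightReduced cs I x)
    (hy : y ∈ standardParabolic cs I) : cs.length (x * y) = cs.length x + cs.length y :=
  length_mul_of_forall_length_le hx.length_le_length_mul hy

theorem IsLeftReduced.length_mul {x y : W} (hx : IsLeftReduced cs I x)
    (hy : y ∈ standardParabolic cs I) : cs.length (y * x) = cs.length y + cs.length x := by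
  have := (isRightReduced_inv.2 hx).length_mul (inv_mem hy)
  rw [← mul_inv_rev, cs.length_inv, cs.length_inv, cs.length_inv] at this
  omega

variable (cs) in
theorem exists_isRightReduced_mul_eq (I : Set B) (w : W) :
    ∃ x y : W, IsRightReduced cs I x ∧ y ∈ standardParabolic cs I ∧ x * y = w := by
  obtain ⟨x, y, hx, hy, h⟩ := exists_mul_eq_forall_length_le (cs := cs) I w
  exact ⟨x, y, isRightReduced_of_forall_length_le hx, hy, h⟩

variable (cs) in
theorem exists_mul_isLeftReduced_eq (I : Set B) (w : W) :
    ∃ y x : W, y ∈ standardParabolic cs I ∧ IsLeftReduced cs I x ∧ y * x = w := by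
  obtain ⟨x, y, hx, hy, h⟩ := exists_isRightReduced_mul_eq cs I w⁻¹
  exact ⟨y⁻¹, x⁻¹, inv_mem hy, isLeftReduced_inv.2 hx, by rw [← mul_inv_rev, h, inv_inv]⟩

theorem IsRightReduced.eq_one {y : W} (h : IsRightReduced cs I y)
    (hy : y ∈ standardParabolic cs I) : y = 1 := by
  by_contra hy_ne
  obtain ⟨i, hi, descent⟩ := exists_isRightDescent_of_mem_standardParabolic hy hy_ne
  exact cs.not_isRightDescent_iff.2 (h i hi) descent

theorem IsRightReduced.eq_of_inv_mul_mem {x x' : W} (h : IsRightReduced cs I x)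
    (h' : IsRightReduced cs I x') (hm : x⁻¹ * x' ∈ standardParabolic cs I) : x = x' := by
  have length_x' := h.length_mul hm
  have length_x := h'.length_mul (inv_mem hm)
  rw [cs.length_inv] at length_x
  simp only [mul_inv_rev, inv_inv, mul_inv_cancel_left] at length_x length_x'
  exact inv_mul_eq_one.1 (cs.length_eq_zero_iff.1 (by omega))

theorem IsLeftReduced.eq_of_mul_inv_mem {x x' : W} (h : IsLeftReduced cs I x)
    (h' : IsLeftReduced cs I x') (hm : x' * x⁻¹ ∈ standardParabolic cs I) : x = x' := by
  rw [← inv_inj]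
  refine (isRightReduced_inv.2 h).eq_of_inv_mul_mem (isRightReduced_inv.2 h') ?_
  simpa using inv_mem hm

/-- Deodhar's lemma. -/
theorem IsRightReduced.simple_mul {x : W} (hx : IsRightReduced cs I x) (i : B) :
    IsRightReduced cs I (cs.simple i * x) ∨ ∃ t ∈ I, cs.simple i * x = x * cs.simple t := by
  by_contra! h
  obtain ⟨not_reduced, h_ne⟩ := h
  simp only [IsRightReduced, not_forall] at not_reduced
  obtain ⟨t, ht, descent⟩ := not_reduced
  refine h_ne t ht (simple_mul_eq_mul_simple ?_ ?_)
  all_goals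
    have := hx t ht
    have := cs.length_mul_simple (cs.simple i * x) t
    have := cs.length_simple_mul x i
    have := mul_assoc (cs.simple i) x (cs.simple t) ▸ cs.length_simple_mul (x * cs.simple t) i
    omega

theorem IsLeftReduced.mul_simple {x : W} (hx : IsLeftReduced cs I x) (i : B) :
    IsLeftReduced cs I (x * cs.simple i) ∨ ∃ t ∈ I, x * cs.simple i = cs.simple t * x := by
  rcases (isRightReduced_inv.2 hx).simple_mul i with h | ⟨t, ht, h⟩
  · left
    rw [← isRightReduced_inv]
    simpa using h
  · exact .inr ⟨t, ht, by simpa using congrArg (·⁻¹) h⟩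

theorem IsRightReduced.exists_mul_eq {w : W} (hr : IsRightReduced cs J w) {a : W}
    (ha : a ∈ standardParabolic cs I) :
    ∃ a' ∈ standardParabolic cs I, ∃ b' ∈ standardParabolic cs J,
      IsRightReduced cs J (a' * w) ∧ a * w = a' * w * b' := by
  obtain ⟨ω, -, hI, rfl⟩ := exists_isReduced_of_mem_standardParabolic ha
  clear ha
  induction ω with
  | nil => exact ⟨1, one_mem _, 1, one_mem _, by simpa using hr, by simp⟩
  | cons i ω ih =>
    obtain ⟨a, ha, b, hb, haw, h⟩ := ih fun j hj => hI j (List.mem_cons_of_mem _ hj)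
    have hi := simple_mem_standardParabolic cs (hI i List.mem_cons_self)
    rw [wordProd_cons, mul_assoc, h]
    rcases haw.simple_mul i with hsaw | ⟨t, ht, hsaw⟩
    · exact ⟨cs.simple i * a, mul_mem hi ha, b, hb, by simpa [mul_assoc] using hsaw,
        by simp [mul_assoc]⟩
    · refine ⟨a, ha, cs.simple t * b, mul_mem (simple_mem_standardParabolic cs ht) hb, haw, ?_⟩
      rw [← mul_assoc, hsaw, mul_assoc, mul_assoc]

theorem exists_mul_mul_eq_length_add {w : W} (hl : IsLeftReduced cs I w)
    (hr : IsRightReduced cs J w) {a b : W} (ha : a ∈ standardParabolic cs I)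
    (hb : b ∈ standardParabolic cs J) :
    ∃ a' ∈ standardParabolic cs I, ∃ b' ∈ standardParabolic cs J,
      a * w * b = a' * w * b' ∧
        cs.length (a' * w * b') = cs.length a' + cs.length w + cs.length b' := by
  obtain ⟨a', ha', c, hc, hr', h⟩ := hr.exists_mul_eq ha
  refine ⟨a', ha', c * b, mul_mem hc hb, by rw [h]; simp [mul_assoc], ?_⟩
  rw [hr'.length_mul (mul_mem hc hb), hl.length_mul ha']

theorem isLeftReduced_of_isDoubleReduced {w : W} (h : IsDoubleReduced cs I J w) :
    IsLeftReduced cs I w := by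
  intro i hi
  have := h _ (simple_mem_standardParabolic cs hi) 1 (one_mem _)
  have := cs.length_simple_mul w i
  rw [mul_one] at *
  omega

theorem isRightReduced_of_isDoubleReduced {w : W} (h : IsDoubleReduced cs I J w) :
    IsRightReduced cs J w := by
  intro i hi
  have := h 1 (one_mem _) _ (simple_mem_standardParabolic cs hi)
  have := cs.length_mul_simple w i
  rw [one_mul] at *
  omega

variable (cs) in
theorem exists_mul_isDoubleReduced_mul_eq (I J : Set B) (u : W) :
    ∃ a ∈ standardParabolic cs I, ∃ w, IsDoubleReduced cs I J w ∧
      ∃ b ∈ standardParabolic cs J, a * w * b = u ∧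
        cs.length u = cs.length a + cs.length w + cs.length b := by
  let s : Set ℕ := {n | ∃ a ∈ standardParabolic cs I, ∃ b ∈ standardParabolic cs J,
    cs.length (a * u * b) = n}
  obtain ⟨a, ha, b, hb, h⟩ := Nat.sInf_mem (s := s) ⟨_, 1, one_mem _, 1, one_mem _, rfl⟩
  have hw : IsDoubleReduced cs I J (a * u * b) := fun a' ha' b' hb' => by
    rw [h]
    refine Nat.sInf_le ⟨a' * a, mul_mem ha' ha, b * b', mul_mem hb hb', ?_⟩
    simp [mul_assoc]
  obtain ⟨a', ha', b', hb', h_eq, h_len⟩ := exists_mul_mul_eq_length_add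
    (isLeftReduced_of_isDoubleReduced hw) (isRightReduced_of_isDoubleReduced hw)
    (inv_mem ha) (inv_mem hb)
  have hu : a' * (a * u * b) * b' = u := by rw [← h_eq]; group
  exact ⟨a', ha', _, hw, b', hb', hu, by rw [← h_len, hu]⟩

variable (cs) (J) in
theorem IsLeftReduced.exists_isDoubleReduced_mul_eq {v : W} (hv : IsLeftReduced cs I v) :
    ∃ w, IsDoubleReduced cs I J w ∧ ∃ b ∈ standardParabolic cs J, w * b = v ∧
      cs.length v = cs.length w + cs.length b := by
  obtain ⟨a, ha, w, hw, b, hb, rfl, length_eq⟩ := exists_mul_isDoubleReduced_mul_eq cs I J v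
  have length_inv_mul := hv.length_mul (inv_mem ha)
  rw [cs.length_inv, mul_assoc, inv_mul_cancel_left] at length_inv_mul
  have := cs.length_mul_le w b
  obtain rfl : a = 1 := cs.length_eq_zero_iff.1 (by rw [mul_assoc] at length_eq; omega)
  rw [cs.length_one, zero_add] at length_eq
  exact ⟨w, hw, b, hb, by rw [one_mul], length_eq⟩

end Parabolic

end CoxeterGroup

namespace CoxeterGroup

open CoxeterSystem
open RennerCoxeterSystem (altProd)

variable {B W : Type*} [Group W] {M : CoxeterMatrix B}

section ReflectionRepresentation

variable (M)

/-- The linear form that defines the simple reflection `i` of the reflection representation on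
`B →₀ ℝ`. An entry `M i j = 0`, which stands for `∞`, gives the value `-2`. -/
noncomputable def simpleCoroot (i : B) : Module.Dual ℝ (B →₀ ℝ) :=
  Finsupp.linearCombination ℝ fun j => -2 * Real.cos (Real.pi / M i j)

theorem simpleCoroot_single (i j : B) :
    simpleCoroot M i (Finsupp.single j 1) = -2 * Real.cos (Real.pi / M i j) := by
  simp [simpleCoroot]

theorem simpleCoroot_single_self (i : B) : simpleCoroot M i (Finsupp.single i 1) = 2 := by
  simp [simpleCoroot_single]

/-- The simple reflection `i` of the reflection representation. -/
noncomputable def geometricReflection (i : B) : (B →₀ ℝ) ≃ₗ[ℝ] (B →₀ ℝ) :=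
  Module.reflection (simpleCoroot_single_self M i)

theorem simpleCoroot_mul_sub_two (i j : B) :
    simpleCoroot M i (Finsupp.single j 1) * simpleCoroot M j (Finsupp.single i 1) - 2 =
      2 * Real.cos (2 * Real.pi / M i j) := by
  rw [simpleCoroot_single, simpleCoroot_single, M.symmetric j i, mul_div_assoc, Real.cos_two_mul]
  ring

variable {m k : ℕ}

theorem sin_two_pi_div_pos (hm : 3 ≤ m) : 0 < Real.sin (2 * Real.pi / m) := by
  have three_le : (3 : ℝ) ≤ m := by exact_mod_cast hm
  have := Real.pi_pos
  refine Real.sin_pos_of_pos_of_lt_pi (by positivity) ?_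
  rw [div_lt_iff₀ (by linarith)]
  nlinarith

theorem cos_pi_div_pos (hm : 3 ≤ m) : 0 < Real.cos (Real.pi / m) := by
  have three_le : (3 : ℝ) ≤ m := by exact_mod_cast hm
  have := Real.pi_pos
  have : 0 < Real.pi / m := by positivity
  refine Real.cos_pos_of_mem_Ioo ⟨by linarith, ?_⟩
  rw [div_lt_div_iff₀ (by linarith) two_pos]
  nlinarith

theorem eval_S_eq_zero_of_eq_two_mul (hm : 3 ≤ m) (hk : m = 2 * k) :
    (Chebyshev.S ℝ (k - 1)).eval (2 * Real.cos (2 * Real.pi / m)) = 0 := by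
  refine (mul_eq_zero.1 ?_).resolve_right (sin_two_pi_div_pos hm).ne'
  have k_ne_zero : (k : ℝ) ≠ 0 := by
    have : k ≠ 0 := by omega
    exact_mod_cast this
  have angle : (((k - 1 : ℤ) : ℝ) + 1) * (2 * Real.pi / m) = Real.pi := by
    rw [hk]
    push_cast
    field_simp
    ring
  rw [Chebyshev.S_two_mul_real_cos, angle, Real.sin_pi]

theorem eval_S_add_eval_S_eq_zero_of_eq_two_mul_add_one (hm : 3 ≤ m) (hk : m = 2 * k + 1) :
    (Chebyshev.S ℝ k).eval (2 * Real.cos (2 * Real.pi / m)) +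
      (Chebyshev.S ℝ (k - 1)).eval (2 * Real.cos (2 * Real.pi / m)) = 0 := by
  refine (mul_eq_zero.1 ?_).resolve_right (sin_two_pi_div_pos hm).ne'
  have angle : (((k : ℤ) : ℝ) + 1) * (2 * Real.pi / m) =
      2 * Real.pi - (((k - 1 : ℤ) : ℝ) + 1) * (2 * Real.pi / m) := by
    rw [hk]
    push_cast
    field_simp
    ring
  rw [add_mul, Chebyshev.S_two_mul_real_cos, Chebyshev.S_two_mul_real_cos, angle,
    Real.sin_two_pi_sub]
  ring

theorem eval_S_ne_one (hm : 3 ≤ m) (hk : 0 < k) (hkm : k < m)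
    (h : (Chebyshev.S ℝ (k - 1)).eval (2 * Real.cos (2 * Real.pi / m)) = 0) :
    (Chebyshev.S ℝ k).eval (2 * Real.cos (2 * Real.pi / m)) ≠ 1 := by
  intro h'
  have sin_pos := sin_two_pi_div_pos hm
  have m_pos : (0 : ℝ) < m := by exact_mod_cast hk.trans hkm
  have k_lt : (k : ℝ) < m := by exact_mod_cast hkm
  have sin_mul : Real.sin (k * (2 * Real.pi / m)) = 0 := by
    have := Chebyshev.S_two_mul_real_cos (2 * Real.pi / m) (k - 1)
    rw [h, zero_mul] at this
    simpa using this.symm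
  have cos_mul : Real.cos (k * (2 * Real.pi / m)) = 1 := by
    have := Chebyshev.S_two_mul_real_cos (2 * Real.pi / m) k
    rw [h', one_mul, Int.cast_natCast, add_mul, one_mul, Real.sin_add, sin_mul] at this
    nlinarith
  have angle_pos : 0 < k * (2 * Real.pi / m) := by
    have : (0 : ℝ) < k := by exact_mod_cast hk
    positivity
  rw [Real.cos_eq_one_iff_of_lt_of_lt (by linarith [Real.pi_pos])] at cos_mul
  · exact angle_pos.ne' cos_mul
  · rw [← mul_div_assoc, div_lt_iff₀ m_pos]
    nlinarith [Real.pi_pos]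

theorem geometricReflection_mul_pow_of_three_le {i j : B} (hm : 3 ≤ M i j) :
    (geometricReflection M i * geometricReflection M j) ^ M i j = 1 := by
  ext1 z
  rw [geometricReflection, geometricReflection, Module.reflection_mul_reflection_pow_apply _ _ _ _ _
    (simpleCoroot_mul_sub_two M i j).symm, LinearEquiv.coe_one, id]
  obtain ⟨k, hk | hk⟩ := Nat.even_or_odd' (M i j)
  · rw [show ((M i j : ℤ) - 2) / 2 = k - 1 by omega, show ((M i j : ℤ) - 1) / 2 = k - 1 by omega,
      eval_S_eq_zero_of_eq_two_mul hm hk]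
    simp
  · rw [show ((M i j : ℤ) - 1) / 2 = k by omega, show ((M i j : ℤ) - 3) / 2 = k - 1 by omega,
      show (M i j : ℤ) / 2 = k by omega, show ((M i j : ℤ) - 2) / 2 = k - 1 by omega,
      eval_S_add_eval_S_eq_zero_of_eq_two_mul_add_one hm hk]
    simp

theorem geometricReflection_mul_pow_of_eq_two {i j : B} (hm : M i j = 2) :
    (geometricReflection M i * geometricReflection M j) ^ M i j = 1 := by
  have orthogonal : simpleCoroot M i (Finsupp.single j 1) = 0 := by simp [simpleCoroot_single, hm]
  have orthogonal' : simpleCoroot M j (Finsupp.single i 1) = 0 := by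
    simp [simpleCoroot_single, M.symmetric j i, hm]
  ext1 z
  rw [hm, pow_two]
  simp only [geometricReflection, LinearEquiv.mul_apply, Module.reflection_apply, map_sub, map_smul,
    orthogonal, orthogonal', simpleCoroot_single_self, LinearEquiv.coe_one, id]
  module

theorem isLiftable_geometricReflection : M.IsLiftable (geometricReflection M) := by
  intro i j
  rcases Nat.lt_or_ge (M i j) 3 with hm | hm
  · interval_cases hM : M i j
    · simp
    · obtain rfl : i = j := by
        by_contra hij
        exact M.off_diagonal i j hij hM
      rw [pow_one]
      ext1 z
      exact Module.involutive_reflection (simpleCoroot_single_self M i) z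
    · rw [← hM]
      exact geometricReflection_mul_pow_of_eq_two M hM
  · exact geometricReflection_mul_pow_of_three_le M hm

variable {M}

theorem eval_S_eq_of_geometricReflection_mul_pow_eq_one {i j : B} (hij : i ≠ j)
    (h : (geometricReflection M i * geometricReflection M j) ^ k = 1) :
    (Chebyshev.S ℝ k).eval (2 * Real.cos (2 * Real.pi / M i j)) +
        (Chebyshev.S ℝ (k - 1)).eval (2 * Real.cos (2 * Real.pi / M i j)) = 1 ∧
      (Real.cos (Real.pi / M i j) = 0 ∨
        (Chebyshev.S ℝ (k - 1)).eval (2 * Real.cos (2 * Real.pi / M i j)) = 0) := by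
  have image_single := Module.reflection_mul_reflection_pow_apply_self
    (simpleCoroot_single_self M i) (simpleCoroot_single_self M j) k _
    (simpleCoroot_mul_sub_two M i j).symm
  change ((geometricReflection M i * geometricReflection M j) ^ k) _ = _ at image_single
  rw [h, simpleCoroot_single, LinearEquiv.coe_one, id] at image_single
  have coord_i := DFunLike.congr_fun image_single i
  have coord_j := DFunLike.congr_fun image_single j
  simp only [Finsupp.coe_add, Finsupp.coe_smul, Pi.add_apply, Pi.smul_apply, Finsupp.single_eq_same,
    Finsupp.single_eq_of_ne hij, Finsupp.single_eq_of_ne hij.symm, smul_eq_mul, mul_one, mul_zero,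
    add_zero, zero_add, zero_eq_mul, neg_eq_zero] at coord_i coord_j
  rw [simpleCoroot_single, M.symmetric j i] at coord_j
  exact ⟨coord_i.symm, coord_j.symm.imp_left fun h => by simpa using h⟩

theorem simple_mul_simple_pow_ne_one (cs : CoxeterSystem M W) {i j : B} (hij : i ≠ j) (hk : 0 < k)
    (hkM : M i j = 0 ∨ k < M i j) : (cs.simple i * cs.simple j) ^ k ≠ 1 := by
  intro h
  have image_eq_one : (geometricReflection M i * geometricReflection M j) ^ k = 1 := by
    simpa using congrArg (cs.lift ⟨_, isLiftable_geometricReflection M⟩) h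
  obtain ⟨add_eq_one, eq_zero⟩ := eval_S_eq_of_geometricReflection_mul_pow_eq_one hij image_eq_one
  rcases hkM with hM | hkM
  · have k_ne_zero : (k : ℝ) ≠ 0 := by exact_mod_cast hk.ne'
    simp [hM, Chebyshev.S_eval_two, k_ne_zero] at eq_zero
  rcases Nat.lt_or_ge (M i j) 3 with hm | hm
  · have hm : M i j = 2 := by omega
    obtain rfl : k = 1 := by omega
    norm_num [hm] at add_eq_one
  · have eval_eq_zero := eq_zero.resolve_left (cos_pi_div_pos hm).ne'
    exact eval_S_ne_one hm hk hkM eval_eq_zero (by rwa [eval_eq_zero, add_zero] at add_eq_one)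

end ReflectionRepresentation

section Matsumoto

/-- The word `i j i ⋯` of length `m`. Unlike `CoxeterSystem.alternatingWord`, it is specified by its
first letter. -/
def altWord : B → B → ℕ → List B
  | _, _, 0 => []
  | i, j, m + 1 => i :: altWord j i m

theorem prod_map_altWord {A : Type*} [Monoid A] (f : B → A) (i j : B) (m : ℕ) :
    ((altWord i j m).map f).prod = altProd (f i) (f j) m := by
  induction m generalizing i j with
  | zero => rfl
  | succ m ih => rw [altWord, List.map_cons, List.prod_cons, ih, altProd]

theorem length_altWord (i j : B) (m : ℕ) : (altWord i j m).length = m := by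
  induction m generalizing i j with
  | zero => rfl
  | succ m ih => rw [altWord, List.length_cons, ih]

theorem exists_altWord_add (i j : B) (m n : ℕ) :
    ∃ ν, altWord i j (m + n) = altWord i j m ++ ν := by
  induction m generalizing i j with
  | zero => exact ⟨_, rfl⟩
  | succ m ih =>
    obtain ⟨ν, hν⟩ := ih j i
    exact ⟨ν, by rw [Nat.succ_add, altWord, hν]; rfl⟩

variable {cs : CoxeterSystem M W} {i j : B} {I : Set B}

theorem wordProd_altWord_mul_inv (cs : CoxeterSystem M W) (i j : B) (m : ℕ) :
    cs.wordProd (altWord i j m) * (cs.wordProd (altWord j i m))⁻¹ =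
      (cs.simple i * cs.simple j) ^ m := by
  induction m generalizing i j with
  | zero => simp [altWord]
  | succ m ih =>
    rw [altWord, altWord, wordProd_cons, wordProd_cons, mul_inv_rev, inv_simple, ← mul_assoc,
      mul_assoc (cs.simple i), ih, ← mul_pow_mul, mul_assoc, pow_succ]

theorem wordProd_altWord_braid (cs : CoxeterSystem M W) (i j : B) :
    cs.wordProd (altWord i j (M i j)) = cs.wordProd (altWord j i (M i j)) := by
  rw [← mul_inv_eq_one, wordProd_altWord_mul_inv, simple_mul_simple_pow]

theorem isLeftDescent_of_isReduced_cons {ω : List B} (h : cs.IsReduced (i :: ω)) :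
    cs.IsLeftDescent (cs.wordProd (i :: ω)) i := by
  rw [isLeftDescent_iff, h.eq, wordProd_cons, simple_mul_simple_cancel_left,
    (isReduced_of_cons h).eq, List.length_cons]

theorem cons_eq_altWord_of_isReduced {ω : List B} (h : cs.IsReduced (i :: ω))
    (hω : ∀ k ∈ ω, k ∈ ({i, j} : Set B)) : i :: ω = altWord i j (ω.length + 1) := by
  induction ω generalizing i j with
  | nil => rfl
  | cons k ω ih =>
    obtain rfl : k = j := by
      refine (hω k List.mem_cons_self).resolve_left fun hk => ?_
      subst hk
      have length_eq := h.eq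
      rw [wordProd_cons, wordProd_cons, simple_mul_simple_cancel_left] at length_eq
      have := cs.length_wordProd_le ω
      simp only [List.length_cons] at length_eq
      omega
    rw [altWord, List.length_cons,
      ih (isReduced_of_cons h) fun l hl => Set.pair_comm i k ▸ hω l (List.mem_cons_of_mem _ hl)]

theorem eq_wordProd_altWord_of_isLeftDescent {y : W} (hy : y ∈ standardParabolic cs {i, j})
    (h : cs.IsLeftDescent y i) : y = cs.wordProd (altWord i j (cs.length y)) := by
  rw [isLeftDescent_iff] at h
  obtain ⟨ω, hω, mem_pair, prod_eq⟩ := exists_isReduced_of_mem_standardParabolic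
    (mul_mem (simple_mem_standardParabolic cs (Set.mem_insert i {j})) hy)
  have prod_cons_eq : cs.wordProd (i :: ω) = y := by
    rw [wordProd_cons, prod_eq, simple_mul_simple_cancel_left]
  have length_eq : cs.length y = ω.length + 1 := by rw [← h, ← prod_eq, hω.eq]
  rw [length_eq, ← cons_eq_altWord_of_isReduced (cs := cs) _ mem_pair, prod_cons_eq]
  rw [CoxeterSystem.IsReduced, prod_cons_eq, length_eq, List.length_cons]

theorem IsLeftReduced.isLeftDescent_of_mul {x y : W} {k : B} (hx : IsLeftReduced cs I x)
    (hy : y ∈ standardParabolic cs I) (hk : k ∈ I) (h : cs.IsLeftDescent (y * x) k) :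
    cs.IsLeftDescent y k := by
  rw [isLeftDescent_iff, ← mul_assoc, hx.length_mul hy, hx.length_mul
    (mul_mem (simple_mem_standardParabolic cs hk) hy)] at h
  rw [isLeftDescent_iff]
  omega

-- The parabolic component of `w` in `⟨s_i, s_j⟩` has both left descents, so it is the product of
-- the two alternating words of its length, which is at least the order of `s_i s_j`.
theorem exists_isReduced_altWord_append (hij : i ≠ j) {w : W} (hi : cs.IsLeftDescent w i)
    (hj : cs.IsLeftDescent w j) :
    M i j ≠ 0 ∧ ∃ ν, cs.wordProd (altWord i j (M i j) ++ ν) = w ∧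
      cs.IsReduced (altWord i j (M i j) ++ ν) := by
  obtain ⟨y, x, hy, hx, rfl⟩ := exists_mul_isLeftReduced_eq cs {i, j} w
  have eq_altWord := eq_wordProd_altWord_of_isLeftDescent hy
    (hx.isLeftDescent_of_mul hy (by simp) hi)
  have eq_altWord' := eq_wordProd_altWord_of_isLeftDescent (Set.pair_comm i j ▸ hy)
    (hx.isLeftDescent_of_mul hy (by simp) hj)
  have pow_eq_one : (cs.simple i * cs.simple j) ^ cs.length y = 1 := by
    rw [← wordProd_altWord_mul_inv, ← eq_altWord, ← eq_altWord', mul_inv_cancel]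
  have length_pos : cs.length y ≠ 0 := by
    have := cs.isLeftDescent_iff.1 (hx.isLeftDescent_of_mul hy (by simp) hi)
    omega
  have ⟨ne_zero, le_length⟩ : M i j ≠ 0 ∧ M i j ≤ cs.length y := by
    by_contra h
    exact simple_mul_simple_pow_ne_one cs hij (by omega) (by omega) pow_eq_one
  refine ⟨ne_zero, ?_⟩
  obtain ⟨n, hn⟩ := Nat.exists_eq_add_of_le le_length
  obtain ⟨ν, hν⟩ := exists_altWord_add i j (M i j) n
  obtain ⟨ξ, hξ, rfl⟩ := cs.exists_isReduced x
  have prod_eq : cs.wordProd (altWord i j (M i j) ++ (ν ++ ξ)) = y * cs.wordProd ξ := by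
    rw [← List.append_assoc, ← hν, ← hn, wordProd_append, ← eq_altWord]
  refine ⟨ν ++ ξ, prod_eq, ?_⟩
  rw [CoxeterSystem.IsReduced, prod_eq, hx.length_mul hy, hξ.eq, ← List.append_assoc, ← hν, ← hn,
    List.length_append, length_altWord]

theorem isReduced_altWord (hij : i ≠ j) {m : ℕ} (hm : m ≤ M i j) :
    cs.IsReduced (altWord i j m) := by
  induction m generalizing i j with
  | zero => simp [altWord, CoxeterSystem.IsReduced]
  | succ m ih =>
    have tail_isReduced := ih hij.symm (by rw [M.symmetric]; omega)
    rw [altWord, isReduced_cons_iff tail_isReduced, ← not_isLeftDescent_iff]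
    intro hi
    rcases m with _ | m
    · simp [altWord, isLeftDescent_iff] at hi
    · obtain ⟨-, ν, hν, hν'⟩ := exists_isReduced_altWord_append hij hi
        (isLeftDescent_of_isReduced_cons tail_isReduced)
      have length_eq := hν'.eq
      rw [hν, tail_isReduced.eq, List.length_append, length_altWord, length_altWord] at length_eq
      omega

variable {A : Type*} [Monoid A] {f : B → A}

theorem exists_isReduced_cons_prod_map_eq
    (hf : ∀ i j, i ≠ j → M i j ≠ 0 → altProd (f i) (f j) (M i j) = altProd (f j) (f i) (M i j))
    (hij : i ≠ j) {w : W} (hi : cs.IsLeftDescent w i) (hj : cs.IsLeftDescent w j) :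
    ∃ ω ω', (cs.IsReduced (i :: ω) ∧ cs.wordProd (i :: ω) = w) ∧
      (cs.IsReduced (j :: ω') ∧ cs.wordProd (j :: ω') = w) ∧
      ((i :: ω).map f).prod = ((j :: ω').map f).prod := by
  obtain ⟨hM, ν, prod_eq, isReduced⟩ := exists_isReduced_altWord_append hij hi hj
  obtain ⟨m, hm⟩ := Nat.exists_eq_succ_of_ne_zero hM
  have altWord_eq_cons (a b : B) : altWord a b (M i j) ++ ν = a :: (altWord b a m ++ ν) := by
    rw [hm]
    rfl
  have prod_eq' : cs.wordProd (altWord j i (M i j) ++ ν) = w := by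
    rw [← prod_eq, wordProd_append, wordProd_append, wordProd_altWord_braid]
  have isReduced' : cs.IsReduced (altWord j i (M i j) ++ ν) := by
    rw [CoxeterSystem.IsReduced, prod_eq', ← prod_eq, isReduced.eq]
    simp [length_altWord]
  refine ⟨altWord j i m ++ ν, altWord i j m ++ ν, ?_, ?_, ?_⟩
  · exact altWord_eq_cons i j ▸ ⟨isReduced, prod_eq⟩
  · exact altWord_eq_cons j i ▸ ⟨isReduced', prod_eq'⟩
  · rw [← altWord_eq_cons, ← altWord_eq_cons, List.map_append, List.map_append, List.prod_append,
      List.prod_append, prod_map_altWord, prod_map_altWord, hf i j hij hM]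

/-- Matsumoto's theorem. -/
theorem prod_map_eq_of_isReduced
    (hf : ∀ i j, i ≠ j → M i j ≠ 0 → altProd (f i) (f j) (M i j) = altProd (f j) (f i) (M i j))
    {ω ω' : List B} (hω : cs.IsReduced ω) (hω' : cs.IsReduced ω')
    (h : cs.wordProd ω = cs.wordProd ω') : (ω.map f).prod = (ω'.map f).prod := by
  induction hn : ω.length generalizing ω ω' with
  | zero =>
    have : ω'.length = 0 := by rw [← hω'.eq, ← h, hω.eq, hn]
    rw [List.eq_nil_of_length_eq_zero hn, List.eq_nil_of_length_eq_zero this]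
  | succ n ih =>
    have same_head {i : B} {ω ω' : List B} (hω : cs.IsReduced (i :: ω))
        (hω' : cs.IsReduced (i :: ω')) (h : cs.wordProd (i :: ω) = cs.wordProd (i :: ω'))
        (hn : cs.length (cs.wordProd (i :: ω)) = n + 1) :
        ((i :: ω).map f).prod = ((i :: ω').map f).prod := by
      rw [hω.eq, List.length_cons, add_left_inj] at hn
      rw [wordProd_cons, wordProd_cons, mul_right_inj] at h
      rw [List.map_cons, List.map_cons, List.prod_cons, List.prod_cons,
        ih (isReduced_of_cons hω) (isReduced_of_cons hω') h hn]
    have length_eq : cs.length (cs.wordProd ω) = n + 1 := by rw [hω.eq, hn]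
    have length_eq' : ω'.length = n + 1 := by rw [← hω'.eq, ← h, length_eq]
    obtain ⟨i, ω, rfl⟩ := List.exists_cons_of_length_eq_add_one hn
    obtain ⟨j, ω', rfl⟩ := List.exists_cons_of_length_eq_add_one length_eq'
    by_cases hij : i = j
    · subst hij
      exact same_head hω hω' h length_eq
    · obtain ⟨ν, ν', ⟨hν, prod_eq⟩, ⟨hν', prod_eq'⟩, map_eq⟩ := exists_isReduced_cons_prod_map_eq hf
        hij (isLeftDescent_of_isReduced_cons hω) (h ▸ isLeftDescent_of_isReduced_cons hω')
      calc ((i :: ω).map f).prod = ((i :: ν).map f).prod := same_head hω hν prod_eq.symm length_eq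
        _ = ((j :: ν').map f).prod := map_eq
        _ = ((j :: ω').map f).prod :=
          same_head hν' hω' (prod_eq'.trans h) (prod_eq' ▸ length_eq)

end Matsumoto

section Factors

variable {cs : CoxeterSystem M W} {I J : Set B}

theorem standardParabolic_mono (h : I ⊆ J) : standardParabolic cs I ≤ standardParabolic cs J :=
  Subgroup.closure_mono (Set.image_mono h)

theorem simple_mem_standardParabolic_of_isRightDescent {w : W} {i : B}
    (hw : w ∈ standardParabolic cs I) (hi : cs.IsRightDescent w i) :
    cs.simple i ∈ standardParabolic cs I := by
  obtain ⟨ω, -, hω, rfl⟩ := exists_isReduced_of_mem_standardParabolic hw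
  obtain ⟨k, -, hk⟩ := exists_wordProd_mul_simple_eq_eraseIdx hi
  rw [eq_inv_mul_of_mul_eq hk]
  exact mul_mem (inv_mem hw) (wordProd_mem_standardParabolic cs fun j hj =>
    hω j (List.mem_of_mem_eraseIdx hj))

theorem exists_simple_eq_of_simple_mem_standardParabolic {i : B}
    (h : cs.simple i ∈ standardParabolic cs I) : ∃ j ∈ I, cs.simple j = cs.simple i := by
  have simple_ne_one : cs.simple i ≠ 1 := by
    rw [Ne, ← cs.length_eq_zero_iff, cs.length_simple]
    exact one_ne_zero
  obtain ⟨j, hj, descent⟩ := exists_isRightDescent_of_mem_standardParabolic h simple_ne_one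
  rw [CoxeterSystem.IsRightDescent, cs.length_simple, Nat.lt_one_iff, cs.length_eq_zero_iff,
    mul_eq_one_iff_eq_inv, cs.inv_simple] at descent
  exact ⟨j, hj, descent.symm⟩

theorem simple_mem_of_wordProd_mem_standardParabolic {ω : List B} (hω : cs.IsReduced ω)
    (h : cs.wordProd ω ∈ standardParabolic cs I) :
    ∀ i ∈ ω, cs.simple i ∈ standardParabolic cs I := by
  induction ω using List.reverseRecOn with
  | nil => simp
  | append_singleton ω i ih =>
    have prefix_isReduced := isReduced_of_append_left hω
    have isRightDescent : cs.IsRightDescent (cs.wordProd (ω ++ [i])) i := by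
      rw [isRightDescent_iff, hω.eq]
      simp [wordProd_append, prefix_isReduced.eq]
    have simple_mem := simple_mem_standardParabolic_of_isRightDescent h isRightDescent
    have prefix_mem : cs.wordProd ω ∈ standardParabolic cs I := by
      simpa [wordProd_append] using mul_mem h simple_mem
    intro j hj
    rcases List.mem_append.1 hj with hj | hj
    · exact ih prefix_isReduced prefix_mem j hj
    · rwa [List.mem_singleton.1 hj]

theorem mem_standardParabolic_of_length_mul_eq_add {x y : W} (h : x * y ∈ standardParabolic cs I)
    (length_eq : cs.length (x * y) = cs.length x + cs.length y) :
    x ∈ standardParabolic cs I ∧ y ∈ standardParabolic cs I := by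
  obtain ⟨ω, hω, rfl⟩ := cs.exists_isReduced x
  obtain ⟨ν, hν, rfl⟩ := cs.exists_isReduced y
  have simple_mem := simple_mem_of_wordProd_mem_standardParabolic
    ((isReduced_append_iff hω hν).2 length_eq) (by rwa [wordProd_append])
  constructor <;>
  · refine Subgroup.list_prod_mem _ fun x hx => ?_
    obtain ⟨i, hi, rfl⟩ := List.mem_map.1 hx
    exact simple_mem i (by simp [hi])

end Factors

end CoxeterGroup

section Monoid

variable {R : Type*} [Monoid R] {e f : R} {u v : Rˣ}

theorem isIdempotentElem_units_conj (he : IsIdempotentElem e) (u : Rˣ) :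
    IsIdempotentElem ((u : R) * e * ((u⁻¹ : Rˣ) : R)) := by
  rw [IsIdempotentElem]
  simp only [mul_assoc, Units.inv_mul_cancel_left]
  rw [← mul_assoc e, he.eq]

namespace IsFactorisableMonoid

theorem eq_of_mul_units_eq (hR : IsFactorisableMonoid R) (he : IsIdempotentElem e)
    (hf : IsIdempotentElem f) (h : e * u = f * v) : e = f := by
  have mul_eq_left : f * e = e := by
    rw [← Units.mul_left_inj u, mul_assoc, h, ← mul_assoc, hf.eq]
  have mul_eq_right : e * f = f := by
    rw [← Units.mul_left_inj v, mul_assoc, ← h, ← mul_assoc, he.eq]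
  rw [← mul_eq_left, ← hR.idempotents_commute e f he hf, mul_eq_right]

theorem isIdempotentElem_mul (hR : IsFactorisableMonoid R) (he : IsIdempotentElem e)
    (hf : IsIdempotentElem f) : IsIdempotentElem (e * f) :=
  he.mul_of_commute (hR.idempotents_commute e f he hf) hf

theorem mem_unitStabilizer (hR : IsFactorisableMonoid R) (he : IsIdempotentElem e)
    (h : e * u = e) : u ∈ unitStabilizer e := by
  have mul_inv_eq : e * ((u⁻¹ : Rˣ) : R) = e := by rw [Units.mul_inv_eq_iff_eq_mul, h]
  have isIdempotentElem_inv_mul : IsIdempotentElem (((u⁻¹ : Rˣ) : R) * e) := by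
    simpa [mul_assoc, h] using isIdempotentElem_units_conj he u⁻¹
  have inv_mul_eq := hR.idempotents_commute _ e isIdempotentElem_inv_mul he
  rw [mul_assoc, he.eq, ← mul_assoc, mul_inv_eq, he.eq, Units.inv_mul_eq_iff_eq_mul] at inv_mul_eq
  exact ⟨inv_mul_eq.symm, h⟩

end IsFactorisableMonoid

theorem mem_unitCentralizer_iff : u ∈ unitCentralizer e ↔ (u : R) * e = e * u := Iff.rfl

theorem inv_mul_mem_unitCentralizer
    (h : (u : R) * e * ((u⁻¹ : Rˣ) : R) = v * e * ((v⁻¹ : Rˣ) : R)) :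
    u⁻¹ * v ∈ unitCentralizer e := by
  rw [Units.mul_inv_eq_iff_eq_mul] at h
  rw [mem_unitCentralizer_iff, Units.val_mul, mul_assoc, Units.inv_mul_eq_iff_eq_mul,
    ← mul_assoc, ← mul_assoc, h]
  simp [mul_assoc]

theorem unitStabilizer_le_unitCentralizer (e : R) : unitStabilizer e ≤ unitCentralizer e :=
  fun _ h => h.1.trans h.2.symm

theorem conj_mem_unitStabilizer (hu : u ∈ unitCentralizer e) (hv : v ∈ unitStabilizer e) :
    u * v * u⁻¹ ∈ unitStabilizer e := by
  have hu' := mem_unitCentralizer_iff.1 (inv_mem hu)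
  rw [mem_unitCentralizer_iff] at hu
  simp only [unitStabilizer, Subgroup.mem_mk, Submonoid.mem_mk, Subsemigroup.mem_mk,
    Set.mem_ofPred_eq, Units.val_mul] at hv ⊢
  constructor
  · rw [mul_assoc, hu', ← mul_assoc, mul_assoc (u : R), hv.1, hu, mul_assoc, Units.mul_inv, mul_one]
  · rw [mul_assoc (u : R), ← mul_assoc, ← hu, mul_assoc, ← mul_assoc e, hv.2, ← hu', ← mul_assoc,
      Units.mul_inv, one_mul]

end Monoid

namespace RennerCoxeterSystem

open CoxeterSystem CoxeterGroup

variable {B R : Type*} [Monoid R] {M : CoxeterMatrix B} (𝓡 : RennerCoxeterSystem M R)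
variable {e f g : R}

section Types

theorem unitCentralizer_eq_standardParabolic (he : e ∈ 𝓡.Λ) :
    unitCentralizer e = standardParabolic 𝓡.cs (typeMap 𝓡.cs e) := by
  obtain ⟨I, hI⟩ := 𝓡.centralizer_parabolic e he
  apply le_antisymm
  · rw [hI]
    refine standardParabolic_mono fun i hi => ?_
    change 𝓡.cs.simple i ∈ unitCentralizer e
    rw [hI]
    exact simple_mem_standardParabolic _ hi
  · refine (Subgroup.closure_le _).2 ?_
    rintro _ ⟨i, hi, rfl⟩
    exact hi

theorem unitStabilizer_eq_standardParabolic (he : e ∈ 𝓡.Λ) :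
    unitStabilizer e = standardParabolic 𝓡.cs (lowerType 𝓡.cs e) := by
  obtain ⟨I, hI⟩ := 𝓡.stabilizer_parabolic e he
  apply le_antisymm
  · rw [hI]
    refine standardParabolic_mono fun i hi => ?_
    change 𝓡.cs.simple i ∈ unitStabilizer e
    rw [hI]
    exact simple_mem_standardParabolic _ hi
  · refine (Subgroup.closure_le _).2 ?_
    rintro _ ⟨i, hi, rfl⟩
    exact hi

theorem upperType_subset_typeMap (e : R) : upperType 𝓡.cs e ⊆ typeMap 𝓡.cs e := fun _ h => h.1

theorem lowerType_subset_typeMap (e : R) : lowerType 𝓡.cs e ⊆ typeMap 𝓡.cs e :=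
  fun _ h => h.1.trans h.2.symm

theorem mem_upperType_or_mem_lowerType {i : B} (h : i ∈ typeMap 𝓡.cs e) :
    i ∈ upperType 𝓡.cs e ∨ i ∈ lowerType 𝓡.cs e := by
  by_cases h' : e * (𝓡.cs.simple i : R) = e
  · exact Or.inr ⟨Eq.trans h h', h'⟩
  · exact Or.inl ⟨h, h'⟩

theorem simple_notMem_of_mem_upperType {j : B} (hj : j ∈ upperType 𝓡.cs e) :
    𝓡.cs.simple j ∉ unitStabilizer e := fun h => hj.2 h.2

theorem isLeftReduced_simple_of_mem_upperType {j : B} (hj : j ∈ upperType 𝓡.cs e) :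
    IsLeftReduced 𝓡.cs (lowerType 𝓡.cs e) (𝓡.cs.simple j) := by
  refine fun i hi => (𝓡.cs.length_simple_mul (𝓡.cs.simple j) i).resolve_right fun h => ?_
  rw [length_simple, Nat.add_eq_right, length_eq_zero_iff, mul_eq_one_iff_eq_inv, inv_simple] at h
  exact 𝓡.simple_notMem_of_mem_upperType hj (h ▸ hi)

-- `s_j s_i s_j` lies in `W_⋆(e)`, for which `s_j` is reduced on both sides; comparing lengths in
-- `s_j (s_j s_i s_j) = s_i s_j` shows that its length is `1`.
theorem commute_simple_of_mem_lowerType_of_mem_upperType (he : e ∈ 𝓡.Λ) {i j : B}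
    (hi : i ∈ lowerType 𝓡.cs e) (hj : j ∈ upperType 𝓡.cs e) :
    Commute (𝓡.cs.simple i) (𝓡.cs.simple j) := by
  set s := 𝓡.cs.simple
  have conj_mem : s j * s i * s j ∈ standardParabolic 𝓡.cs (lowerType 𝓡.cs e) := by
    rw [← 𝓡.unitStabilizer_eq_standardParabolic he]
    simpa [s] using conj_mem_unitStabilizer (𝓡.upperType_subset_typeMap e hj) hi
  have left_reduced := 𝓡.isLeftReduced_simple_of_mem_upperType hj
  have right_reduced : IsRightReduced 𝓡.cs (lowerType 𝓡.cs e) (s j) := by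
    rwa [← isRightReduced_inv, inv_simple] at left_reduced
  have length_left : 𝓡.cs.length (s i * s j) = 2 := by rw [left_reduced i hi, length_simple]
  have length_right : 𝓡.cs.length (s j * s i) = 2 := by rw [right_reduced i hi, length_simple]
  have length_conj := right_reduced.length_mul conj_mem
  rw [show s j * (s j * s i * s j) = s i * s j by simp [s, mul_assoc], length_left,
    length_simple] at length_conj
  have length_eq : 𝓡.cs.length (s j * s i * s j) = 𝓡.cs.length (s i) := by
    rw [length_simple]
    omega
  exact (simple_mul_eq_mul_simple (length_right.trans length_left.symm) length_eq).symm

theorem commute_of_mem_lower_of_mem_upper (he : e ∈ 𝓡.Λ) {x y : Rˣ}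
    (hx : x ∈ standardParabolic 𝓡.cs (lowerType 𝓡.cs e))
    (hy : y ∈ standardParabolic 𝓡.cs (upperType 𝓡.cs e)) : Commute x y := by
  induction hx using Subgroup.closure_induction with
  | mem x hx =>
    obtain ⟨i, hi, rfl⟩ := hx
    induction hy using Subgroup.closure_induction with
    | mem y hy =>
      obtain ⟨j, hj, rfl⟩ := hy
      exact 𝓡.commute_simple_of_mem_lowerType_of_mem_upperType he hi hj
    | one => exact Commute.one_right _
    | mul _ _ _ _ ih ih' => exact ih.mul_right ih'
    | inv _ _ ih => exact ih.inv_right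
  | one => exact Commute.one_left _
  | mul _ _ _ _ ih ih' => exact ih.mul_left ih'
  | inv _ _ ih => exact ih.inv_left

theorem exists_mul_eq_of_mem_unitCentralizer (he : e ∈ 𝓡.Λ) {c : Rˣ}
    (hc : c ∈ unitCentralizer e) :
    ∃ x ∈ standardParabolic 𝓡.cs (lowerType 𝓡.cs e),
      ∃ y ∈ standardParabolic 𝓡.cs (upperType 𝓡.cs e), x * y = c := by
  rw [𝓡.unitCentralizer_eq_standardParabolic he] at hc
  induction hc using Subgroup.closure_induction with
  | mem _ h =>
    obtain ⟨i, hi, rfl⟩ := h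
    rcases 𝓡.mem_upperType_or_mem_lowerType hi with hi | hi
    · exact ⟨1, one_mem _, _, simple_mem_standardParabolic _ hi, one_mul _⟩
    · exact ⟨_, simple_mem_standardParabolic _ hi, 1, one_mem _, mul_one _⟩
  | one => exact ⟨1, one_mem _, 1, one_mem _, mul_one _⟩
  | mul _ _ _ _ ih ih' =>
    obtain ⟨x, hx, y, hy, rfl⟩ := ih
    obtain ⟨x', hx', y', hy', rfl⟩ := ih'
    exact ⟨x * x', Subgroup.mul_mem _ hx hx', y * y', Subgroup.mul_mem _ hy hy',
      (𝓡.commute_of_mem_lower_of_mem_upper he hx' hy).mul_mul_mul_comm _ _⟩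
  | inv _ _ ih =>
    obtain ⟨x, hx, y, hy, rfl⟩ := ih
    exact ⟨x⁻¹, inv_mem hx, y⁻¹, inv_mem hy,
      ((𝓡.commute_of_mem_lower_of_mem_upper he hx hy).mul_inv).symm⟩

end Types

section Wedge

theorem eq_of_conj_eq_conj (he : e ∈ 𝓡.Λ) (hf : f ∈ 𝓡.Λ) {u v : Rˣ}
    (h : (u : R) * e * ((u⁻¹ : Rˣ) : R) = v * f * ((v⁻¹ : Rˣ) : R)) : e = f :=
  (𝓡.transversal _ (isIdempotentElem_units_conj (𝓡.isIdempotentElem e he) u)).unique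
    ⟨he, u, rfl⟩ ⟨hf, v, h.symm⟩

theorem one_mem_Λ : (1 : R) ∈ 𝓡.Λ := by
  obtain ⟨f, ⟨hf, w, hw⟩, -⟩ := 𝓡.transversal 1 IsIdempotentElem.one
  rw [Units.mul_inv_eq_iff_eq_mul, one_mul, ← Units.eq_inv_mul_iff_mul_eq, Units.inv_mul] at hw
  exact hw ▸ hf

theorem exists_conj_eq_of_mul_eq_self (hf : f ∈ 𝓡.Λ) {p : R} (hp : IsIdempotentElem p)
    (hpf : p * f = p) :
    ∃ h ∈ 𝓡.Λ, h * f = h ∧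
      ∃ b ∈ unitCentralizer f, (b : R) * h * ((b⁻¹ : Rˣ) : R) = p := by
  obtain ⟨b, h, f', hh, hf', hhf, conj_h, conj_f⟩ :=
    𝓡.conj_pair p f hp (𝓡.isIdempotentElem f hf) hpf
  obtain rfl : f' = f := 𝓡.eq_of_conj_eq_conj hf' hf (u := b) (v := 1) (by simpa using conj_f)
  exact ⟨h, hh, hhf, b, by rwa [Units.mul_inv_eq_iff_eq_mul] at conj_f, conj_h⟩

theorem conj_eq_self_of_mul_conj_eq_self (hg : g ∈ 𝓡.Λ) {b : Rˣ}
    (h : g * ((b : R) * g * ((b⁻¹ : Rˣ) : R)) = g) : (b : R) * g * ((b⁻¹ : Rˣ) : R) = g := by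
  have hgi := 𝓡.isIdempotentElem g hg
  obtain ⟨z, g₁, g₂, hg₁, hg₂, -, conj_g₁, conj_g₂⟩ :=
    𝓡.conj_pair g _ hgi (isIdempotentElem_units_conj hgi b) h
  obtain rfl := 𝓡.eq_of_conj_eq_conj hg₁ hg (u := z) (v := 1) (by simpa using conj_g₁)
  obtain rfl := 𝓡.eq_of_conj_eq_conj hg₂ hg conj_g₂
  exact conj_g₂.symm.trans conj_g₁

-- Write `a w b = y x` with `y ∈ W_{λ^⋆(g)} ⊆ W(e)` and `x ∈ W_⋆(g)`. Then `x = (y⁻¹ a) w b`, and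
-- `w` is a factor of a length-additive decomposition of `x`.
theorem mem_unitStabilizer_of_mul_mul_mem (he : e ∈ 𝓡.Λ) (hf : f ∈ 𝓡.Λ) (hg : g ∈ 𝓡.Λ)
    (hge : g * e = g) {w a b : Rˣ} (hw : w ∈ 𝓡.Red e f) (ha : a ∈ unitCentralizer e)
    (hb : b ∈ unitCentralizer f) (h : a * w * b ∈ unitCentralizer g) : w ∈ unitStabilizer g := by
  obtain ⟨x, hx, y, hy, hxy⟩ := 𝓡.exists_mul_eq_of_mem_unitCentralizer hg h
  have y_mem : y ∈ standardParabolic 𝓡.cs (typeMap 𝓡.cs e) :=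
    standardParabolic_mono
      ((𝓡.upperType_mono g hg e he hge).trans (𝓡.upperType_subset_typeMap e)) hy
  rw [𝓡.unitCentralizer_eq_standardParabolic he] at ha
  rw [𝓡.unitCentralizer_eq_standardParabolic hf] at hb
  have eq_x : y⁻¹ * a * w * b = x := by
    rw [(𝓡.commute_of_mem_lower_of_mem_upper hg hx hy).eq] at hxy
    rw [eq_inv_mul_of_mul_eq hxy]
    group
  obtain ⟨a', -, b', -, prod_eq, length_eq⟩ := exists_mul_mul_eq_length_add
    (isLeftReduced_of_isDoubleReduced hw) (isRightReduced_of_isDoubleReduced hw)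
    (Subgroup.mul_mem _ (inv_mem y_mem) ha) hb
  rw [← eq_x, prod_eq] at hx
  have := 𝓡.cs.length_mul_le a' w
  have := 𝓡.cs.length_mul_le (a' * w) b'
  have prefix_mem := (mem_standardParabolic_of_length_mul_eq_add hx (by omega)).1
  rw [𝓡.unitStabilizer_eq_standardParabolic hg]
  exact (mem_standardParabolic_of_length_mul_eq_add prefix_mem (by omega)).2

variable {w : Rˣ}

theorem exists_mul_mul_eq_mem_Λ (he : e ∈ 𝓡.Λ) (hf : f ∈ 𝓡.Λ) (hw : w ∈ 𝓡.Red e f) :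
    ∃ h ∈ 𝓡.Λ, w ∈ unitStabilizer h ∧ h * e = h ∧ e * w * f = h := by
  have he' := 𝓡.isIdempotentElem e he
  have hf' := 𝓡.isIdempotentElem f hf
  -- `q = (w⁻¹ e w) f` lies below `f`, and its conjugate `w q w⁻¹ = e (w f w⁻¹)` below `e`.
  set q : R := ((w⁻¹ : Rˣ) : R) * e * w * f with q_eq
  have hq : IsIdempotentElem q := 𝓡.factorisable.isIdempotentElem_mul
    (by simpa using isIdempotentElem_units_conj he' w⁻¹) hf'
  have conj_q : (w : R) * q * ((w⁻¹ : Rˣ) : R) = e * (w * f * ((w⁻¹ : Rˣ) : R)) := by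
    simp [q_eq, mul_assoc]
  have conj_q_mul : (w : R) * q * ((w⁻¹ : Rˣ) : R) * e = w * q * ((w⁻¹ : Rˣ) : R) := by
    rw [conj_q, 𝓡.factorisable.idempotents_commute _ _ he' (isIdempotentElem_units_conj hf' w),
      mul_assoc, he'.eq]
  obtain ⟨h, hh, hhf, b, hb, conj_b⟩ :=
    𝓡.exists_conj_eq_of_mul_eq_self hf hq (by rw [q_eq, mul_assoc, hf'.eq])
  obtain ⟨h', hh', hhe, a, ha, conj_a⟩ :=
    𝓡.exists_conj_eq_of_mul_eq_self he (isIdempotentElem_units_conj hq w) conj_q_mul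
  have conj_eq : (a : R) * h' * ((a⁻¹ : Rˣ) : R) =
      ((w * b : Rˣ) : R) * h * (((w * b)⁻¹ : Rˣ) : R) := by
    rw [conj_a, ← conj_b]
    simp [mul_assoc]
  obtain rfl : h' = h := 𝓡.eq_of_conj_eq_conj hh' hh conj_eq
  have w_mem : w ∈ unitStabilizer h' := 𝓡.mem_unitStabilizer_of_mul_mul_mem he hf hh hhe hw
    (inv_mem ha) hb (by simpa [mul_assoc] using inv_mul_mem_unitCentralizer conj_eq)
  have q_eq_h : q = h' := by
    rw [← conj_b]
    refine 𝓡.conj_eq_self_of_mul_conj_eq_self hh ?_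
    rw [conj_b, q_eq, ← mul_assoc, ← mul_assoc, ← mul_assoc, (inv_mem w_mem).2, hhe, w_mem.2, hhf]
  refine ⟨h', hh, w_mem, hhe, ?_⟩
  calc e * w * f = w * q := by simp [q_eq, mul_assoc]
    _ = h' := by rw [q_eq_h, w_mem.1]

theorem mul_mul_mem_Λ (he : e ∈ 𝓡.Λ) (hf : f ∈ 𝓡.Λ) (hw : w ∈ 𝓡.Red e f) : e * w * f ∈ 𝓡.Λ := by
  obtain ⟨h, hh, -, -, rfl⟩ := 𝓡.exists_mul_mul_eq_mem_Λ he hf hw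
  exact hh

theorem mem_unitStabilizer_mul_mul (he : e ∈ 𝓡.Λ) (hf : f ∈ 𝓡.Λ) (hw : w ∈ 𝓡.Red e f) :
    w ∈ unitStabilizer (e * w * f) := by
  obtain ⟨h, -, w_mem, -, rfl⟩ := 𝓡.exists_mul_mul_eq_mem_Λ he hf hw
  exact w_mem

theorem mul_mul_mul_left_eq (he : e ∈ 𝓡.Λ) (hf : f ∈ 𝓡.Λ) (hw : w ∈ 𝓡.Red e f) :
    e * w * f * e = e * w * f := by
  obtain ⟨h, -, -, mul_eq, rfl⟩ := 𝓡.exists_mul_mul_eq_mem_Λ he hf hw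
  exact mul_eq

theorem isWedge_iff (he : e ∈ 𝓡.Λ) (hf : f ∈ 𝓡.Λ) (hw : w ∈ 𝓡.Red e f) {h : R} :
    𝓡.IsWedge e w f h ↔ h = e * w * f := by
  have w_mem := 𝓡.mem_unitStabilizer_mul_mul he hf hw
  constructor
  · rintro ⟨-, -, eq_mul⟩
    rw [← w_mem.1, Units.mul_right_inj] at eq_mul
    exact eq_mul.symm
  · rintro rfl
    exact ⟨𝓡.mul_mul_mem_Λ he hf hw, unitStabilizer_le_unitCentralizer _ w_mem, w_mem.1.symm⟩

theorem mul_mul_mem_LambdaCirc (he : e ∈ 𝓡.LambdaCirc) (hf : f ∈ 𝓡.Λ) (hw : w ∈ 𝓡.Red e f) :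
    e * w * f ∈ 𝓡.LambdaCirc := by
  refine ⟨𝓡.mul_mul_mem_Λ he.1 hf hw, fun h => he.2 ?_⟩
  have mul_eq := 𝓡.mul_mul_mul_left_eq he.1 hf hw
  rw [Set.mem_singleton_iff] at h ⊢
  rwa [h, one_mul] at mul_eq

theorem existsUnique_wedge (he : e ∈ 𝓡.LambdaCirc) (hf : f ∈ 𝓡.LambdaCirc)
    (hw : w ∈ 𝓡.Red e f) : ∃! h : R, h ∈ 𝓡.LambdaCirc ∧ 𝓡.IsWedge e w f h :=
  ⟨e * w * f, ⟨𝓡.mul_mul_mem_LambdaCirc he hf.1 hw, (𝓡.isWedge_iff he.1 hf.1 hw).2 rfl⟩,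
    fun _ h => (𝓡.isWedge_iff he.1 hf.1 hw).1 h.2⟩

end Wedge

end RennerCoxeterSystem

namespace RennerCoxeterSystem

open CoxeterSystem CoxeterGroup

variable {B R : Type*} [Monoid R] {M : CoxeterMatrix B} (𝓡 : RennerCoxeterSystem M R)
variable {e f g : R}

section Length

theorem length_prod_letterVal_le (ω : List 𝓡.Letter) :
    𝓡.length (ω.map 𝓡.letterVal).prod ≤ (ω.map 𝓡.letterLength).sum :=
  Nat.sInf_le ⟨ω, rfl, rfl⟩

theorem exists_word_sum_letterLength_eq (r : R) : ∃ ω : List 𝓡.Letter,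
    (ω.map 𝓡.letterVal).prod = r ∧ (ω.map 𝓡.letterLength).sum = 𝓡.length r := by
  obtain ⟨ω, h⟩ := 𝓡.exists_word r
  exact Nat.sInf_mem (s := {n | ∃ ω : List 𝓡.Letter,
    (ω.map 𝓡.letterVal).prod = r ∧ (ω.map 𝓡.letterLength).sum = n}) ⟨_, ω, h, rfl⟩

theorem length_mul_le (r r' : R) : 𝓡.length (r * r') ≤ 𝓡.length r + 𝓡.length r' := by
  obtain ⟨ω, rfl, h⟩ := 𝓡.exists_word_sum_letterLength_eq r
  obtain ⟨ω', rfl, h'⟩ := 𝓡.exists_word_sum_letterLength_eq r'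
  rw [← h, ← h']
  simpa using 𝓡.length_prod_letterVal_le (ω ++ ω')

theorem length_letterVal_le (x : 𝓡.Letter) : 𝓡.length (𝓡.letterVal x) ≤ 𝓡.letterLength x := by
  simpa using 𝓡.length_prod_letterVal_le [x]

theorem length_one : 𝓡.length 1 = 0 := by
  simpa using 𝓡.length_prod_letterVal_le []

theorem length_of_mem_Λ (hg : g ∈ 𝓡.Λ) : 𝓡.length g = 0 := by
  by_cases h : g = 1
  · rw [h, 𝓡.length_one]
  · exact Nat.le_zero.1 (𝓡.length_letterVal_le (Sum.inr ⟨g, hg, h⟩))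

theorem length_wordProd_le (ω : List B) : 𝓡.length (𝓡.cs.wordProd ω : R) ≤ ω.length := by
  induction ω with
  | nil => simp [𝓡.length_one]
  | cons i ω ih =>
    rw [wordProd_cons, Units.val_mul, List.length_cons, add_comm]
    exact (𝓡.length_mul_le _ _).trans (add_le_add (𝓡.length_letterVal_le (Sum.inl i)) ih)

theorem length_units_le (u : Rˣ) : 𝓡.length (u : R) ≤ 𝓡.cs.length u := by
  obtain ⟨ω, hω, rfl⟩ := 𝓡.cs.exists_isReduced u
  rw [hω.eq]
  exact 𝓡.length_wordProd_le ω

theorem length_mul_mul_le (u : Rˣ) (hg : g ∈ 𝓡.Λ) (v : Rˣ) :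
    𝓡.length (u * g * v) ≤ 𝓡.cs.length u + 𝓡.cs.length v :=
  calc 𝓡.length (u * g * v) ≤ 𝓡.length u + 𝓡.length g + 𝓡.length v :=
        (𝓡.length_mul_le _ _).trans (add_le_add_left (𝓡.length_mul_le _ _) _)
    _ ≤ 𝓡.cs.length u + 𝓡.cs.length v := by
        rw [𝓡.length_of_mem_Λ hg, add_zero]
        exact add_le_add (𝓡.length_units_le u) (𝓡.length_units_le v)

theorem exists_mul_mul_eq_lambda_mul (he : e ∈ 𝓡.Λ) (hg : g ∈ 𝓡.Λ) (u v : Rˣ) :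
    ∃ (u' : Rˣ) (g' : R) (v' : Rˣ), g' ∈ 𝓡.Λ ∧ (u' : R) * g' * v' = e * (u * g * v) ∧
      𝓡.cs.length u' + 𝓡.cs.length v' ≤ 𝓡.cs.length u + 𝓡.cs.length v := by
  obtain ⟨a, ha, w, hw, b, hb, rfl, length_eq⟩ :=
    exists_mul_isDoubleReduced_mul_eq 𝓡.cs (typeMap 𝓡.cs e) (typeMap 𝓡.cs g) u
  rw [← 𝓡.unitCentralizer_eq_standardParabolic he, mem_unitCentralizer_iff] at ha
  rw [← 𝓡.unitCentralizer_eq_standardParabolic hg, mem_unitCentralizer_iff] at hb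
  refine ⟨a, e * w * g, b * v, 𝓡.mul_mul_mem_Λ he hg hw, ?_, ?_⟩
  · calc (a : R) * (e * w * g) * (b * v : Rˣ) = a * e * w * (g * b) * v := by simp [mul_assoc]
      _ = e * ((a * w * b : Rˣ) * g * v) := by rw [ha, ← hb]; simp [mul_assoc]
  · have := 𝓡.cs.length_mul_le b v
    omega

theorem exists_mul_mul_eq_prod_letterVal (ω : List 𝓡.Letter) :
    ∃ (u : Rˣ) (g : R) (v : Rˣ), g ∈ 𝓡.Λ ∧ (u : R) * g * v = (ω.map 𝓡.letterVal).prod ∧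
      𝓡.cs.length u + 𝓡.cs.length v ≤ (ω.map 𝓡.letterLength).sum := by
  induction ω with
  | nil => exact ⟨1, 1, 1, 𝓡.one_mem_Λ, by simp, by simp⟩
  | cons x ω ih =>
    obtain ⟨u, g, v, hg, h, length_le⟩ := ih
    rw [List.map_cons, List.prod_cons, ← h, List.map_cons, List.sum_cons]
    rcases x with i | e
    · refine ⟨𝓡.cs.simple i * u, g, v, hg, by simp [letterVal, mul_assoc], ?_⟩
      have := 𝓡.cs.length_mul_le (𝓡.cs.simple i) u
      rw [length_simple] at this
      simp only [letterLength]
      omega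
    · obtain ⟨u', g', v', hg', h', length_le'⟩ := 𝓡.exists_mul_mul_eq_lambda_mul e.2.1 hg u v
      exact ⟨u', g', v', hg', h', by simp only [letterLength]; omega⟩

theorem exists_mul_mul_eq_length_add_eq (r : R) :
    ∃ (u : Rˣ) (g : R) (v : Rˣ), g ∈ 𝓡.Λ ∧ (u : R) * g * v = r ∧
      𝓡.cs.length u + 𝓡.cs.length v = 𝓡.length r := by
  obtain ⟨ω, rfl, hω⟩ := 𝓡.exists_word_sum_letterLength_eq r
  obtain ⟨u, g, v, hg, h, length_le⟩ := 𝓡.exists_mul_mul_eq_prod_letterVal ω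
  refine ⟨u, g, v, hg, h, le_antisymm (hω ▸ length_le) ?_⟩
  rw [← h]
  exact 𝓡.length_mul_mul_le u hg v

end Length

section NormalForm

variable {u v u' v' : Rˣ}

theorem eq_and_mem_of_mul_mul_eq {g' : R} (hg : g ∈ 𝓡.Λ) (hg' : g' ∈ 𝓡.Λ)
    (h : (u : R) * g * v = u' * g' * v') :
    g = g' ∧ v' * v⁻¹ ∈ unitCentralizer g ∧ u⁻¹ * u' * (v' * v⁻¹) ∈ unitStabilizer g := by
  have hg_idem := 𝓡.isIdempotentElem g hg
  have conj_eq : (u : R) * g * ((u⁻¹ : Rˣ) : R) = u' * g' * ((u'⁻¹ : Rˣ) : R) :=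
    𝓡.factorisable.eq_of_mul_units_eq (u := u * v) (v := u' * v')
      (isIdempotentElem_units_conj hg_idem u)
      (isIdempotentElem_units_conj (𝓡.isIdempotentElem g' hg') u') (by simpa [mul_assoc] using h)
  obtain rfl := 𝓡.eq_of_conj_eq_conj hg hg' conj_eq
  have left_mem : u⁻¹ * u' ∈ unitCentralizer g := inv_mul_mem_unitCentralizer conj_eq
  have mul_mem : u⁻¹ * u' * (v' * v⁻¹) ∈ unitStabilizer g := by
    refine 𝓡.factorisable.mem_unitStabilizer hg_idem ?_
    rw [Units.val_mul, ← mul_assoc, ← mem_unitCentralizer_iff.1 left_mem]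
    calc ((u⁻¹ * u' : Rˣ) : R) * g * ((v' * v⁻¹ : Rˣ) : R)
        = ((u⁻¹ : Rˣ) : R) * (u' * g * v') * ((v⁻¹ : Rˣ) : R) := by simp [mul_assoc]
      _ = g := by rw [← h]; simp [mul_assoc]
  have right_mem := Subgroup.mul_mem _ (inv_mem left_mem)
    (unitStabilizer_le_unitCentralizer _ mul_mem)
  rw [inv_mul_cancel_left] at right_mem
  exact ⟨rfl, right_mem, mul_mem⟩

/-- The conditions under which `u g v` is a normal form: every element of `R` has exactly one
(`exists_isNormal`, `IsNormal.unique`), and its length is `ℓ(u) + ℓ(v)`. -/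
structure IsNormal (u : Rˣ) (g : R) (v : Rˣ) : Prop where
  mem : g ∈ 𝓡.Λ
  right : IsRightReduced 𝓡.cs (lowerType 𝓡.cs g) u
  left : IsLeftReduced 𝓡.cs (typeMap 𝓡.cs g) v

variable {𝓡}

theorem IsNormal.length_eq (h : 𝓡.IsNormal u g v) :
    𝓡.length (u * g * v) = 𝓡.cs.length u + 𝓡.cs.length v := by
  refine le_antisymm (𝓡.length_mul_mul_le u h.mem v) ?_
  obtain ⟨x, g', y, hg', h_eq, length_eq⟩ := 𝓡.exists_mul_mul_eq_length_add_eq (u * g * v)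
  obtain ⟨rfl, right_mem, mul_mem⟩ := 𝓡.eq_and_mem_of_mul_mul_eq h.mem hg' h_eq.symm
  rw [𝓡.unitCentralizer_eq_standardParabolic h.mem] at right_mem
  rw [𝓡.unitStabilizer_eq_standardParabolic h.mem] at mul_mem
  have length_y := h.left.length_mul right_mem
  rw [inv_mul_cancel_right] at length_y
  have length_le := h.right.length_le_length_mul _ mul_mem
  rw [show u * (u⁻¹ * x * (y * v⁻¹)) = x * (y * v⁻¹) by group] at length_le
  have := 𝓡.cs.length_mul_le x (y * v⁻¹)
  omega

theorem IsNormal.unique {g' : R} (h : 𝓡.IsNormal u g v) (h' : 𝓡.IsNormal u' g' v')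
    (h_eq : (u : R) * g * v = u' * g' * v') : u = u' ∧ g = g' ∧ v = v' := by
  obtain ⟨rfl, right_mem, mul_mem⟩ := 𝓡.eq_and_mem_of_mul_mul_eq h.mem h'.mem h_eq
  rw [𝓡.unitCentralizer_eq_standardParabolic h.mem] at right_mem
  obtain rfl := h.left.eq_of_mul_inv_mem h'.left right_mem
  rw [mul_inv_cancel, mul_one, 𝓡.unitStabilizer_eq_standardParabolic h.mem] at mul_mem
  exact ⟨h.right.eq_of_inv_mul_mem h'.right mul_mem, rfl, rfl⟩

variable (𝓡)

theorem exists_isRightReduced_mul_eq_mul (hg : g ∈ 𝓡.Λ) (u : Rˣ) :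
    ∃ x y : Rˣ, IsRightReduced 𝓡.cs (lowerType 𝓡.cs g) x ∧ x * y = u ∧
      𝓡.cs.length u = 𝓡.cs.length x + 𝓡.cs.length y ∧ (u : R) * g = x * g := by
  obtain ⟨x, y, hx, hy, rfl⟩ := exists_isRightReduced_mul_eq 𝓡.cs (lowerType 𝓡.cs g) u
  refine ⟨x, y, hx, rfl, hx.length_mul hy, ?_⟩
  rw [← 𝓡.unitStabilizer_eq_standardParabolic hg] at hy
  rw [Units.val_mul, mul_assoc, hy.1]

theorem exists_isNormal (r : R) : ∃ u g v, 𝓡.IsNormal u g v ∧ (u : R) * g * v = r := by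
  obtain ⟨u, g, v, hg, rfl, -⟩ := 𝓡.exists_mul_mul_eq_length_add_eq r
  obtain ⟨y, d, hy, hd, rfl⟩ := exists_mul_isLeftReduced_eq 𝓡.cs (typeMap 𝓡.cs g) v
  obtain ⟨x, -, hx, -, -, mul_eq⟩ := 𝓡.exists_isRightReduced_mul_eq_mul hg (u * y)
  rw [← 𝓡.unitCentralizer_eq_standardParabolic hg, mem_unitCentralizer_iff] at hy
  refine ⟨x, g, d, ⟨hg, hx, hd⟩, ?_⟩
  rw [← mul_eq, Units.val_mul, Units.val_mul, mul_assoc (u : R), hy]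
  simp only [mul_assoc]

theorem isRightReduced_of_mem_upperType {y : Rˣ}
    (hy : y ∈ standardParabolic 𝓡.cs (upperType 𝓡.cs g)) :
    IsRightReduced 𝓡.cs (lowerType 𝓡.cs g) y := by
  intro i hi
  rw [← 𝓡.cs.not_isRightDescent_iff]
  intro descent
  obtain ⟨j, hj, simple_eq⟩ := exists_simple_eq_of_simple_mem_standardParabolic
    (simple_mem_standardParabolic_of_isRightDescent hy descent)
  exact 𝓡.simple_notMem_of_mem_upperType hj (simple_eq ▸ hi)

-- Write `u = x d` with `d ∈ W(g)` and `ℓ(x z) = ℓ(x) + ℓ(z)` for all `z ∈ W(g)`. Then `d`, like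
-- `u`, is reduced with respect to `W_⋆(g)`, hence lies in `W_{λ^⋆(g)}`, and so does `d y`.
theorem isRightReduced_mul_of_mem_upperType (hg : g ∈ 𝓡.Λ) {y : Rˣ}
    (hu : IsRightReduced 𝓡.cs (lowerType 𝓡.cs g) u)
    (hy : y ∈ standardParabolic 𝓡.cs (upperType 𝓡.cs g)) :
    IsRightReduced 𝓡.cs (lowerType 𝓡.cs g) (u * y) := by
  obtain ⟨x, d, hx, hd, rfl⟩ := exists_isRightReduced_mul_eq 𝓡.cs (typeMap 𝓡.cs g) u
  have isRightReduced_iff : ∀ z ∈ standardParabolic 𝓡.cs (typeMap 𝓡.cs g),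
      IsRightReduced 𝓡.cs (lowerType 𝓡.cs g) (x * z) ↔
        IsRightReduced 𝓡.cs (lowerType 𝓡.cs g) z := by
    intro z hz
    refine forall₂_congr fun i hi => ?_
    have mul_simple_mem := Subgroup.mul_mem _ hz
      (simple_mem_standardParabolic _ (𝓡.lowerType_subset_typeMap g hi))
    rw [mul_assoc, hx.length_mul hz, hx.length_mul mul_simple_mem, add_assoc, add_right_inj]
  obtain ⟨a, ha, b, hb, rfl⟩ := 𝓡.exists_mul_eq_of_mem_unitCentralizer hg
    (𝓡.unitCentralizer_eq_standardParabolic hg ▸ hd)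
  have a_mul_b := (𝓡.commute_of_mem_lower_of_mem_upper hg ha hb).eq
  have b_eq : b = a * b := (𝓡.isRightReduced_of_mem_upperType hb).eq_of_inv_mul_mem
    ((isRightReduced_iff _ hd).1 hu) (by rwa [a_mul_b, inv_mul_cancel_left])
  obtain rfl : a = 1 := right_eq_mul.1 b_eq
  rw [one_mul] at hd ⊢
  rw [mul_assoc, isRightReduced_iff _ (Subgroup.mul_mem _ hd
    (standardParabolic_mono (𝓡.upperType_subset_typeMap g) hy))]
  exact 𝓡.isRightReduced_of_mem_upperType (Subgroup.mul_mem _ hb hy)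

variable {𝓡}

theorem IsNormal.length_simple_mul {i : B} (h : 𝓡.IsNormal (𝓡.cs.simple i * u) g v) :
    𝓡.length (𝓡.cs.simple i * (u * g * v)) = 𝓡.cs.length (𝓡.cs.simple i * u) + 𝓡.cs.length v := by
  rw [← h.length_eq]
  simp only [Units.val_mul, mul_assoc]

theorem IsNormal.simple_mul (h : 𝓡.IsNormal u g v) (i : B) :
    𝓡.IsNormal (𝓡.cs.simple i * u) g v ∨
      (𝓡.cs.simple i : R) * (u * g * v) = u * g * v := by
  refine (h.right.simple_mul i).imp (fun hu => ⟨h.mem, hu, h.left⟩) ?_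
  rintro ⟨t, ht, simple_mul_eq⟩
  calc (𝓡.cs.simple i : R) * (u * g * v) = (𝓡.cs.simple i * u : Rˣ) * g * v := by simp [mul_assoc]
    _ = u * (𝓡.cs.simple t * g) * v := by rw [simple_mul_eq]; simp [mul_assoc]
    _ = u * g * v := by rw [ht.1]

theorem IsNormal.mul_simple (h : 𝓡.IsNormal u g v) (j : B) :
    𝓡.IsNormal u g (v * 𝓡.cs.simple j) ∨
      (∃ t, 𝓡.IsNormal (u * 𝓡.cs.simple t) g v ∧
        (u * g * v : R) * 𝓡.cs.simple j = (u * 𝓡.cs.simple t : Rˣ) * g * v) ∨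
      (u * g * v : R) * 𝓡.cs.simple j = u * g * v := by
  refine (h.left.mul_simple j).imp (fun hv => ⟨h.mem, h.right, hv⟩) ?_
  rintro ⟨t, ht, mul_simple_eq⟩
  have mul_eq : (u * g * v : R) * 𝓡.cs.simple j = u * (g * 𝓡.cs.simple t) * v := by
    rw [mul_assoc, ← Units.val_mul, mul_simple_eq]
    simp [mul_assoc]
  refine (𝓡.mem_upperType_or_mem_lowerType ht).imp (fun upper => ⟨t, ⟨h.mem, ?_, h.left⟩, ?_⟩)
    fun lower => ?_
  · exact 𝓡.isRightReduced_mul_of_mem_upperType h.mem h.right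
      (simple_mem_standardParabolic _ upper)
  · rw [mul_eq, ← upper.1]
    simp [mul_assoc]
  · rw [mul_eq, lower.2]

variable (𝓡)

theorem length_simple_mul_trichotomy (i : B) (r : R) :
    𝓡.length (𝓡.cs.simple i * r) = 𝓡.length r + 1 ∨ (𝓡.cs.simple i : R) * r = r ∨
      𝓡.length (𝓡.cs.simple i * r) + 1 = 𝓡.length r := by
  obtain ⟨u, g, v, h, rfl⟩ := 𝓡.exists_isNormal r
  rcases h.simple_mul i with h_simple | simple_mul_eq
  · rw [h_simple.length_simple_mul, h.length_eq]
    have := 𝓡.cs.length_simple_mul u i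
    omega
  · exact Or.inr (Or.inl simple_mul_eq)

theorem coe_simple_mul_eq_mul_coe_simple {i j : B} {r : R}
    (length_ne : 𝓡.length (𝓡.cs.simple i * r) ≠ 𝓡.length r)
    (length_eq : 𝓡.length (𝓡.cs.simple i * r) = 𝓡.length (r * 𝓡.cs.simple j))
    (length_eq' : 𝓡.length (𝓡.cs.simple i * r * 𝓡.cs.simple j) = 𝓡.length r) :
    (𝓡.cs.simple i : R) * r = r * 𝓡.cs.simple j := by
  obtain ⟨u, g, v, h, rfl⟩ := 𝓡.exists_isNormal r
  rcases h.simple_mul i with hs | simple_mul_eq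
  swap
  · exact absurd (congrArg 𝓡.length simple_mul_eq) length_ne
  rw [hs.length_simple_mul, h.length_eq] at length_ne
  rw [hs.length_simple_mul] at length_eq
  rw [h.length_eq, mul_assoc] at length_eq'
  rcases h.mul_simple j with ht | ⟨t, ht, mul_simple_eq⟩ | mul_simple_eq
  · have length_right := ht.length_eq
    rw [Units.val_mul, ← mul_assoc] at length_right
    have length_both := IsNormal.length_simple_mul ⟨h.mem, hs.right, ht.left⟩
    rw [Units.val_mul, ← mul_assoc (u * g : R)] at length_both
    have := 𝓡.cs.length_simple_mul u i
    omega
  · rw [mul_simple_eq] at length_eq length_eq' ⊢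
    rw [ht.length_eq] at length_eq
    rcases ht.simple_mul i with hst | simple_mul_eq
    · rw [hst.length_simple_mul] at length_eq'
      have simple_mul_u : 𝓡.cs.simple i * u = u * 𝓡.cs.simple t :=
        simple_mul_eq_mul_simple (by omega) (by rw [mul_assoc]; omega)
      rw [← simple_mul_u]
      simp [mul_assoc]
    · rw [simple_mul_eq, ht.length_eq] at length_eq'
      omega
  · rw [mul_simple_eq, h.length_eq] at length_eq
    exact absurd length_eq length_ne

theorem exists_mul_isLeftReduced_typeMap_eq (hg : g ∈ 𝓡.Λ) {b : Rˣ}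
    (hb : IsLeftReduced 𝓡.cs (upperType 𝓡.cs g) b) :
    ∃ y ∈ unitStabilizer g, ∃ d, IsLeftReduced 𝓡.cs (typeMap 𝓡.cs g) d ∧ y * d = b := by
  obtain ⟨y, d, hy, hd, rfl⟩ := exists_mul_isLeftReduced_eq 𝓡.cs (typeMap 𝓡.cs g) b
  obtain ⟨x, hx, z, hz, rfl⟩ := 𝓡.exists_mul_eq_of_mem_unitCentralizer hg
    (𝓡.unitCentralizer_eq_standardParabolic hg ▸ hy)
  have x_mul_z := (𝓡.commute_of_mem_lower_of_mem_upper hg hx hz).eq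
  have z_eq_one : z = 1 := by
    have length_mul := hd.length_mul hy
    have length_inv_mul := hb.length_mul (inv_mem hz)
    have length_z_mul_x := (𝓡.isRightReduced_of_mem_upperType hz).length_mul hx
    rw [𝓡.cs.length_inv, x_mul_z, mul_assoc, inv_mul_cancel_left, ← mul_assoc] at length_inv_mul
    rw [x_mul_z] at length_mul
    have := 𝓡.cs.length_mul_le x d
    exact 𝓡.cs.length_eq_zero_iff.1 (by omega)
  rw [z_eq_one, mul_one]
  exact ⟨x, (𝓡.unitStabilizer_eq_standardParabolic hg).symm ▸ hx, d, hd, rfl⟩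

theorem exists_isLeftReduced_mul_eq_mul_mul_lambda (hg : g ∈ 𝓡.Λ) (he : e ∈ 𝓡.Λ)
    (hv : IsLeftReduced 𝓡.cs (typeMap 𝓡.cs g) v) :
    ∃ k ∈ 𝓡.Λ, ∃ d : Rˣ, IsLeftReduced 𝓡.cs (typeMap 𝓡.cs k) d ∧ k * (d : R) = g * v * e := by
  obtain ⟨w, hw, b, hb, rfl, length_eq⟩ := hv.exists_isDoubleReduced_mul_eq 𝓡.cs (typeMap 𝓡.cs e)
  rw [← 𝓡.unitCentralizer_eq_standardParabolic he, mem_unitCentralizer_iff] at hb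
  have hk := 𝓡.mul_mul_mem_Λ hg he hw
  have w_mem := 𝓡.mem_unitStabilizer_mul_mul hg he hw
  have upperType_subset := (𝓡.upperType_mono _ hk _ hg (𝓡.mul_mul_mul_left_eq hg he hw)).trans
    (𝓡.upperType_subset_typeMap g)
  have b_reduced : IsLeftReduced 𝓡.cs (upperType 𝓡.cs (g * w * e)) b := by
    intro t ht
    have length_simple_mul := hv t (upperType_subset ht)
    have w_comm := (𝓡.commute_of_mem_lower_of_mem_upper hk
      (𝓡.unitStabilizer_eq_standardParabolic hk ▸ w_mem) (simple_mem_standardParabolic _ ht)).eq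
    rw [← mul_assoc, ← w_comm, mul_assoc] at length_simple_mul
    have := 𝓡.cs.length_mul_le w (𝓡.cs.simple t * b)
    have := 𝓡.cs.length_simple_mul b t
    omega
  obtain ⟨y, hy, d, hd, rfl⟩ := 𝓡.exists_mul_isLeftReduced_typeMap_eq hk b_reduced
  refine ⟨g * w * e, hk, d, hd, ?_⟩
  calc g * w * e * (d : R) = g * w * e * y * d := by rw [hy.2]
    _ = g * w * (e * (y * d : Rˣ)) := by simp [mul_assoc]
    _ = g * (w * (y * d) : Rˣ) * e := by rw [← hb]; simp [mul_assoc]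

theorem length_mul_mul_le_length_simple_mul {i : B} (hg : g ∈ 𝓡.Λ)
    (hv : IsLeftReduced 𝓡.cs (typeMap 𝓡.cs g) v)
    (hu : 𝓡.cs.length (𝓡.cs.simple i * u) = 𝓡.cs.length u + 1) :
    𝓡.length (u * g * v) ≤ 𝓡.length (𝓡.cs.simple i * (u * g * v)) := by
  obtain ⟨x, y, hx, rfl, length_mul, mul_eq⟩ := 𝓡.exists_isRightReduced_mul_eq_mul hg u
  have h : 𝓡.IsNormal x g v := ⟨hg, hx, hv⟩
  rw [mul_eq]
  rcases h.simple_mul i with hs | simple_mul_eq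
  · rw [hs.length_simple_mul, h.length_eq]
    have := 𝓡.cs.length_mul_le (𝓡.cs.simple i * x) y
    rw [mul_assoc] at this
    omega
  · rw [simple_mul_eq]

theorem length_mul_lambda_le_length_simple_mul (he : e ∈ 𝓡.Λ) {i : B} {r : R}
    (hr : 𝓡.length (𝓡.cs.simple i * r) = 𝓡.length r + 1) :
    𝓡.length (r * e) ≤ 𝓡.length (𝓡.cs.simple i * (r * e)) := by
  obtain ⟨u, g, v, h, rfl⟩ := 𝓡.exists_isNormal r
  rcases h.simple_mul i with hs | simple_mul_eq
  swap
  · rw [simple_mul_eq] at hr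
    omega
  rw [hs.length_simple_mul, h.length_eq] at hr
  obtain ⟨k, hk, d, hd, mul_eq⟩ := 𝓡.exists_isLeftReduced_mul_eq_mul_mul_lambda h.mem he h.left
  have := 𝓡.length_mul_mul_le_length_simple_mul (i := i) (u := u) hk hd (by omega)
  rwa [mul_assoc (u : R), mul_eq, ← mul_assoc (u : R), ← mul_assoc (u : R)] at this

end NormalForm

end RennerCoxeterSystem

namespace IsFactorisableMonoid

variable {R : Type*} [Monoid R] {e : R}

/-- The anti-automorphism `e u ↦ u⁻¹ e` of a factorisable monoid (`e` idempotent, `u` a unit). It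
exchanges statements about left and right multiplication. The choice of a factorisation `e u` is
immaterial by `involution_idempotent_mul_units`. -/
noncomputable def involution (hR : IsFactorisableMonoid R) (r : R) : R :=
  (((hR.exists_idempotent_mul_unit r).choose_spec.choose⁻¹ : Rˣ) : R) *
    (hR.exists_idempotent_mul_unit r).choose

variable (hR : IsFactorisableMonoid R)

theorem involution_idempotent_mul_units (he : IsIdempotentElem e) (u : Rˣ) :
    hR.involution (e * u) = ((u⁻¹ : Rˣ) : R) * e := by
  obtain ⟨hf, h⟩ := (hR.exists_idempotent_mul_unit (e * u)).choose_spec.choose_spec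
  rw [involution]
  generalize (hR.exists_idempotent_mul_unit (e * u)).choose_spec.choose = v at *
  generalize (hR.exists_idempotent_mul_unit (e * u)).choose = f at *
  obtain rfl : e = f := hR.eq_of_mul_units_eq he hf h
  have mem_stabilizer : v * u⁻¹ ∈ unitStabilizer e := hR.mem_unitStabilizer he (by
    rw [Units.val_mul, ← mul_assoc, ← h, mul_assoc, Units.mul_inv, mul_one])
  rw [Units.inv_mul_eq_iff_eq_mul, ← mul_assoc, ← Units.val_mul, mem_stabilizer.1]

theorem involution_units_mul (u : Rˣ) (r : R) :
    hR.involution (u * r) = hR.involution r * ((u⁻¹ : Rˣ) : R) := by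
  obtain ⟨e, v, he, rfl⟩ := hR.exists_idempotent_mul_unit r
  have mul_eq : (u : R) * (e * v) = u * e * ((u⁻¹ : Rˣ) : R) * ((u * v : Rˣ) : R) := by
    simp [mul_assoc]
  rw [mul_eq, hR.involution_idempotent_mul_units (isIdempotentElem_units_conj he u),
    hR.involution_idempotent_mul_units he]
  simp [mul_assoc]

theorem involution_mul_units (r : R) (u : Rˣ) :
    hR.involution (r * u) = ((u⁻¹ : Rˣ) : R) * hR.involution r := by
  obtain ⟨e, v, he, rfl⟩ := hR.exists_idempotent_mul_unit r
  rw [mul_assoc, ← Units.val_mul, hR.involution_idempotent_mul_units he,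
    hR.involution_idempotent_mul_units he, mul_inv_rev, Units.val_mul, mul_assoc]

theorem involution_idempotent (he : IsIdempotentElem e) : hR.involution e = e := by
  simpa using hR.involution_idempotent_mul_units he 1

theorem involution_one : hR.involution 1 = 1 :=
  hR.involution_idempotent (mul_one 1)

theorem involution_idempotent_mul (he : IsIdempotentElem e) (r : R) :
    hR.involution (e * r) = hR.involution r * e := by
  obtain ⟨f, v, hf, rfl⟩ := hR.exists_idempotent_mul_unit r
  rw [← mul_assoc, hR.involution_idempotent_mul_units hf,
    hR.involution_idempotent_mul_units (hR.isIdempotentElem_mul he hf),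
    hR.idempotents_commute e f he hf, mul_assoc]

theorem involution_involutive : Function.Involutive hR.involution := by
  intro r
  obtain ⟨e, v, he, rfl⟩ := hR.exists_idempotent_mul_unit r
  rw [hR.involution_idempotent_mul_units he, hR.involution_units_mul, hR.involution_idempotent he,
    inv_inv]

end IsFactorisableMonoid

namespace RennerCoxeterSystem

open CoxeterSystem CoxeterGroup

variable {B R : Type*} [Monoid R] {M : CoxeterMatrix B} (𝓡 : RennerCoxeterSystem M R)
variable {e f g : R}

section Length

theorem length_involution (r : R) : 𝓡.length (𝓡.factorisable.involution r) = 𝓡.length r := by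
  have length_le : ∀ r, 𝓡.length (𝓡.factorisable.involution r) ≤ 𝓡.length r := by
    intro r
    obtain ⟨u, g, v, hg, rfl, length_eq⟩ := 𝓡.exists_mul_mul_eq_length_add_eq r
    rw [IsFactorisableMonoid.involution_mul_units, IsFactorisableMonoid.involution_units_mul,
      IsFactorisableMonoid.involution_idempotent _ (𝓡.isIdempotentElem g hg), ← mul_assoc,
      ← length_eq, add_comm]
    simpa using 𝓡.length_mul_mul_le v⁻¹ hg u⁻¹
  refine le_antisymm (length_le r) ?_
  simpa only [𝓡.factorisable.involution_involutive r] using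
    length_le (𝓡.factorisable.involution r)

theorem simple_mul_involution (i : B) (r : R) :
    (𝓡.cs.simple i : R) * 𝓡.factorisable.involution r =
      𝓡.factorisable.involution (r * 𝓡.cs.simple i) := by
  rw [IsFactorisableMonoid.involution_mul_units, inv_simple]

theorem length_mul_simple_trichotomy (i : B) (r : R) :
    𝓡.length (r * 𝓡.cs.simple i) = 𝓡.length r + 1 ∨ r * (𝓡.cs.simple i : R) = r ∨
      𝓡.length (r * 𝓡.cs.simple i) + 1 = 𝓡.length r := by
  have trichotomy := 𝓡.length_simple_mul_trichotomy i (𝓡.factorisable.involution r)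
  simpa only [simple_mul_involution, length_involution,
    𝓡.factorisable.involution_involutive.injective.eq_iff] using trichotomy

theorem ne_one_of_mem_lowerType {i : B} (hi : i ∈ lowerType 𝓡.cs g) : g ≠ 1 := by
  rintro rfl
  have simple_eq_one : 𝓡.cs.simple i = 1 := Units.val_eq_one.1 ((mul_one _).symm.trans hi.1)
  simpa [simple_eq_one] using 𝓡.cs.length_simple i

theorem isNormal_units (u : Rˣ) : 𝓡.IsNormal u 1 1 :=
  ⟨𝓡.one_mem_Λ, fun _ hi => absurd rfl (𝓡.ne_one_of_mem_lowerType hi), isLeftReduced_one⟩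

theorem length_units (u : Rˣ) : 𝓡.length (u : R) = 𝓡.cs.length u := by
  simpa using (𝓡.isNormal_units u).length_eq

theorem length_simple (i : B) : 𝓡.length (𝓡.cs.simple i : R) = 1 := by
  rw [length_units, CoxeterSystem.length_simple]

theorem length_units_mul_of_isRightReduced (hg : g ∈ 𝓡.Λ) {u : Rˣ}
    (hu : IsRightReduced 𝓡.cs (lowerType 𝓡.cs g) u) : 𝓡.length (u * g) = 𝓡.cs.length u := by
  simpa using (IsNormal.mk (𝓡 := 𝓡) (v := 1) hg hu isLeftReduced_one).length_eq

theorem length_mul_units_of_isLeftReduced (hg : g ∈ 𝓡.Λ) {v : Rˣ}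
    (hv : IsLeftReduced 𝓡.cs (typeMap 𝓡.cs g) v) : 𝓡.length (g * v) = 𝓡.cs.length v := by
  simpa using (IsNormal.mk (𝓡 := 𝓡) (u := 1) hg isRightReduced_one hv).length_eq

theorem length_mul_le_of_left_mem_Λ (he : e ∈ 𝓡.Λ) (r : R) : 𝓡.length (e * r) ≤ 𝓡.length r := by
  simpa [𝓡.length_of_mem_Λ he] using 𝓡.length_mul_le e r

theorem length_mul_le_of_right_mem_Λ (he : e ∈ 𝓡.Λ) (r : R) : 𝓡.length (r * e) ≤ 𝓡.length r := by
  simpa [𝓡.length_of_mem_Λ he] using 𝓡.length_mul_le r e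

end Length

section Operators

theorem end_ext {R : Type*} {F G : Module.End ℤ[X] (R →₀ ℤ[X])}
    (h : ∀ r : R, F (basisT r) = G (basisT r)) : F = G :=
  Finsupp.lhom_ext' fun r => LinearMap.ext_ring (h r)

/-- The operator that the product of the generic Hecke algebra must have as left multiplication
by `T_s`, `s ∈ S`. -/
noncomputable def leftS (i : B) : Module.End ℤ[X] (R →₀ ℤ[X]) :=
  Finsupp.linearCombination ℤ[X] fun r =>
    if 𝓡.length (𝓡.cs.simple i * r) = 𝓡.length r + 1 then basisT (𝓡.cs.simple i * r)
    else if 𝓡.length (𝓡.cs.simple i * r) = 𝓡.length r then (X : ℤ[X]) • basisT r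
    else (X - 1 : ℤ[X]) • basisT r + (X : ℤ[X]) • basisT (𝓡.cs.simple i * r)

/-- The operator that the product of the generic Hecke algebra must have as left multiplication
by `T_e`. It is meant for `e ∈ Λ`; for other `e` the difference of lengths may be truncated. -/
noncomputable def leftΛ (e : R) : Module.End ℤ[X] (R →₀ ℤ[X]) :=
  Finsupp.linearCombination ℤ[X] fun r =>
    (X ^ (𝓡.length r - 𝓡.length (e * r)) : ℤ[X]) • basisT (e * r)

/-- The operator `leftS` or `leftΛ` attached to a letter of `S ∪ Λ∘`. -/
noncomputable def leftOp : 𝓡.Letter → Module.End ℤ[X] (R →₀ ℤ[X])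
  | Sum.inl i => 𝓡.leftS i
  | Sum.inr e => 𝓡.leftΛ e

/-- The linear involution `T_r ↦ T_{r*}`, where `r ↦ r*` is the involution of `R`. -/
noncomputable def basisInvolution : (R →₀ ℤ[X]) ≃ₗ[ℤ[X]] (R →₀ ℤ[X]) :=
  Finsupp.domLCongr 𝓡.factorisable.involution_involutive.toPerm

/-- Conjugation of endomorphisms by `basisInvolution`. It turns left multiplications into right
multiplications. -/
noncomputable def mirror : Module.End ℤ[X] (R →₀ ℤ[X]) ≃ₐ[ℤ[X]] Module.End ℤ[X] (R →₀ ℤ[X]) :=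
  𝓡.basisInvolution.conjAlgEquiv ℤ[X]

theorem basisInvolution_basisT (r : R) :
    𝓡.basisInvolution (basisT r) = basisT (𝓡.factorisable.involution r) := by
  simp [basisInvolution, basisT]

theorem basisInvolution_symm_basisT (r : R) :
    𝓡.basisInvolution.symm (basisT r) = basisT (𝓡.factorisable.involution r) := by
  rw [LinearEquiv.symm_apply_eq, basisInvolution_basisT, 𝓡.factorisable.involution_involutive]

theorem basisInvolution_symm : 𝓡.basisInvolution.symm = 𝓡.basisInvolution :=
  LinearEquiv.toLinearMap_injective <| end_ext fun r =>
    (𝓡.basisInvolution_symm_basisT r).trans (𝓡.basisInvolution_basisT r).symm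

theorem mirror_basisT (F : Module.End ℤ[X] (R →₀ ℤ[X])) (r : R) :
    𝓡.mirror F (basisT r) =
      𝓡.basisInvolution (F (basisT (𝓡.factorisable.involution r))) := by
  rw [← basisInvolution_symm_basisT]
  rfl

theorem mirror_mirror (F : Module.End ℤ[X] (R →₀ ℤ[X])) : 𝓡.mirror (𝓡.mirror F) = F := by
  have mirror_symm : 𝓡.mirror.symm = 𝓡.mirror := by
    rw [mirror, LinearEquiv.symm_conjAlgEquiv, basisInvolution_symm]
  conv_lhs => enter [1]; rw [← mirror_symm]
  exact 𝓡.mirror.symm_apply_apply F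

variable {𝓡}

theorem commute_mirror_comm {F G : Module.End ℤ[X] (R →₀ ℤ[X])} (h : Commute F (𝓡.mirror G)) :
    Commute G (𝓡.mirror F) := by
  simpa only [mirror_mirror] using (h.map 𝓡.mirror).symm

theorem leftS_basisT_of_length_eq_add_one {i : B} {r : R}
    (h : 𝓡.length (𝓡.cs.simple i * r) = 𝓡.length r + 1) :
    𝓡.leftS i (basisT r) = basisT (𝓡.cs.simple i * r) := by
  rw [leftS, basisT, Finsupp.linearCombination_single, one_smul, if_pos h]

theorem leftS_basisT_of_length_eq {i : B} {r : R}
    (h : 𝓡.length (𝓡.cs.simple i * r) = 𝓡.length r) :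
    𝓡.leftS i (basisT r) = (X : ℤ[X]) • basisT r := by
  rw [leftS, basisT, Finsupp.linearCombination_single, one_smul, if_neg (by lia), if_pos h, basisT]

theorem leftS_basisT_of_simple_mul_eq {i : B} {r : R} (h : (𝓡.cs.simple i : R) * r = r) :
    𝓡.leftS i (basisT r) = (X : ℤ[X]) • basisT r :=
  leftS_basisT_of_length_eq (by rw [h])

theorem leftS_basisT_of_length_add_one_eq {i : B} {r : R}
    (h : 𝓡.length (𝓡.cs.simple i * r) + 1 = 𝓡.length r) :
    𝓡.leftS i (basisT r) =
      (X - 1 : ℤ[X]) • basisT r + (X : ℤ[X]) • basisT (𝓡.cs.simple i * r) := by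
  rw [leftS, basisT, Finsupp.linearCombination_single, one_smul, if_neg (by lia),
    if_neg (by lia), basisT]

theorem leftΛ_basisT (e r : R) : 𝓡.leftΛ e (basisT r) =
    (X ^ (𝓡.length r - 𝓡.length (e * r)) : ℤ[X]) • basisT (e * r) := by
  rw [leftΛ, basisT, Finsupp.linearCombination_single, one_smul]

theorem mirror_leftS_basisT_of_length_eq_add_one {j : B} {r : R}
    (h : 𝓡.length (r * 𝓡.cs.simple j) = 𝓡.length r + 1) :
    𝓡.mirror (𝓡.leftS j) (basisT r) = basisT (r * 𝓡.cs.simple j) := by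
  rw [mirror_basisT, leftS_basisT_of_length_eq_add_one, simple_mul_involution,
    basisInvolution_basisT, 𝓡.factorisable.involution_involutive]
  rwa [simple_mul_involution, length_involution, length_involution]

theorem mirror_leftS_basisT_of_mul_simple_eq {j : B} {r : R}
    (h : r * (𝓡.cs.simple j : R) = r) :
    𝓡.mirror (𝓡.leftS j) (basisT r) = (X : ℤ[X]) • basisT r := by
  rw [mirror_basisT, leftS_basisT_of_simple_mul_eq, map_smul, basisInvolution_basisT,
    𝓡.factorisable.involution_involutive]
  rw [simple_mul_involution, h]

theorem mirror_leftΛ_basisT (he : IsIdempotentElem e) (r : R) :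
    𝓡.mirror (𝓡.leftΛ e) (basisT r) =
      (X ^ (𝓡.length r - 𝓡.length (r * e)) : ℤ[X]) • basisT (r * e) := by
  have mul_involution : e * 𝓡.factorisable.involution r = 𝓡.factorisable.involution (r * e) := by
    conv_lhs => rw [← 𝓡.factorisable.involution_involutive (e * _),
      𝓡.factorisable.involution_idempotent_mul he, 𝓡.factorisable.involution_involutive]
  rw [mirror_basisT, leftΛ_basisT, mul_involution, length_involution, length_involution, map_smul,
    basisInvolution_basisT, 𝓡.factorisable.involution_involutive]

theorem simple_mul_simple_mul (i : B) (r : R) :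
    (𝓡.cs.simple i : R) * (𝓡.cs.simple i * r) = r := by
  rw [← mul_assoc, ← Units.val_mul, simple_mul_simple_self, Units.val_one, one_mul]

theorem mul_simple_mul_simple (r : R) (j : B) :
    r * (𝓡.cs.simple j : R) * 𝓡.cs.simple j = r := by
  rw [mul_assoc, ← Units.val_mul, simple_mul_simple_self, Units.val_one, mul_one]

variable (𝓡)

theorem leftS_mul_self (i : B) :
    𝓡.leftS i * 𝓡.leftS i = (X - 1 : ℤ[X]) • 𝓡.leftS i + (X : ℤ[X]) • 1 := by
  refine end_ext fun r => ?_
  simp only [Module.End.mul_apply, LinearMap.add_apply, LinearMap.smul_apply, Module.End.one_apply]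
  rcases 𝓡.length_simple_mul_trichotomy i r with up | fixed | down
  · rw [leftS_basisT_of_length_eq_add_one up, leftS_basisT_of_length_add_one_eq,
      simple_mul_simple_mul]
    rw [simple_mul_simple_mul, up]
  · rw [leftS_basisT_of_simple_mul_eq fixed, map_smul, leftS_basisT_of_simple_mul_eq fixed]
    module
  · rw [leftS_basisT_of_length_add_one_eq down, map_add, map_smul, map_smul,
      leftS_basisT_of_length_add_one_eq down, leftS_basisT_of_length_eq_add_one,
      simple_mul_simple_mul]
    rw [simple_mul_simple_mul, down]

theorem mirror_leftS_mul_self (i : B) :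
    𝓡.mirror (𝓡.leftS i) * 𝓡.mirror (𝓡.leftS i) =
      (X - 1 : ℤ[X]) • 𝓡.mirror (𝓡.leftS i) + (X : ℤ[X]) • 1 := by
  rw [← map_mul, leftS_mul_self, map_add, map_smul, map_smul, map_one]

variable {𝓡}

/-- This disposes of the vectors `T_r` with `ℓ(sr) < ℓ(r)`, because then `T_r = T_s T_{sr}`. -/
theorem apply_comm_of_mul_self_eq {A V : Type*} [CommRing A] [AddCommGroup V] [Module A V] {a b : A}
    {F L : Module.End A V} (mul_self : L * L = a • L + b • 1) {v : V}
    (comm : F (L v) = L (F v)) : F (L (L v)) = L (F (L v)) := by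
  have apply_apply (x : V) : L (L x) = a • L x + b • x := LinearMap.congr_fun mul_self x
  rw [comm, apply_apply, apply_apply, map_add, map_smul, map_smul, comm]

theorem leftS_mirror_leftS_comm_of_up {i j : B} {r : R}
    (left_up : 𝓡.length (𝓡.cs.simple i * r) = 𝓡.length r + 1)
    (right_up : 𝓡.length (r * 𝓡.cs.simple j) = 𝓡.length r + 1) :
    𝓡.leftS i (𝓡.mirror (𝓡.leftS j) (basisT r)) =
      𝓡.mirror (𝓡.leftS j) (𝓡.leftS i (basisT r)) := by
  have assoc := mul_assoc (𝓡.cs.simple i : R) r (𝓡.cs.simple j : R)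
  rcases 𝓡.length_simple_mul_trichotomy i (r * 𝓡.cs.simple j) with up | fixed | down
  · rw [mirror_leftS_basisT_of_length_eq_add_one right_up, leftS_basisT_of_length_eq_add_one up,
      leftS_basisT_of_length_eq_add_one left_up, mirror_leftS_basisT_of_length_eq_add_one, assoc]
    rw [assoc, up, left_up, right_up]
  · rw [← assoc, Units.mul_left_inj] at fixed
    rw [fixed] at left_up
    lia
  · have simple_mul_eq : (𝓡.cs.simple i : R) * r = r * 𝓡.cs.simple j :=
      𝓡.coe_simple_mul_eq_mul_coe_simple (by lia) (by lia) (by rw [assoc]; lia)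
    have leftS_eq : 𝓡.leftS i (basisT r) = 𝓡.mirror (𝓡.leftS j) (basisT r) := by
      rw [leftS_basisT_of_length_eq_add_one left_up, simple_mul_eq,
        mirror_leftS_basisT_of_length_eq_add_one right_up]
    have left_mul_self := LinearMap.congr_fun (𝓡.leftS_mul_self i) (basisT r)
    have right_mul_self := LinearMap.congr_fun (𝓡.mirror_leftS_mul_self j) (basisT r)
    simp only [Module.End.mul_apply, LinearMap.add_apply, LinearMap.smul_apply, leftS_eq]
      at left_mul_self right_mul_self ⊢
    rw [left_mul_self, right_mul_self]

variable (𝓡)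

theorem commute_leftS_mirror_leftS (i j : B) : Commute (𝓡.leftS i) (𝓡.mirror (𝓡.leftS j)) := by
  refine end_ext fun r => ?_
  simp only [Module.End.mul_apply]
  induction hn : 𝓡.length r using Nat.strong_induction_on generalizing r with | _ n ih
  subst hn
  rcases or_assoc.2 (𝓡.length_simple_mul_trichotomy i r) with left | left_down
  · rcases or_assoc.2 (𝓡.length_mul_simple_trichotomy j r) with right | right_down
    · rcases left with left_up | left_fixed <;> rcases right with right_up | right_fixed
      · exact leftS_mirror_leftS_comm_of_up left_up right_up
      · rw [leftS_basisT_of_length_eq_add_one left_up,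
          mirror_leftS_basisT_of_mul_simple_eq right_fixed, map_smul,
          leftS_basisT_of_length_eq_add_one left_up, mirror_leftS_basisT_of_mul_simple_eq]
        rw [mul_assoc, right_fixed]
      · rw [leftS_basisT_of_simple_mul_eq left_fixed, map_smul,
          mirror_leftS_basisT_of_length_eq_add_one right_up, leftS_basisT_of_simple_mul_eq]
        rw [← mul_assoc, left_fixed]
      · rw [leftS_basisT_of_simple_mul_eq left_fixed, map_smul,
          mirror_leftS_basisT_of_mul_simple_eq right_fixed, map_smul,
          leftS_basisT_of_simple_mul_eq left_fixed]
    · have basisT_eq : 𝓡.mirror (𝓡.leftS j) (basisT (r * 𝓡.cs.simple j)) = basisT r := by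
        rw [mirror_leftS_basisT_of_length_eq_add_one, mul_simple_mul_simple]
        rw [mul_simple_mul_simple, right_down]
      rw [← basisT_eq]
      exact apply_comm_of_mul_self_eq (𝓡.mirror_leftS_mul_self j) (ih _ (by lia) _ rfl)
  · have basisT_eq : 𝓡.leftS i (basisT (𝓡.cs.simple i * r)) = basisT r := by
      rw [leftS_basisT_of_length_eq_add_one, simple_mul_simple_mul]
      rw [simple_mul_simple_mul, left_down]
    rw [← basisT_eq]
    exact (apply_comm_of_mul_self_eq (𝓡.leftS_mul_self i) (ih _ (by lia) _ rfl).symm).symm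

theorem leftS_mirror_leftΛ_comm_of_up (he : e ∈ 𝓡.Λ) {i : B} {r : R}
    (up : 𝓡.length (𝓡.cs.simple i * r) = 𝓡.length r + 1) :
    𝓡.leftS i (𝓡.mirror (𝓡.leftΛ e) (basisT r)) =
      𝓡.mirror (𝓡.leftΛ e) (𝓡.leftS i (basisT r)) := by
  have length_le := 𝓡.length_mul_lambda_le_length_simple_mul he up
  have length_mul_le := 𝓡.length_mul_le_of_right_mem_Λ he r
  have assoc := mul_assoc (𝓡.cs.simple i : R) r e
  rw [leftS_basisT_of_length_eq_add_one up, mirror_leftΛ_basisT (𝓡.isIdempotentElem e he),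
    mirror_leftΛ_basisT (𝓡.isIdempotentElem e he), map_smul, assoc]
  rcases 𝓡.length_simple_mul_trichotomy i (r * e) with up' | fixed | down
  · rw [leftS_basisT_of_length_eq_add_one up', up, up', Nat.add_sub_add_right]
  · rw [leftS_basisT_of_simple_mul_eq fixed, fixed, up, smul_smul, ← pow_succ,
      Nat.sub_add_comm length_mul_le]
  · lia

theorem commute_leftS_mirror_leftΛ (i : B) (he : e ∈ 𝓡.Λ) :
    Commute (𝓡.leftS i) (𝓡.mirror (𝓡.leftΛ e)) := by
  refine end_ext fun r => ?_
  simp only [Module.End.mul_apply]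
  rcases 𝓡.length_simple_mul_trichotomy i r with up | fixed | down
  · exact 𝓡.leftS_mirror_leftΛ_comm_of_up he up
  · rw [leftS_basisT_of_simple_mul_eq fixed, map_smul,
      mirror_leftΛ_basisT (𝓡.isIdempotentElem e he), map_smul, leftS_basisT_of_simple_mul_eq,
      smul_comm]
    rw [← mul_assoc, fixed]
  · have up : 𝓡.length (𝓡.cs.simple i * (𝓡.cs.simple i * r)) =
        𝓡.length (𝓡.cs.simple i * r) + 1 := by
      rw [simple_mul_simple_mul, down]
    have comm := (𝓡.leftS_mirror_leftΛ_comm_of_up he up).symm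
    simpa only [leftS_basisT_of_length_eq_add_one up, simple_mul_simple_mul] using
      (apply_comm_of_mul_self_eq (𝓡.leftS_mul_self i) comm).symm

theorem commute_leftΛ_mirror_leftΛ (he : e ∈ 𝓡.Λ) (hf : f ∈ 𝓡.Λ) :
    Commute (𝓡.leftΛ e) (𝓡.mirror (𝓡.leftΛ f)) := by
  refine end_ext fun r => ?_
  have mul_le := 𝓡.length_mul_le_of_left_mem_Λ he r
  have mul_mul_le := 𝓡.length_mul_le_of_left_mem_Λ he (r * f)
  have le_mul := 𝓡.length_mul_le_of_right_mem_Λ hf r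
  have le_mul_mul := 𝓡.length_mul_le_of_right_mem_Λ hf (e * r)
  simp only [Module.End.mul_apply, leftΛ_basisT, mirror_leftΛ_basisT (𝓡.isIdempotentElem f hf),
    map_smul, smul_smul, ← pow_add, mul_assoc] at *
  congr 2
  lia

theorem commute_leftOp_mirror_leftOp :
    ∀ x y : 𝓡.Letter, Commute (𝓡.leftOp x) (𝓡.mirror (𝓡.leftOp y))
  | Sum.inl i, Sum.inl j => 𝓡.commute_leftS_mirror_leftS i j
  | Sum.inl i, Sum.inr f => 𝓡.commute_leftS_mirror_leftΛ i f.2.1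
  | Sum.inr e, Sum.inl j => commute_mirror_comm (𝓡.commute_leftS_mirror_leftΛ j e.2.1)
  | Sum.inr e, Sum.inr f => 𝓡.commute_leftΛ_mirror_leftΛ e.2.1 f.2.1

variable {𝓡}

theorem leftOp_basisT {x : 𝓡.Letter} {r : R}
    (h : 𝓡.length (𝓡.letterVal x * r) = 𝓡.letterLength x + 𝓡.length r) :
    𝓡.leftOp x (basisT r) = basisT (𝓡.letterVal x * r) := by
  rcases x with i | e
  · exact leftS_basisT_of_length_eq_add_one (h.trans (add_comm _ _))
  · refine (leftΛ_basisT _ _).trans ?_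
    have length_eq : 𝓡.length (e * r) = 𝓡.length r := h.trans (zero_add _)
    rw [length_eq, Nat.sub_self, pow_zero, one_smul]
    rfl

theorem prod_leftOp_basisT_one {ω : List 𝓡.Letter}
    (h : (ω.map 𝓡.letterLength).sum = 𝓡.length (ω.map 𝓡.letterVal).prod) :
    (ω.map 𝓡.leftOp).prod (basisT 1) = basisT (ω.map 𝓡.letterVal).prod := by
  induction ω with
  | nil => simp
  | cons x ω ih =>
    simp only [List.map_cons, List.prod_cons, List.sum_cons] at h ⊢
    have length_mul_le := 𝓡.length_mul_le (𝓡.letterVal x) (ω.map 𝓡.letterVal).prod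
    have length_letterVal_le := 𝓡.length_letterVal_le x
    have length_prod_le := 𝓡.length_prod_letterVal_le ω
    rw [Module.End.mul_apply, ih (by lia), leftOp_basisT (by lia)]

variable (𝓡)

theorem exists_prod_leftOp_basisT_one_eq (r : R) :
    ∃ ω : List 𝓡.Letter, (ω.map 𝓡.leftOp).prod (basisT 1) = basisT r := by
  obtain ⟨ω, rfl, sum_eq⟩ := 𝓡.exists_word_sum_letterLength_eq r
  exact ⟨ω, prod_leftOp_basisT_one sum_eq⟩

variable {𝓡}

theorem eq_of_commute_mirror_leftOp {F G : Module.End ℤ[X] (R →₀ ℤ[X])}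
    (hF : ∀ x, Commute F (𝓡.mirror (𝓡.leftOp x))) (hG : ∀ x, Commute G (𝓡.mirror (𝓡.leftOp x)))
    (h : F (basisT 1) = G (basisT 1)) : F = G := by
  refine end_ext fun r => ?_
  obtain ⟨ω, hω⟩ := 𝓡.exists_prod_leftOp_basisT_one_eq (𝓡.factorisable.involution r)
  have basisT_eq : 𝓡.mirror (ω.map 𝓡.leftOp).prod (basisT 1) = basisT r := by
    rw [mirror_basisT, 𝓡.factorisable.involution_one, hω, basisInvolution_basisT,
      𝓡.factorisable.involution_involutive]
  have commute_prod {F : Module.End ℤ[X] (R →₀ ℤ[X])}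
      (hF : ∀ x, Commute F (𝓡.mirror (𝓡.leftOp x))) :
      Commute F (𝓡.mirror (ω.map 𝓡.leftOp).prod) := by
    rw [map_list_prod, List.map_map]
    exact Commute.list_prod_right _ _ (List.forall_mem_map.2 fun x _ => hF x)
  rw [← basisT_eq, ← Module.End.mul_apply, ← Module.End.mul_apply, (commute_prod hF).eq,
    (commute_prod hG).eq, Module.End.mul_apply, h, Module.End.mul_apply]

theorem prod_leftS_basisT {ω : List B} {r : R}
    (h : 𝓡.length (𝓡.cs.wordProd ω * r) = ω.length + 𝓡.length r) :
    (ω.map 𝓡.leftS).prod (basisT r) = basisT (𝓡.cs.wordProd ω * r) := by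
  induction ω with
  | nil => simp
  | cons i ω ih =>
    rw [wordProd_cons, Units.val_mul, mul_assoc, List.length_cons] at h
    have length_simple_mul_le := 𝓡.length_mul_le (𝓡.cs.simple i) (𝓡.cs.wordProd ω * r)
    have length_wordProd_mul_le := 𝓡.length_mul_le (𝓡.cs.wordProd ω) r
    have length_wordProd_le := 𝓡.length_wordProd_le ω
    rw [𝓡.length_simple] at length_simple_mul_le
    rw [List.map_cons, List.prod_cons, Module.End.mul_apply, ih (by lia),
      leftS_basisT_of_length_eq_add_one (by lia), wordProd_cons, Units.val_mul, mul_assoc]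

theorem prod_leftS_basisT_one {ω : List B} (h : 𝓡.cs.IsReduced ω) :
    (ω.map 𝓡.leftS).prod (basisT 1) = basisT (𝓡.cs.wordProd ω : R) := by
  rw [prod_leftS_basisT, mul_one]
  rw [mul_one, length_units, h.eq, 𝓡.length_one, add_zero]

variable (𝓡)

theorem leftS_basisT_one (i : B) : 𝓡.leftS i (basisT 1) = basisT (𝓡.cs.simple i : R) := by
  rw [leftS_basisT_of_length_eq_add_one, mul_one]
  rw [mul_one, length_simple, 𝓡.length_one]

theorem leftΛ_basisT_one (e : R) : 𝓡.leftΛ e (basisT 1) = basisT e := by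
  rw [leftΛ_basisT, 𝓡.length_one, Nat.zero_sub, pow_zero, one_smul, mul_one]

end Operators

end RennerCoxeterSystem

namespace RennerCoxeterSystem

open CoxeterSystem CoxeterGroup

variable {B R : Type*} [Monoid R] {M : CoxeterMatrix B} (𝓡 : RennerCoxeterSystem M R)

section Representation

theorem map_altProd {A A' F : Type*} [Monoid A] [Monoid A'] [FunLike F A A'] [MonoidHomClass F A A']
    (φ : F) (a b : A) (m : ℕ) : φ (altProd a b m) = altProd (φ a) (φ b) m := by
  induction m generalizing a b with
  | zero => exact map_one φ
  | succ m ih => rw [altProd, map_mul, ih, altProd]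

/-- The action of the free algebra on the free module in which the generators `T_x` act by the
operators `leftOp x`. -/
noncomputable def freeAction : FreeAlgebra ℤ[X] 𝓡.Letter →ₐ[ℤ[X]] Module.End ℤ[X] (R →₀ ℤ[X]) :=
  FreeAlgebra.lift ℤ[X] 𝓡.leftOp

theorem freeAction_genS (i : B) : 𝓡.freeAction (𝓡.genS i) = 𝓡.leftS i :=
  FreeAlgebra.lift_ι_apply _ _

theorem freeAction_genΛ (e : 𝓡.LambdaCirc) : 𝓡.freeAction (𝓡.genΛ e) = 𝓡.leftΛ e :=
  FreeAlgebra.lift_ι_apply _ _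

theorem freeAction_genWord (ω : List B) :
    𝓡.freeAction (𝓡.genWord ω) = (ω.map 𝓡.leftS).prod := by
  rw [genWord, map_list_prod, List.map_map]
  exact congrArg _ (List.map_congr_left fun i _ => 𝓡.freeAction_genS i)

theorem commute_freeAction_mirror_leftOp (a : FreeAlgebra ℤ[X] 𝓡.Letter) (x : 𝓡.Letter) :
    Commute (𝓡.freeAction a) (𝓡.mirror (𝓡.leftOp x)) := by
  induction a using FreeAlgebra.induction with
  | grade0 c =>
    rw [AlgHom.commutes]
    exact Algebra.commutes c _
  | grade1 y =>
    rw [freeAction, FreeAlgebra.lift_ι_apply]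
    exact 𝓡.commute_leftOp_mirror_leftOp y x
  | mul a b ha hb => rw [map_mul]; exact ha.mul_left hb
  | add a b ha hb => rw [map_add]; exact ha.add_left hb

variable {𝓡}

theorem altProd_leftS_basisT_one {i j : B} (hij : i ≠ j) :
    altProd (𝓡.leftS i) (𝓡.leftS j) (M i j) (basisT 1) =
      basisT (𝓡.cs.wordProd (altWord i j (M i j)) : R) := by
  rw [← prod_map_altWord, prod_leftS_basisT_one (isReduced_altWord hij le_rfl)]

theorem altProd_leftS_basisT_one_braid {i j : B} (hij : i ≠ j) :
    altProd (𝓡.leftS i) (𝓡.leftS j) (M i j) (basisT 1) =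
      altProd (𝓡.leftS j) (𝓡.leftS i) (M i j) (basisT 1) := by
  rw [altProd_leftS_basisT_one hij, wordProd_altWord_braid, M.symmetric i j,
    altProd_leftS_basisT_one hij.symm]

theorem leftS_leftΛ_basisT_one_of_mem_upperType {i : B} {e : R} (he : e ∈ 𝓡.Λ)
    (hi : i ∈ upperType 𝓡.cs e) :
    𝓡.leftS i (𝓡.leftΛ e (basisT 1)) = 𝓡.leftΛ e (𝓡.leftS i (basisT 1)) := by
  have length_eq := 𝓡.length_units_mul_of_isRightReduced he
    (𝓡.isRightReduced_of_mem_upperType (simple_mem_standardParabolic 𝓡.cs hi))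
  rw [CoxeterSystem.length_simple] at length_eq
  rw [leftΛ_basisT_one, leftS_basisT_one, leftΛ_basisT, ← hi.1, length_eq, 𝓡.length_simple,
    Nat.sub_self, pow_zero, one_smul, leftS_basisT_of_length_eq_add_one]
  rw [length_eq, 𝓡.length_of_mem_Λ he]

theorem leftS_leftΛ_basisT_one_of_mem_lowerType {i : B} {e : R} (hi : i ∈ lowerType 𝓡.cs e) :
    𝓡.leftS i (𝓡.leftΛ e (basisT 1)) = (X : ℤ[X]) • 𝓡.leftΛ e (basisT 1) := by
  rw [leftΛ_basisT_one, leftS_basisT_of_simple_mul_eq hi.1]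

theorem leftΛ_leftS_basisT_one_of_mem_lowerType {i : B} {e : R} (he : e ∈ 𝓡.Λ)
    (hi : i ∈ lowerType 𝓡.cs e) :
    𝓡.leftΛ e (𝓡.leftS i (basisT 1)) = (X : ℤ[X]) • 𝓡.leftΛ e (basisT 1) := by
  rw [leftΛ_basisT_one, leftS_basisT_one, leftΛ_basisT, hi.2, 𝓡.length_simple,
    𝓡.length_of_mem_Λ he, Nat.sub_zero, pow_one]

theorem leftΛ_prod_leftS_leftΛ_basisT_one {e f h : R} (he : e ∈ 𝓡.Λ) (hf : f ∈ 𝓡.Λ) {ω : List B}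
    (hω : 𝓡.cs.IsReduced ω) (hred : 𝓡.cs.wordProd ω ∈ 𝓡.Red e f)
    (hh : 𝓡.IsWedge e (𝓡.cs.wordProd ω) f h) :
    𝓡.leftΛ e ((ω.map 𝓡.leftS).prod (𝓡.leftΛ f (basisT 1))) =
      (X ^ ω.length : ℤ[X]) • 𝓡.leftΛ h (basisT 1) := by
  have length_eq : 𝓡.length (𝓡.cs.wordProd ω * f) = ω.length := by
    rw [𝓡.length_units_mul_of_isRightReduced hf, hω.eq]
    exact (isRightReduced_of_isDoubleReduced hred).mono (𝓡.lowerType_subset_typeMap f)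
  rw [leftΛ_basisT_one, leftΛ_basisT_one, prod_leftS_basisT, leftΛ_basisT, ← mul_assoc,
    ← (𝓡.isWedge_iff he hf hred).1 hh, length_eq, 𝓡.length_of_mem_Λ hh.1, Nat.sub_zero]
  rw [length_eq, 𝓡.length_of_mem_Λ hf, add_zero]

variable (𝓡) {word : Rˣ → List B}
variable (hword : ∀ w : Rˣ, 𝓡.cs.IsReduced (word w) ∧ 𝓡.cs.wordProd (word w) = w)
include hword

theorem freeAction_eq_of_heckeRel {a b : FreeAlgebra ℤ[X] 𝓡.Letter} (h : 𝓡.HeckeRel word a b) :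
    𝓡.freeAction a = 𝓡.freeAction b := by
  refine eq_of_commute_mirror_leftOp (𝓡.commute_freeAction_mirror_leftOp a)
    (𝓡.commute_freeAction_mirror_leftOp b) ?_
  cases h with
  | quadratic i =>
    rw [map_mul, map_add, map_smul, map_smul, map_one, freeAction_genS, leftS_mul_self]
  | braid i j hij _ =>
    rw [map_altProd, map_altProd, freeAction_genS, freeAction_genS,
      altProd_leftS_basisT_one_braid hij]
  | upper i e hi =>
    simpa only [map_mul, Module.End.mul_apply, freeAction_genS, freeAction_genΛ] using
      leftS_leftΛ_basisT_one_of_mem_upperType e.2.1 hi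
  | lower_left i e hi =>
    simpa only [map_mul, map_smul, Module.End.mul_apply, LinearMap.smul_apply, freeAction_genS,
      freeAction_genΛ] using
      leftS_leftΛ_basisT_one_of_mem_lowerType hi
  | lower_right i e hi =>
    simpa only [map_mul, map_smul, Module.End.mul_apply, LinearMap.smul_apply, freeAction_genS,
      freeAction_genΛ] using
      leftΛ_leftS_basisT_one_of_mem_lowerType e.2.1 hi
  | wedge e f h w hw hh =>
    obtain ⟨word_reduced, wordProd_word⟩ := hword w
    rw [← wordProd_word] at hw hh
    have length_word := word_reduced.eq
    rw [wordProd_word] at length_word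
    simpa only [map_mul, map_smul, Module.End.mul_apply, LinearMap.smul_apply, freeAction_genWord,
      freeAction_genΛ, length_word] using
      leftΛ_prod_leftS_leftΛ_basisT_one e.2.1 f.2.1 word_reduced hw hh

/-- The action of the presented algebra on the free module in which the generators `T_x` act by the
operators `leftOp x`. -/
noncomputable def presentedAction :
    𝓡.PresentedHecke word →ₐ[ℤ[X]] Module.End ℤ[X] (R →₀ ℤ[X]) :=
  RingQuot.liftAlgHom ℤ[X] ⟨𝓡.freeAction, fun _ _ h => 𝓡.freeAction_eq_of_heckeRel hword h⟩

theorem presentedAction_mkAlgHom (a : FreeAlgebra ℤ[X] 𝓡.Letter) :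
    𝓡.presentedAction hword (RingQuot.mkAlgHom ℤ[X] (𝓡.HeckeRel word) a) = 𝓡.freeAction a :=
  RingQuot.liftAlgHom_mkAlgHom_apply _ _ _ _

theorem presentedAction_presentedGen (x : 𝓡.Letter) :
    𝓡.presentedAction hword (𝓡.presentedGen word x) = 𝓡.leftOp x := by
  rw [presentedGen, presentedAction_mkAlgHom, freeAction, FreeAlgebra.lift_ι_apply]

end Representation

end RennerCoxeterSystem

namespace RennerCoxeterSystem

open CoxeterSystem CoxeterGroup

variable {B R : Type*} [Monoid R] {M : CoxeterMatrix B} (𝓡 : RennerCoxeterSystem M R)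
variable {e g : R} {i : B}

section Presentation

variable (word : Rˣ → List B)

/-- The generator `T_s` of the presented algebra. -/
noncomputable def presentedS (i : B) : 𝓡.PresentedHecke word := 𝓡.presentedGen word (Sum.inl i)

open Classical in
/-- The generator `T_g` of the presented algebra for `g ∈ Λ∘`, extended by `1` to all of `R`, so
that it is the unit for the remaining element `1` of `Λ`. -/
noncomputable def presentedΛ (g : R) : 𝓡.PresentedHecke word :=
  if h : g ∈ 𝓡.LambdaCirc then 𝓡.presentedGen word (Sum.inr ⟨g, h⟩) else 1

/-- The element `T_w` of the presented algebra, for a unit `w`. -/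
noncomputable def presentedW (w : Rˣ) : 𝓡.PresentedHecke word :=
  ((word w).map (𝓡.presentedS word)).prod

/-- The subalgebra of the presented algebra generated by the `T_s`, `s ∈ S`. -/
noncomputable def presentedUnits : Subalgebra ℤ[X] (𝓡.PresentedHecke word) :=
  Algebra.adjoin ℤ[X] (Set.range (𝓡.presentedS word))

/-- The element `T_u T_g T_v` of the presented algebra, where `u g v` is the normal form of `r`. -/
noncomputable def presentedNormal (r : R) : 𝓡.PresentedHecke word :=
  𝓡.presentedW word (𝓡.exists_isNormal r).choose *
    𝓡.presentedΛ word (𝓡.exists_isNormal r).choose_spec.choose *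
    𝓡.presentedW word (𝓡.exists_isNormal r).choose_spec.choose_spec.choose

/-- The submodule of the presented algebra spanned by the normal forms; it turns out to be a left
ideal that contains `1`, hence the whole algebra. -/
noncomputable def presentedNormalSpan : Submodule ℤ[X] (𝓡.PresentedHecke word) :=
  Submodule.span ℤ[X] (Set.range (𝓡.presentedNormal word))

variable {word}

theorem presentedΛ_of_mem (hg : g ∈ 𝓡.LambdaCirc) :
    𝓡.presentedΛ word g = 𝓡.presentedGen word (Sum.inr ⟨g, hg⟩) := dif_pos hg

theorem presentedΛ_one : 𝓡.presentedΛ word 1 = 1 := dif_neg fun h => h.2 rfl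

theorem mkAlgHom_genS (i : B) :
    RingQuot.mkAlgHom ℤ[X] (𝓡.HeckeRel word) (𝓡.genS i) = 𝓡.presentedS word i := rfl

theorem mkAlgHom_genΛ (hg : g ∈ 𝓡.LambdaCirc) :
    RingQuot.mkAlgHom ℤ[X] (𝓡.HeckeRel word) (𝓡.genΛ ⟨g, hg⟩) = 𝓡.presentedΛ word g :=
  (𝓡.presentedΛ_of_mem hg).symm

theorem mkAlgHom_genWord (w : Rˣ) :
    RingQuot.mkAlgHom ℤ[X] (𝓡.HeckeRel word) (𝓡.genWord (word w)) = 𝓡.presentedW word w := by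
  rw [genWord, map_list_prod, List.map_map]
  rfl

theorem presentedS_mul_self (i : B) : 𝓡.presentedS word i * 𝓡.presentedS word i =
    (X - 1 : ℤ[X]) • 𝓡.presentedS word i + (X : ℤ[X]) • 1 := by
  simpa only [map_mul, map_add, map_smul, map_one, mkAlgHom_genS] using
    RingQuot.mkAlgHom_rel ℤ[X] (HeckeRel.quadratic (𝓡 := 𝓡) (word := word) i)

theorem presentedS_braid (i j : B) (hij : i ≠ j) (hM : M i j ≠ 0) :
    altProd (𝓡.presentedS word i) (𝓡.presentedS word j) (M i j) =
      altProd (𝓡.presentedS word j) (𝓡.presentedS word i) (M i j) := by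
  simpa only [map_altProd, mkAlgHom_genS] using
    RingQuot.mkAlgHom_rel ℤ[X] (HeckeRel.braid (𝓡 := 𝓡) (word := word) i j hij hM)

theorem presentedS_mul_presentedΛ_of_mem_upperType (hg : g ∈ 𝓡.Λ) (hi : i ∈ upperType 𝓡.cs g) :
    𝓡.presentedS word i * 𝓡.presentedΛ word g = 𝓡.presentedΛ word g * 𝓡.presentedS word i := by
  by_cases g_eq : g = 1
  · rw [g_eq, presentedΛ_one, one_mul, mul_one]
  · have hg' : g ∈ 𝓡.LambdaCirc := ⟨hg, g_eq⟩
    simpa only [map_mul, mkAlgHom_genS, mkAlgHom_genΛ] using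
      RingQuot.mkAlgHom_rel ℤ[X] (HeckeRel.upper (𝓡 := 𝓡) (word := word) i ⟨g, hg'⟩ hi)

theorem presentedS_mul_presentedΛ_of_mem_lowerType (hg : g ∈ 𝓡.Λ) (hi : i ∈ lowerType 𝓡.cs g) :
    𝓡.presentedS word i * 𝓡.presentedΛ word g = (X : ℤ[X]) • 𝓡.presentedΛ word g := by
  have hg' : g ∈ 𝓡.LambdaCirc := ⟨hg, 𝓡.ne_one_of_mem_lowerType hi⟩
  simpa only [map_mul, map_smul, mkAlgHom_genS, mkAlgHom_genΛ] using
    RingQuot.mkAlgHom_rel ℤ[X] (HeckeRel.lower_left (𝓡 := 𝓡) (word := word) i ⟨g, hg'⟩ hi)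

theorem presentedΛ_mul_presentedS_of_mem_lowerType (hg : g ∈ 𝓡.Λ) (hi : i ∈ lowerType 𝓡.cs g) :
    𝓡.presentedΛ word g * 𝓡.presentedS word i = (X : ℤ[X]) • 𝓡.presentedΛ word g := by
  have hg' : g ∈ 𝓡.LambdaCirc := ⟨hg, 𝓡.ne_one_of_mem_lowerType hi⟩
  simpa only [map_mul, map_smul, mkAlgHom_genS, mkAlgHom_genΛ] using
    RingQuot.mkAlgHom_rel ℤ[X] (HeckeRel.lower_right (𝓡 := 𝓡) (word := word) i ⟨g, hg'⟩ hi)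

theorem presentedS_mem_presentedUnits (i : B) : 𝓡.presentedS word i ∈ 𝓡.presentedUnits word :=
  Algebra.subset_adjoin ⟨i, rfl⟩

theorem presentedW_mem_presentedUnits (w : Rˣ) : 𝓡.presentedW word w ∈ 𝓡.presentedUnits word := by
  refine Subalgebra.list_prod_mem _ fun x hx => ?_
  obtain ⟨i, -, rfl⟩ := List.mem_map.1 hx
  exact 𝓡.presentedS_mem_presentedUnits i

theorem IsNormal.presentedNormal_eq {𝓡 : RennerCoxeterSystem M R} {u v : Rˣ}
    (h : 𝓡.IsNormal u g v) :
    𝓡.presentedNormal word (u * g * v) =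
      𝓡.presentedW word u * 𝓡.presentedΛ word g * 𝓡.presentedW word v := by
  obtain ⟨h', h_eq⟩ := (𝓡.exists_isNormal (u * g * v)).choose_spec.choose_spec.choose_spec
  obtain ⟨u_eq, g_eq, v_eq⟩ := h'.unique h h_eq
  rw [presentedNormal, v_eq, g_eq, u_eq]

variable (hword : ∀ w : Rˣ, 𝓡.cs.IsReduced (word w) ∧ 𝓡.cs.wordProd (word w) = w)
include hword

theorem presentedW_wordProd {ω : List B} (hω : 𝓡.cs.IsReduced ω) :
    𝓡.presentedW word (𝓡.cs.wordProd ω) = (ω.map (𝓡.presentedS word)).prod :=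
  prod_map_eq_of_isReduced 𝓡.presentedS_braid (hword _).1 hω (hword _).2

theorem presentedW_one : 𝓡.presentedW word 1 = 1 := by
  simpa using 𝓡.presentedW_wordProd hword (ω := []) (by simp [CoxeterSystem.IsReduced])

theorem presentedW_simple (i : B) : 𝓡.presentedW word (𝓡.cs.simple i) = 𝓡.presentedS word i := by
  simpa using 𝓡.presentedW_wordProd hword (ω := [i]) (by simp [CoxeterSystem.IsReduced])

theorem presentedW_mul {u v : Rˣ} (h : 𝓡.cs.length (u * v) = 𝓡.cs.length u + 𝓡.cs.length v) :
    𝓡.presentedW word (u * v) = 𝓡.presentedW word u * 𝓡.presentedW word v := by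
  obtain ⟨ω, hω, rfl⟩ := 𝓡.cs.exists_isReduced u
  obtain ⟨ν, hν, rfl⟩ := 𝓡.cs.exists_isReduced v
  rw [← wordProd_append, 𝓡.presentedW_wordProd hword ((isReduced_append_iff hω hν).2 h),
    𝓡.presentedW_wordProd hword hω, 𝓡.presentedW_wordProd hword hν, List.map_append,
    List.prod_append]

theorem presentedW_simple_mul {w : Rˣ}
    (h : 𝓡.cs.length (𝓡.cs.simple i * w) = 𝓡.cs.length w + 1) :
    𝓡.presentedW word (𝓡.cs.simple i * w) = 𝓡.presentedS word i * 𝓡.presentedW word w := by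
  rw [𝓡.presentedW_mul hword (by rw [h, CoxeterSystem.length_simple, add_comm]),
    𝓡.presentedW_simple hword]

theorem presentedS_mul_presentedW_mem_span (i : B) (w : Rˣ) :
    𝓡.presentedS word i * 𝓡.presentedW word w ∈
      Submodule.span ℤ[X] (Set.range (𝓡.presentedW word)) := by
  rcases 𝓡.cs.length_simple_mul w i with length_eq | length_eq
  · rw [← 𝓡.presentedW_simple_mul hword length_eq]
    exact Submodule.subset_span ⟨_, rfl⟩
  · have eq_mul : 𝓡.presentedW word w =
        𝓡.presentedS word i * 𝓡.presentedW word (𝓡.cs.simple i * w) := by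
      rw [← 𝓡.presentedW_simple_mul hword (by rw [simple_mul_simple_cancel_left, length_eq]),
        simple_mul_simple_cancel_left]
    rw [eq_mul, ← mul_assoc, presentedS_mul_self, add_mul, smul_mul_assoc, ← eq_mul,
      smul_mul_assoc, one_mul]
    exact add_mem (Submodule.smul_mem _ _ (Submodule.subset_span ⟨_, rfl⟩))
      (Submodule.smul_mem _ _ (Submodule.subset_span ⟨_, rfl⟩))

theorem presentedS_mul_mem_span (i : B) {a : 𝓡.PresentedHecke word}
    (ha : a ∈ Submodule.span ℤ[X] (Set.range (𝓡.presentedW word))) :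
    𝓡.presentedS word i * a ∈ Submodule.span ℤ[X] (Set.range (𝓡.presentedW word)) := by
  suffices Submodule.span ℤ[X] (Set.range (𝓡.presentedW word)) ≤
      (Submodule.span ℤ[X] (Set.range (𝓡.presentedW word))).comap
        (LinearMap.mulLeft ℤ[X] (𝓡.presentedS word i)) from this ha
  exact Submodule.span_le.2
    (Set.range_subset_iff.2 (𝓡.presentedS_mul_presentedW_mem_span hword i))

theorem presentedUnits_le_span :
    Subalgebra.toSubmodule (𝓡.presentedUnits word) ≤
      Submodule.span ℤ[X] (Set.range (𝓡.presentedW word)) := by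
  rw [presentedUnits, Algebra.adjoin_eq_span, Submodule.span_le]
  intro a ha
  induction ha using Submonoid.closure_induction_left with
  | one => exact Submodule.subset_span ⟨1, 𝓡.presentedW_one hword⟩
  | mul_left x hx y _ hy =>
    obtain ⟨i, rfl⟩ := hx
    exact 𝓡.presentedS_mul_mem_span hword i hy

theorem exists_presentedΛ_mul_presentedW_eq (hg : g ∈ 𝓡.Λ) {c : Rˣ}
    (hc : c ∈ standardParabolic 𝓡.cs (typeMap 𝓡.cs g)) :
    ∃ a ∈ 𝓡.presentedUnits word,
      𝓡.presentedΛ word g * 𝓡.presentedW word c = a * 𝓡.presentedΛ word g := by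
  obtain ⟨ω, hω, hI, rfl⟩ := exists_isReduced_of_mem_standardParabolic hc
  rw [𝓡.presentedW_wordProd hword hω]
  clear hc hω
  induction ω with
  | nil => exact ⟨1, one_mem _, by rw [List.map_nil, List.prod_nil, mul_one, one_mul]⟩
  | cons i ω ih =>
    obtain ⟨a, ha, mul_eq⟩ := ih fun j hj => hI j (List.mem_cons_of_mem _ hj)
    rw [List.map_cons, List.prod_cons, ← mul_assoc]
    rcases 𝓡.mem_upperType_or_mem_lowerType (hI i List.mem_cons_self) with hi | hi
    · refine ⟨𝓡.presentedS word i * a,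
        MulMemClass.mul_mem (𝓡.presentedS_mem_presentedUnits i) ha, ?_⟩
      rw [← 𝓡.presentedS_mul_presentedΛ_of_mem_upperType hg hi, mul_assoc, mul_eq, mul_assoc]
    · refine ⟨(X : ℤ[X]) • a, Subalgebra.smul_mem _ ha _, ?_⟩
      rw [𝓡.presentedΛ_mul_presentedS_of_mem_lowerType hg hi, smul_mul_assoc, mul_eq,
        smul_mul_assoc]

theorem exists_presentedW_mul_presentedΛ_eq (hg : g ∈ 𝓡.Λ) {c : Rˣ}
    (hc : c ∈ standardParabolic 𝓡.cs (typeMap 𝓡.cs g)) :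
    ∃ a ∈ 𝓡.presentedUnits word,
      𝓡.presentedW word c * 𝓡.presentedΛ word g = 𝓡.presentedΛ word g * a := by
  obtain ⟨ω, hω, hI, rfl⟩ := exists_isReduced_of_mem_standardParabolic hc
  rw [𝓡.presentedW_wordProd hword hω]
  clear hc hω
  induction ω with
  | nil => exact ⟨1, one_mem _, by rw [List.map_nil, List.prod_nil, mul_one, one_mul]⟩
  | cons i ω ih =>
    obtain ⟨a, ha, mul_eq⟩ := ih fun j hj => hI j (List.mem_cons_of_mem _ hj)
    rw [List.map_cons, List.prod_cons, mul_assoc, mul_eq, ← mul_assoc]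
    rcases 𝓡.mem_upperType_or_mem_lowerType (hI i List.mem_cons_self) with hi | hi
    · refine ⟨𝓡.presentedS word i * a,
        MulMemClass.mul_mem (𝓡.presentedS_mem_presentedUnits i) ha, ?_⟩
      rw [𝓡.presentedS_mul_presentedΛ_of_mem_upperType hg hi, mul_assoc]
    · refine ⟨(X : ℤ[X]) • a, Subalgebra.smul_mem _ ha _, ?_⟩
      rw [𝓡.presentedS_mul_presentedΛ_of_mem_lowerType hg hi, smul_mul_assoc, mul_smul_comm]

theorem presentedW_mul_presentedΛ (hg : g ∈ 𝓡.Λ) {y : Rˣ}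
    (hy : y ∈ standardParabolic 𝓡.cs (lowerType 𝓡.cs g)) :
    𝓡.presentedW word y * 𝓡.presentedΛ word g =
      (X ^ 𝓡.cs.length y : ℤ[X]) • 𝓡.presentedΛ word g := by
  obtain ⟨ω, hω, hI, rfl⟩ := exists_isReduced_of_mem_standardParabolic hy
  rw [𝓡.presentedW_wordProd hword hω, hω.eq]
  clear hy hω
  induction ω with
  | nil => rw [List.map_nil, List.prod_nil, one_mul, List.length_nil, pow_zero, one_smul]
  | cons i ω ih =>
    rw [List.map_cons, List.prod_cons, mul_assoc, ih fun j hj => hI j (List.mem_cons_of_mem _ hj),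
      mul_smul_comm, 𝓡.presentedS_mul_presentedΛ_of_mem_lowerType hg (hI i List.mem_cons_self),
      smul_smul, ← pow_succ, List.length_cons]

theorem presentedΛ_mul_presentedW_mul_presentedΛ (he : e ∈ 𝓡.LambdaCirc) (hg : g ∈ 𝓡.Λ) {w : Rˣ}
    (hw : w ∈ 𝓡.Red e g) :
    𝓡.presentedΛ word e * 𝓡.presentedW word w * 𝓡.presentedΛ word g =
      (X ^ 𝓡.cs.length w : ℤ[X]) • 𝓡.presentedΛ word (e * w * g) := by
  by_cases g_eq : g = 1
  · subst g_eq
    obtain rfl : w = 1 := (isRightReduced_of_isDoubleReduced hw).eq_one (by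
      rw [← 𝓡.unitCentralizer_eq_standardParabolic hg, mem_unitCentralizer_iff, mul_one, one_mul])
    rw [presentedΛ_one, 𝓡.presentedW_one hword, CoxeterSystem.length_one, pow_zero, one_smul,
      Units.val_one, mul_one, mul_one, mul_one, mul_one]
  · have hg' : g ∈ 𝓡.LambdaCirc := ⟨hg, g_eq⟩
    have wedge := HeckeRel.wedge (𝓡 := 𝓡) (word := word) ⟨e, he⟩ ⟨g, hg'⟩
      ⟨_, 𝓡.mul_mul_mem_LambdaCirc he hg hw⟩ w hw ((𝓡.isWedge_iff he.1 hg hw).2 rfl)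
    simpa only [map_mul, map_smul, mkAlgHom_genΛ, mkAlgHom_genWord] using
      RingQuot.mkAlgHom_rel ℤ[X] wedge

theorem presentedW_mul_presentedΛ_mul_presentedW_mem (hg : g ∈ 𝓡.Λ) {v : Rˣ}
    (hv : IsLeftReduced 𝓡.cs (typeMap 𝓡.cs g) v) (u : Rˣ) :
    𝓡.presentedW word u * 𝓡.presentedΛ word g * 𝓡.presentedW word v ∈
      𝓡.presentedNormalSpan word := by
  obtain ⟨x, y, hx, hy, rfl⟩ := exists_isRightReduced_mul_eq 𝓡.cs (lowerType 𝓡.cs g) u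
  have h : 𝓡.IsNormal x g v := ⟨hg, hx, hv⟩
  rw [𝓡.presentedW_mul hword (hx.length_mul hy), mul_assoc (𝓡.presentedW word x),
    𝓡.presentedW_mul_presentedΛ hword hg hy, mul_smul_comm, smul_mul_assoc, ← h.presentedNormal_eq]
  exact Submodule.smul_mem _ _ (Submodule.subset_span ⟨_, rfl⟩)

theorem mul_presentedΛ_mul_presentedW_mem {a : 𝓡.PresentedHecke word}
    (ha : a ∈ 𝓡.presentedUnits word) (hg : g ∈ 𝓡.Λ) {v : Rˣ}
    (hv : IsLeftReduced 𝓡.cs (typeMap 𝓡.cs g) v) :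
    a * 𝓡.presentedΛ word g * 𝓡.presentedW word v ∈ 𝓡.presentedNormalSpan word := by
  suffices Submodule.span ℤ[X] (Set.range (𝓡.presentedW word)) ≤
      (𝓡.presentedNormalSpan word).comap
        (LinearMap.mulRight ℤ[X] (𝓡.presentedΛ word g * 𝓡.presentedW word v)) by
    rw [mul_assoc]
    exact this (𝓡.presentedUnits_le_span hword ha)
  refine Submodule.span_le.2 (Set.range_subset_iff.2 fun u => ?_)
  rw [SetLike.mem_coe, Submodule.mem_comap, LinearMap.mulRight_apply, ← mul_assoc]
  exact 𝓡.presentedW_mul_presentedΛ_mul_presentedW_mem hword hg hv u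

theorem mul_presentedΛ_mul_mem {a b : 𝓡.PresentedHecke word} (ha : a ∈ 𝓡.presentedUnits word)
    (hg : g ∈ 𝓡.Λ) (hb : b ∈ 𝓡.presentedUnits word) :
    a * 𝓡.presentedΛ word g * b ∈ 𝓡.presentedNormalSpan word := by
  suffices Submodule.span ℤ[X] (Set.range (𝓡.presentedW word)) ≤
      (𝓡.presentedNormalSpan word).comap (LinearMap.mulLeft ℤ[X] (a * 𝓡.presentedΛ word g)) from
    this (𝓡.presentedUnits_le_span hword hb)
  refine Submodule.span_le.2 (Set.range_subset_iff.2 fun v => ?_)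
  obtain ⟨c, d, hc, hd, rfl⟩ := exists_mul_isLeftReduced_eq 𝓡.cs (typeMap 𝓡.cs g) v
  obtain ⟨a', ha', mul_eq⟩ := 𝓡.exists_presentedΛ_mul_presentedW_eq hword hg hc
  rw [SetLike.mem_coe, Submodule.mem_comap, LinearMap.mulLeft_apply,
    𝓡.presentedW_mul hword (hd.length_mul hc), ← mul_assoc, mul_assoc a, mul_eq, ← mul_assoc]
  exact 𝓡.mul_presentedΛ_mul_presentedW_mem hword (MulMemClass.mul_mem ha ha') hg hd

theorem exists_presentedΛ_mul_presentedW_mul_presentedΛ_eq (he : e ∈ 𝓡.LambdaCirc) (hg : g ∈ 𝓡.Λ)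
    (u : Rˣ) :
    ∃ α ∈ 𝓡.presentedUnits word, ∃ w ∈ 𝓡.Red e g, ∃ β ∈ 𝓡.presentedUnits word,
      𝓡.presentedΛ word e * 𝓡.presentedW word u * 𝓡.presentedΛ word g =
        (X ^ 𝓡.cs.length w : ℤ[X]) • (α * 𝓡.presentedΛ word (e * w * g) * β) := by
  obtain ⟨a, ha, w, hw, b, hb, rfl, length_eq⟩ :=
    exists_mul_isDoubleReduced_mul_eq 𝓡.cs (typeMap 𝓡.cs e) (typeMap 𝓡.cs g) u
  have length_mul_mul_le := 𝓡.cs.length_mul_le (a * w) b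
  have length_mul_le := 𝓡.cs.length_mul_le a w
  obtain ⟨α, hα, left_eq⟩ := 𝓡.exists_presentedΛ_mul_presentedW_eq hword he.1 ha
  obtain ⟨β, hβ, right_eq⟩ := 𝓡.exists_presentedW_mul_presentedΛ_eq hword hg hb
  refine ⟨α, hα, w, hw, β, hβ, ?_⟩
  rw [𝓡.presentedW_mul hword (by lia), 𝓡.presentedW_mul hword (by lia)]
  calc 𝓡.presentedΛ word e * (𝓡.presentedW word a * 𝓡.presentedW word w * 𝓡.presentedW word b) *
        𝓡.presentedΛ word g
      = 𝓡.presentedΛ word e * 𝓡.presentedW word a * 𝓡.presentedW word w *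
          (𝓡.presentedW word b * 𝓡.presentedΛ word g) := by simp only [mul_assoc]
    _ = α * (𝓡.presentedΛ word e * 𝓡.presentedW word w * 𝓡.presentedΛ word g) * β := by
        rw [left_eq, right_eq]; simp only [mul_assoc]
    _ = (X ^ 𝓡.cs.length w : ℤ[X]) • (α * 𝓡.presentedΛ word (e * w * g) * β) := by
        rw [𝓡.presentedΛ_mul_presentedW_mul_presentedΛ hword he hg hw, mul_smul_comm,
          smul_mul_assoc]

theorem presentedGen_mul_presentedNormal_mem (x : 𝓡.Letter) (r : R) :
    𝓡.presentedGen word x * 𝓡.presentedNormal word r ∈ 𝓡.presentedNormalSpan word := by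
  obtain ⟨u, g, v, h, rfl⟩ := 𝓡.exists_isNormal r
  rw [h.presentedNormal_eq, ← mul_assoc, ← mul_assoc]
  rcases x with i | e
  · exact 𝓡.mul_presentedΛ_mul_mem hword (MulMemClass.mul_mem (𝓡.presentedS_mem_presentedUnits i)
      (𝓡.presentedW_mem_presentedUnits u)) h.mem (𝓡.presentedW_mem_presentedUnits v)
  · obtain ⟨α, hα, w, hw, β, hβ, mul_eq⟩ :=
      𝓡.exists_presentedΛ_mul_presentedW_mul_presentedΛ_eq hword e.2 h.mem u
    rw [← 𝓡.presentedΛ_of_mem e.2, mul_eq, smul_mul_assoc, mul_assoc _ β]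
    exact Submodule.smul_mem _ _ (𝓡.mul_presentedΛ_mul_mem hword hα
      (𝓡.mul_mul_mem_Λ e.2.1 h.mem hw)
      (MulMemClass.mul_mem hβ (𝓡.presentedW_mem_presentedUnits v)))

theorem presentedGen_mul_mem (x : 𝓡.Letter) {a : 𝓡.PresentedHecke word}
    (ha : a ∈ 𝓡.presentedNormalSpan word) :
    𝓡.presentedGen word x * a ∈ 𝓡.presentedNormalSpan word := by
  suffices 𝓡.presentedNormalSpan word ≤
      (𝓡.presentedNormalSpan word).comap (LinearMap.mulLeft ℤ[X] (𝓡.presentedGen word x)) from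
    this ha
  exact Submodule.span_le.2
    (Set.range_subset_iff.2 (𝓡.presentedGen_mul_presentedNormal_mem hword x))

theorem mkAlgHom_mul_mem (x : FreeAlgebra ℤ[X] 𝓡.Letter) {a : 𝓡.PresentedHecke word}
    (ha : a ∈ 𝓡.presentedNormalSpan word) :
    RingQuot.mkAlgHom ℤ[X] (𝓡.HeckeRel word) x * a ∈ 𝓡.presentedNormalSpan word := by
  induction x using FreeAlgebra.induction generalizing a with
  | grade0 c =>
    rw [AlgHom.commutes, ← Algebra.smul_def]
    exact Submodule.smul_mem _ _ ha
  | grade1 x => exact 𝓡.presentedGen_mul_mem hword x ha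
  | mul x y hx hy =>
    rw [map_mul, mul_assoc]
    exact hx (hy ha)
  | add x y hx hy =>
    rw [map_add, add_mul]
    exact add_mem (hx ha) (hy ha)

theorem one_mem_presentedNormalSpan : 1 ∈ 𝓡.presentedNormalSpan word := by
  simpa only [presentedΛ_one, one_mul] using
    𝓡.mul_presentedΛ_mul_mem hword (one_mem _) 𝓡.one_mem_Λ (one_mem _)

theorem presentedNormalSpan_eq_top : 𝓡.presentedNormalSpan word = ⊤ := by
  refine eq_top_iff.2 fun a _ => ?_
  obtain ⟨x, rfl⟩ := RingQuot.mkAlgHom_surjective ℤ[X] (𝓡.HeckeRel word) a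
  simpa only [mul_one] using 𝓡.mkAlgHom_mul_mem hword x (𝓡.one_mem_presentedNormalSpan hword)

theorem presentedAction_presentedW (w : Rˣ) :
    𝓡.presentedAction hword (𝓡.presentedW word w) = ((word w).map 𝓡.leftS).prod := by
  rw [← mkAlgHom_genWord, presentedAction_mkAlgHom, freeAction_genWord]

theorem presentedAction_presentedΛ (hg : g ∈ 𝓡.Λ) :
    𝓡.presentedAction hword (𝓡.presentedΛ word g) = 𝓡.leftΛ g := by
  by_cases g_eq : g = 1
  · subst g_eq
    rw [presentedΛ_one, map_one]
    refine end_ext fun r => ?_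
    rw [leftΛ_basisT, one_mul, Nat.sub_self, pow_zero, one_smul, Module.End.one_apply]
  · rw [𝓡.presentedΛ_of_mem ⟨hg, g_eq⟩, presentedAction_presentedGen]
    rfl

theorem presentedAction_presentedNormal_basisT_one (r : R) :
    𝓡.presentedAction hword (𝓡.presentedNormal word r) (basisT 1) = basisT r := by
  obtain ⟨u, g, v, h, rfl⟩ := 𝓡.exists_isNormal r
  have length_mul := 𝓡.length_mul_units_of_isLeftReduced h.mem h.left
  have length_word := (hword u).1.eq
  rw [(hword u).2] at length_word
  rw [h.presentedNormal_eq, map_mul, map_mul, 𝓡.presentedAction_presentedΛ hword h.mem,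
    presentedAction_presentedW, presentedAction_presentedW, Module.End.mul_apply,
    Module.End.mul_apply, prod_leftS_basisT_one (hword v).1, (hword v).2, leftΛ_basisT,
    length_units, length_mul, Nat.sub_self, pow_zero, one_smul, prod_leftS_basisT, (hword u).2,
    mul_assoc]
  rw [(hword u).2, ← mul_assoc, h.length_eq, length_mul, length_word]

/-- The value on `T_1` of the action of an element of the presented algebra. -/
noncomputable def presentedEval : 𝓡.PresentedHecke word →ₗ[ℤ[X]] (R →₀ ℤ[X]) :=
  LinearMap.applyₗ (basisT 1) ∘ₗ (𝓡.presentedAction hword).toLinearMap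

theorem presentedEval_linearCombination (c : R →₀ ℤ[X]) :
    𝓡.presentedEval hword (Finsupp.linearCombination ℤ[X] (𝓡.presentedNormal word) c) = c := by
  suffices 𝓡.presentedEval hword ∘ₗ Finsupp.linearCombination ℤ[X] (𝓡.presentedNormal word) =
      LinearMap.id from LinearMap.congr_fun this c
  refine end_ext fun r => ?_
  rw [LinearMap.comp_apply, basisT, Finsupp.linearCombination_single, one_smul]
  exact 𝓡.presentedAction_presentedNormal_basisT_one hword r

theorem bijective_presentedEval : Function.Bijective (𝓡.presentedEval hword) := by
  have surjective_linearCombination :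
      Function.Surjective (Finsupp.linearCombination ℤ[X] (𝓡.presentedNormal word)) := by
    rw [← LinearMap.range_eq_top, Finsupp.range_linearCombination]
    exact 𝓡.presentedNormalSpan_eq_top hword
  have leftInverse : Function.LeftInverse (𝓡.presentedEval hword)
      (Finsupp.linearCombination ℤ[X] (𝓡.presentedNormal word)) :=
    𝓡.presentedEval_linearCombination hword
  exact ⟨(leftInverse.rightInverse_of_surjective surjective_linearCombination).injective,
    leftInverse.surjective⟩

/-- `presentedEval` as a linear equivalence: the normal forms are a basis of the presented algebra,
and correspond to the `T_r`. -/
noncomputable def presentedEquiv : 𝓡.PresentedHecke word ≃ₗ[ℤ[X]] (R →₀ ℤ[X]) :=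
  LinearEquiv.ofBijective (𝓡.presentedEval hword) (𝓡.bijective_presentedEval hword)

theorem presentedEquiv_apply (a : 𝓡.PresentedHecke word) :
    𝓡.presentedEquiv hword a = 𝓡.presentedAction hword a (basisT 1) := rfl

theorem presentedEquiv_one : 𝓡.presentedEquiv hword 1 = basisT 1 := by
  rw [presentedEquiv_apply, map_one, Module.End.one_apply]

theorem presentedEquiv_presentedGen (x : 𝓡.Letter) :
    𝓡.presentedEquiv hword (𝓡.presentedGen word x) = basisT (𝓡.letterVal x) := by
  rw [presentedEquiv_apply, presentedAction_presentedGen]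
  rcases x with i | e
  · exact 𝓡.leftS_basisT_one i
  · exact 𝓡.leftΛ_basisT_one e

end Presentation

section HeckeAlgebra

variable {𝓡}
variable {μ ν : (R →₀ ℤ[X]) →ₗ[ℤ[X]] (R →₀ ℤ[X]) →ₗ[ℤ[X]] (R →₀ ℤ[X])}

theorem IsHeckeMul.apply_basisT_letterVal (hμ : 𝓡.IsHeckeMul μ) (x : 𝓡.Letter) :
    μ (basisT (𝓡.letterVal x)) = 𝓡.leftOp x := by
  refine end_ext fun r => ?_
  rcases x with i | e
  · change μ (basisT (𝓡.cs.simple i : R)) (basisT r) = 𝓡.leftS i (basisT r)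
    rcases 𝓡.length_simple_mul_trichotomy i r with length_eq | mul_eq | length_eq
    · rw [leftS_basisT_of_length_eq_add_one length_eq, hμ.simple_up i r length_eq]
    · rw [leftS_basisT_of_simple_mul_eq mul_eq, hμ.simple_eq i r (by rw [mul_eq])]
    · rw [leftS_basisT_of_length_add_one_eq length_eq, hμ.simple_down i r length_eq]
  · exact (hμ.lambda_mul e e.2 r).trans (leftΛ_basisT (e : R) r).symm

theorem IsHeckeMul.apply_prod_leftOp_basisT_one (hμ : 𝓡.IsHeckeMul μ) (ω : List 𝓡.Letter) :
    μ ((ω.map 𝓡.leftOp).prod (basisT 1)) = (ω.map 𝓡.leftOp).prod := by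
  induction ω with
  | nil => exact LinearMap.ext hμ.one_left
  | cons x ω ih =>
    rw [List.map_cons, List.prod_cons, Module.End.mul_apply, ← hμ.apply_basisT_letterVal]
    refine LinearMap.ext fun a => ?_
    rw [hμ.assoc, ih, Module.End.mul_apply]

theorem IsHeckeMul.unique (hμ : 𝓡.IsHeckeMul μ) (hν : 𝓡.IsHeckeMul ν) : μ = ν := by
  refine Finsupp.lhom_ext' fun r => LinearMap.ext_ring ?_
  change μ (basisT r) = ν (basisT r)
  obtain ⟨ω, hω⟩ := 𝓡.exists_prod_leftOp_basisT_one_eq r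
  rw [← hω, hμ.apply_prod_leftOp_basisT_one, hν.apply_prod_leftOp_basisT_one]

variable (𝓡) {word : Rˣ → List B}
variable (hword : ∀ w : Rˣ, 𝓡.cs.IsReduced (word w) ∧ 𝓡.cs.wordProd (word w) = w)

/-- The product of the generic Hecke algebra, transported from the presented algebra along
`presentedEquiv`. -/
noncomputable def heckeMul : (R →₀ ℤ[X]) →ₗ[ℤ[X]] (R →₀ ℤ[X]) →ₗ[ℤ[X]] (R →₀ ℤ[X]) :=
  (𝓡.presentedAction hword).toLinearMap ∘ₗ (𝓡.presentedEquiv hword).symm.toLinearMap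

theorem heckeMul_presentedEquiv (a : 𝓡.PresentedHecke word) :
    𝓡.heckeMul hword (𝓡.presentedEquiv hword a) = 𝓡.presentedAction hword a :=
  congrArg (𝓡.presentedAction hword) ((𝓡.presentedEquiv hword).symm_apply_apply a)

theorem heckeMul_presentedEquiv_presentedEquiv (a b : 𝓡.PresentedHecke word) :
    𝓡.heckeMul hword (𝓡.presentedEquiv hword a) (𝓡.presentedEquiv hword b) =
      𝓡.presentedEquiv hword (a * b) := by
  rw [heckeMul_presentedEquiv, presentedEquiv_apply, presentedEquiv_apply, map_mul,
    Module.End.mul_apply]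

theorem heckeMul_basisT_letterVal (x : 𝓡.Letter) :
    𝓡.heckeMul hword (basisT (𝓡.letterVal x)) = 𝓡.leftOp x := by
  rw [← 𝓡.presentedEquiv_presentedGen hword, heckeMul_presentedEquiv, presentedAction_presentedGen]

theorem heckeMul_basisT_simple (i : B) :
    𝓡.heckeMul hword (basisT (𝓡.cs.simple i : R)) = 𝓡.leftS i :=
  𝓡.heckeMul_basisT_letterVal hword (Sum.inl i)

theorem isHeckeMul_heckeMul : 𝓡.IsHeckeMul (𝓡.heckeMul hword) where
  assoc a b c := by
    obtain ⟨a, rfl⟩ := (𝓡.presentedEquiv hword).surjective a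
    obtain ⟨b, rfl⟩ := (𝓡.presentedEquiv hword).surjective b
    obtain ⟨c, rfl⟩ := (𝓡.presentedEquiv hword).surjective c
    simp only [heckeMul_presentedEquiv_presentedEquiv, mul_assoc]
  one_left a := by
    obtain ⟨a, rfl⟩ := (𝓡.presentedEquiv hword).surjective a
    rw [← 𝓡.presentedEquiv_one hword, heckeMul_presentedEquiv_presentedEquiv, one_mul]
  one_right a := by
    obtain ⟨a, rfl⟩ := (𝓡.presentedEquiv hword).surjective a
    rw [← 𝓡.presentedEquiv_one hword, heckeMul_presentedEquiv_presentedEquiv, mul_one]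
  simple_up i r h := by rw [heckeMul_basisT_simple, leftS_basisT_of_length_eq_add_one h]
  simple_eq i r h := by rw [heckeMul_basisT_simple, leftS_basisT_of_length_eq h]
  simple_down i r h := by rw [heckeMul_basisT_simple, leftS_basisT_of_length_add_one_eq h]
  lambda_mul e he r :=
    (LinearMap.congr_fun (𝓡.heckeMul_basisT_letterVal hword (Sum.inr ⟨e, he⟩)) _).trans
      (leftΛ_basisT e r)

variable {𝓡}

/-- The isomorphism of the presented algebra with the generic Hecke algebra. -/
noncomputable def presentedAlgEquiv (hμ : 𝓡.IsHeckeMul μ) :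
    𝓡.PresentedHecke word ≃ₐ[ℤ[X]] HeckeAlgebra hμ :=
  AlgEquiv.ofLinearEquiv (A₂ := HeckeAlgebra hμ) (𝓡.presentedEquiv hword)
    (𝓡.presentedEquiv_one hword) fun a b =>
      (𝓡.heckeMul_presentedEquiv_presentedEquiv hword a b).symm.trans
        (LinearMap.congr_fun₂ ((𝓡.isHeckeMul_heckeMul hword).unique hμ) _ _)

end HeckeAlgebra

end RennerCoxeterSystem

theorem mainTheorem6 {B R : Type*} [Monoid R] {M : CoxeterMatrix B}
    (𝓡 : RennerCoxeterSystem M R)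
    (word : Rˣ → List B)
    (hword : ∀ w : Rˣ, 𝓡.cs.IsReduced (word w) ∧ 𝓡.cs.wordProd (word w) = w) :
    (∃! μ : (R →₀ ℤ[X]) →ₗ[ℤ[X]] (R →₀ ℤ[X]) →ₗ[ℤ[X]] (R →₀ ℤ[X]), 𝓡.IsHeckeMul μ) ∧
    (∀ e ∈ 𝓡.LambdaCirc, ∀ f ∈ 𝓡.LambdaCirc, ∀ w ∈ 𝓡.Red e f,
      ∃! h : R, h ∈ 𝓡.LambdaCirc ∧ 𝓡.IsWedge e w f h) ∧
    ∀ (μ : (R →₀ ℤ[X]) →ₗ[ℤ[X]] (R →₀ ℤ[X]) →ₗ[ℤ[X]] (R →₀ ℤ[X])) (hμ : 𝓡.IsHeckeMul μ),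
      ∃ φ : 𝓡.PresentedHecke word ≃ₐ[ℤ[X]] RennerCoxeterSystem.HeckeAlgebra hμ,
        ∀ x : 𝓡.Letter, φ (𝓡.presentedGen word x) =
          RennerCoxeterSystem.HeckeAlgebra.T hμ (𝓡.letterVal x) :=
  ⟨⟨𝓡.heckeMul hword, 𝓡.isHeckeMul_heckeMul hword,
      fun _ hμ => hμ.unique (𝓡.isHeckeMul_heckeMul hword)⟩,
    fun _ he _ hf _ hw => 𝓡.existsUnique_wedge he hf hw,
    fun _ hμ => ⟨RennerCoxeterSystem.presentedAlgEquiv hword hμ,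
      𝓡.presentedEquiv_presentedGen hword⟩⟩
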